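/- Conventions. All $C^*$-algebras below are unital. A spectral triple $X=(\mathcal B,\mathcal H,D)$ on a $C^*$-algebra $\mathcal B$ consists of a faithful unital $*$-representation of $\mathcal B$ on a Hilbert space $\mathcal H$ and a selfadjoint operator $D$ on $\mathcal H$ with compact resolvent, such that $\mathcal C^1(X)=\{b\in\mathcal B:\|[D,b]\|<\infty\}$ is dense in $\mathcal B$. Here $\|[D,b]\|<\infty$ means that $D$ has a core invariant under $b$ on which $Db-bD$ is bounded, and $[D,b]$ then denotes its bounded extension. $X$ is a compact spectral metric space if $\{b\in\mathcal B:[D,b]=0\}=\mathbb C\mathbf 1$ and the Lipschitz ball $\{b\in\mathcal B:\|[D,b]\|\le 1\}$ has precompact image in $\mathcal B/\mathbb C\mathbf 1$. For an action $g\mapsto \eta_g$ of a topological group $G$ on $\mathcal B$ by $*$-automorphisms, $\mathcal C^1(G,X)$ is the set of $b\in\mathcal B$ such that $\|[D,\eta_g(b)]\|<\infty$ for all $g\in G$ and $g\mapsto[D,\eta_g(b)]$ is continuous in the strong operator topology, and $\mathcal C^1_b(G,X)=\{b\in\mathcal C^1(G,X):\sup_g\|[D,\eta_g(b)]\|<\infty\}$.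 The action is quasi-isometric on $X$ if $\mathcal C^1(X)=\mathcal C^1(G,X)$, and equicontinuous on $X$ if $\mathcal C^1(X)=\mathcal C^1_b(G,X)$. The group $\mathbb Z$ is discrete. Let $\mathcal A$ be a unital separable $C^*$-algebra and let $\alpha$ be a $*$-automorphism of $\mathcal A$. Let $\mathcal A\rtimes_\alpha\mathbb Z$ be the universal $C^*$-algebra generated by $\mathcal A$ and a unitary $u$ with $uau^{-1}=\alpha(a)$ for $a\in\mathcal A$. The dual action of the circle $\mathbb T=\{z\in\mathbb C:|z|=1\}$ on it is given by $\eta_z(a)=a$ for $a\in\mathcal A$ and $\eta_z(u)=zu$. For states $\rho,\omega$ of $\mathcal A$, the Connes metric of a spectral triple $X=(\mathcal A,\mathcal H,D)$ is $d_X(\rho,\omega)=\sup\{|\rho(a)-\omega(a)|:a\in\mathcal A,\ \|[D,a]\|\le1\}$, and the metric induced by a spectral triple $Y=(\mathcal A\rtimes_\alpha\mathbb Z,\mathcal K,\widehat D)$ is $d_Y(\rho,\omega)=\sup\{|\rho(a)-\omega(a)|:a\in\mathcal A,\ \|[\widehat D,a]\|\le1\}$. For compact spectral metric spaces $X=(\mathcal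 A,\mathcal H,D)$ and $Y=(\mathcal A\rtimes_\alpha\mathbb Z,\mathcal K,\widehat D)$ consider the conditions: (i) the dual action of $\mathbb T$ is quasi-isometric on $Y$; (ii) $u^{-1}[\widehat D,u]$ is bounded and commutes with the elements of $\mathcal A$; (iii) $d_X$ and $d_Y$ are equivalent: there is a constant $K\ge 0$ with $d_X\le K\,d_Y$ and $d_Y\le K\,d_X$ on the state space of $\mathcal A$. Theorem. (a) There is a compact spectral metric space $X$ on $\mathcal A$ on which the $\mathbb Z$-action $n\mapsto\alpha^n$ is equicontinuous if and only if there are a compact spectral metric space $X$ on $\mathcal A$ and a compact spectral metric space $Y$ on $\mathcal A\rtimes_\alpha\mathbb Z$ satisfying (i), (ii) and (iii). (b) Let $X$ be a compact spectral metric space on $\mathcal A$. The $\mathbb Z$-action $n\mapsto\alpha^n$ is equicontinuous on $X$ if and only if there is a compact spectral metric space $Y$ on $\mathcal A\rtimes_\alpha\mathbb Z$ satisfying (i), (ii) and (iii). (c) If $Y$ is a compact spectral metric space on $\mathcal A\rtimes_\alpha\mathbb Z$ satisfying (i) and (ii), then there is a compact spectral metric space $X$ on $\mathcal A$ on which the $\mathbb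 Z$-action $n\mapsto\alpha^n$ is equicontinuous and for which (iii) holds. -/

import Mathlib

open scoped ENNReal NNReal

universe u v

namespace SpectralMetric

noncomputable section

/-! ### Unbounded operators and commutators -/

section Operators

variable {H : Type u} [NormedAddCommGroup H] [InnerProductSpace ℂ H]

/-- `IsCommutator D S T` says that `[D, S]` is bounded and that its bounded extension is `T`:
there is a core of `D` that is invariant under `S` and on which `D S - S D` agrees with the bounded
operator `T`. -/
def IsCommutator (D : H →ₗ.[ℂ] H) (S T : H →L[ℂ] H) : Prop :=
  ∃ C : Submodule ℂ H, D.HasCore C ∧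
    ∀ x : D.domain, (x : H) ∈ C →
      ∃ y : D.domain, (y : H) = S x ∧ (y : H) ∈ C ∧ D y - S (D x) = T x

/-- Some resolvent `(z - D)⁻¹` exists and is a compact operator `R`. -/
def HasCompactResolvent (D : H →ₗ.[ℂ] H) : Prop :=
  ∃ (z : ℂ) (R : H →L[ℂ] H), IsCompactOperator R ∧
    (∀ x : H, ∃ y : D.domain, (y : H) = R x ∧ z • (y : H) - D y = x) ∧
    ∀ y : D.domain, R (z • (y : H) - D y) = y

/-- For a closed operator `D`, bounded commutators on an invariant core are the same as bounded
commutators on the whole domain. -/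
theorem isCommutator_iff_of_isClosed {D : H →ₗ.[ℂ] H} (hD : D.IsClosed) (S T : H →L[ℂ] H) :
    IsCommutator D S T ↔
      ∀ x : D.domain, ∃ y : D.domain, (y : H) = S x ∧ D y - S (D x) = T x := by
  constructor
  · rintro ⟨C, hC, h⟩ x
    have hcl : (D.domRestrict C).IsClosable :=
      hD.isClosable.leIsClosable D.domRestrict_le
    let F : H × H → H × H := fun p => (S p.1, S p.2 + T p.1)
    have hF : Continuous F := by fun_prop
    have hclosed : IsClosed (F ⁻¹' (D.graph : Set (H × H))) := IsClosed.preimage hF hD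
    have hsub : ((D.domRestrict C).graph : Set (H × H)) ⊆ F ⁻¹' (D.graph : Set (H × H)) := by
      rintro p hp
      obtain ⟨w, hw1, hw2⟩ := (LinearPMap.mem_graph_iff _).1 hp
      have hw : (w : H) ∈ C ⊓ D.domain := w.2
      have hval : D.domRestrict C w = D ⟨w, hw.2⟩ := LinearPMap.domRestrict_apply rfl
      obtain ⟨y, hy1, -, hy3⟩ := h ⟨w, hw.2⟩ hw.1
      refine (LinearPMap.mem_graph_iff _).2 ⟨y, ?_, ?_⟩
      · simp only [F]; rw [hy1, ← hw1]
      · simp only [F]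
        rw [← hw1, ← hw2, hval]
        exact (sub_eq_iff_eq_add'.1 hy3)
    have hx : ((x : H), D x) ∈ (D.domRestrict C).graph.topologicalClosure := by
      rw [hcl.graph_closure_eq_closure_graph, hC.closure_eq]
      exact D.mem_graph x
    have := closure_minimal hsub hclosed hx
    obtain ⟨y, hy1, hy2⟩ := (LinearPMap.mem_graph_iff _).1 this
    exact ⟨y, hy1, by rw [hy2]; simp [F]⟩
  · intro h
    refine ⟨D.domain, ⟨le_rfl, ?_⟩, fun x _ => ?_⟩
    · have : D.domRestrict D.domain = D := by
        refine LinearPMap.ext (by simp [LinearPMap.domRestrict_domain]) ?_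
        intro x h1 h2
        exact LinearPMap.domRestrict_apply rfl
      rw [this]
      refine LinearPMap.eq_of_eq_graph ?_
      rw [← hD.isClosable.graph_closure_eq_closure_graph]
      exact hD.submodule_topologicalClosure_eq
    · obtain ⟨y, hy1, hy2⟩ := h x
      exact ⟨y, hy1, y.2, hy2⟩

end Operators

/-! ### Spectral triples and compact spectral metric spaces -/

/-- A spectral triple `(B, H, D)` over a unital C⋆-algebra `B`. The algebra is identified with its
image in the bounded operators, i.e. the representation is faithful; being a unital homomorphism,
it is nondegenerate. -/
structure SpectralTriple (B : Type v) [CStarAlgebra B] where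
  H : Type u
  [normedAddCommGroup : NormedAddCommGroup H]
  [innerProductSpace : InnerProductSpace ℂ H]
  [completeSpace : CompleteSpace H]
  π : B →⋆ₐ[ℂ] (H →L[ℂ] H)
  π_injective : Function.Injective π
  D : H →ₗ.[ℂ] H
  isSelfAdjoint : IsSelfAdjoint D
  hasCompactResolvent : HasCompactResolvent D
  dense_bounded_commutator : Dense {b : B | ∃ T : H →L[ℂ] H, IsCommutator D (π b) T}

attribute [instance] SpectralTriple.normedAddCommGroup SpectralTriple.innerProductSpace
  SpectralTriple.completeSpace

namespace SpectralTriple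

variable {B : Type v} [CStarAlgebra B]

/-- The algebra `C¹(X)` of elements having a bounded commutator with `D`. -/
def C1 (X : SpectralTriple.{u} B) : Set B :=
  {b | ∃ T : X.H →L[ℂ] X.H, IsCommutator X.D (X.π b) T}

/-- The Lipschitz ball `{b | ‖[D, b]‖ ≤ 1}`. -/
def lipBall (X : SpectralTriple.{u} B) : Set B :=
  {b | ∃ T : X.H →L[ℂ] X.H, IsCommutator X.D (X.π b) T ∧ ‖T‖ ≤ 1}

/-- The metric commutant `{b | [D, b] = 0}`. -/
def metricCommutant (X : SpectralTriple.{u} B) : Set B :=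
  {b | IsCommutator X.D (X.π b) 0}

/-- A compact spectral metric space: the metric commutant consists of the multiples of the unit,
and the Lipschitz ball has precompact image in the quotient by the multiples of the unit. -/
structure IsCompactMetric (X : SpectralTriple.{u} B) : Prop where
  commutant_trivial : X.metricCommutant = (Submodule.span ℂ {(1 : B)} : Submodule ℂ B)
  lipBall_precompact :
    TotallyBounded ((Submodule.span ℂ {(1 : B)}).mkQ '' X.lipBall)

section Actions

variable {G : Type} [Group G] [TopologicalSpace G]

/-- `C¹(G, X)`: the elements `b` such that `[D, g(b)]` is bounded for every `g`, and depends
strongly continuously on `g`. -/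
def C1Action (X : SpectralTriple.{u} B) (act : G →* (B ≃⋆ₐ[ℂ] B)) : Set B :=
  {b | ∃ T : G → (X.H →L[ℂ] X.H),
    (∀ g, IsCommutator X.D (X.π (act g b)) (T g)) ∧ ∀ x, Continuous fun g => T g x}

/-- `C¹_b(G, X)`: the elements `b` of `C¹(G, X)` such that `‖[D, g(b)]‖` is bounded in `g`. -/
def C1bAction (X : SpectralTriple.{u} B) (act : G →* (B ≃⋆ₐ[ℂ] B)) : Set B :=
  {b | b ∈ X.C1Action act ∧ ∃ M : ℝ, ∀ g, ∃ T : X.H →L[ℂ] X.H,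
    IsCommutator X.D (X.π (act g b)) T ∧ ‖T‖ ≤ M}

/-- The action is quasi-isometric on `X`. -/
def IsQuasiIsometric (X : SpectralTriple.{u} B) (act : G →* (B ≃⋆ₐ[ℂ] B)) : Prop :=
  X.C1 = X.C1Action act

/-- The action is equicontinuous on `X`. -/
def IsEquicontinuous (X : SpectralTriple.{u} B) (act : G →* (B ≃⋆ₐ[ℂ] B)) : Prop :=
  X.C1 = X.C1bAction act

end Actions

/-- The `ℤ`-action `n ↦ αⁿ` (the group `ℤ` is discrete) is equicontinuous on `X`. -/
def IsEquicontinuousAut (X : SpectralTriple.{u} B) (α : B ≃⋆ₐ[ℂ] B) : Prop :=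
  X.IsEquicontinuous (zpowersHom (B ≃⋆ₐ[ℂ] B) α)

end SpectralTriple

/-! ### States and Connes metrics -/

/-- The states of a unital C⋆-algebra: the normalized positive functionals. -/
def IsState {A : Type v} [CStarAlgebra A] (ρ : A →L[ℂ] ℂ) : Prop :=
  (∀ a : A, ∃ r : ℝ, 0 ≤ r ∧ ρ (star a * a) = r) ∧ ρ 1 = 1

/-- The Connes metric that a spectral triple on `B` induces on the states of `A`, through a unital
homomorphism `j : A → B`: the supremum of `|ρ(a) - ω(a)|` over `a` in `A` with `‖[D, j(a)]‖ ≤ 1`. -/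
def inducedConnesDist {A : Type v} [CStarAlgebra A] {B : Type*} [CStarAlgebra B]
    (Y : SpectralTriple.{u} B) (j : A →⋆ₐ[ℂ] B) (ρ ω : A →L[ℂ] ℂ) : ℝ≥0∞ :=
  ⨆ a : A, ⨆ _ : j a ∈ Y.lipBall, ‖ρ a - ω a‖ₑ

/-- The Connes metric of a spectral triple. -/
def connesDist {A : Type v} [CStarAlgebra A] (X : SpectralTriple.{u} A) (ρ ω : A →L[ℂ] ℂ) : ℝ≥0∞ :=
  inducedConnesDist X (StarAlgHom.id ℂ A) ρ ω

/-- The Connes metric of `X` and the one induced by `Y` are equivalent on the state space of `A`: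
each is bounded by a constant multiple of the other. -/
def EquivalentConnesMetrics {A : Type v} [CStarAlgebra A] {B : Type*} [CStarAlgebra B]
    (X : SpectralTriple.{u} A) (Y : SpectralTriple.{u} B) (j : A →⋆ₐ[ℂ] B) : Prop :=
  ∃ K : ℝ≥0, ∀ ρ ω : A →L[ℂ] ℂ, IsState ρ → IsState ω →
    connesDist X ρ ω ≤ K * inducedConnesDist Y j ρ ω ∧
    inducedConnesDist Y j ρ ω ≤ K * connesDist X ρ ω

/-! ### The C⋆-algebra generated by a set -/

section Generated

variable {B : Type v} [CStarAlgebra B]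

/-- The unital C⋆-subalgebra generated by a set. -/
def cstarAdjoin (s : Set B) : StarSubalgebra ℂ B := (StarAlgebra.adjoin ℂ s).topologicalClosure

theorem isClosed_cstarAdjoin (s : Set B) : IsClosed (cstarAdjoin s : Set B) :=
  StarSubalgebra.isClosed_topologicalClosure _

theorem subset_cstarAdjoin (s : Set B) : s ⊆ cstarAdjoin s := fun _ hx =>
  StarSubalgebra.le_topologicalClosure _ (StarAlgebra.subset_adjoin ℂ _ hx)

theorem cstarAdjoin_le {s : Set B} {S : StarSubalgebra ℂ B} (hS : IsClosed (S : Set B))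
    (h : s ⊆ S) : cstarAdjoin s ≤ S :=
  StarSubalgebra.topologicalClosure_minimal (StarAlgebra.adjoin_le h) hS

instance (s : Set B) : CStarAlgebra (cstarAdjoin s) :=
  StarSubalgebra.cstarAlgebra (cstarAdjoin s) (h_closed := isClosed_cstarAdjoin s)

theorem continuous_starAlgHom {C : Type*} [CStarAlgebra C] (f : B →⋆ₐ[ℂ] C) : Continuous f :=
  AddMonoidHomClass.continuous_of_bound f 1 fun x => by
    simpa using NonUnitalStarAlgHom.norm_apply_le f x

theorem cstarAdjoin_hom_ext {C : Type*} [CStarAlgebra C] {s : Set B}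
    {f g : cstarAdjoin s →⋆ₐ[ℂ] C}
    (h : ∀ x (hx : x ∈ s), f ⟨x, subset_cstarAdjoin s hx⟩ = g ⟨x, subset_cstarAdjoin s hx⟩) :
    f = g := by
  refine StarAlgHom.ext_topologicalClosure (continuous_starAlgHom f) (continuous_starAlgHom g) ?_
  refine StarAlgHom.ext_adjoin ?_
  rintro ⟨x, hx⟩ hx'
  exact h x hx'

end Generated

/-! ### The crossed product by a single automorphism -/

section CrossedProduct

variable {A : Type u} [CStarAlgebra A]

/-- A covariant representation of `(A, α)`: a unital representation of `A` on a nonzero Hilbert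
space with a unitary implementing `α`. -/
structure CovariantRep (α : A ≃⋆ₐ[ℂ] A) where
  H : Type u
  [normedAddCommGroup : NormedAddCommGroup H]
  [innerProductSpace : InnerProductSpace ℂ H]
  [completeSpace : CompleteSpace H]
  [nontrivial : Nontrivial H]
  φ : A →⋆ₐ[ℂ] (H →L[ℂ] H)
  V : unitary (H →L[ℂ] H)
  covariant : ∀ a, (V : H →L[ℂ] H) * φ a * star (V : H →L[ℂ] H) = φ (α a)

attribute [instance] CovariantRep.normedAddCommGroup CovariantRep.innerProductSpace
  CovariantRep.completeSpace CovariantRep.nontrivial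

/-- The C⋆-algebra of bounded families of operators indexed by all covariant representations. -/
def CovariantFamilies (α : A ≃⋆ₐ[ℂ] A) : Type (u + 1) :=
  lp (fun i : CovariantRep α => i.H →L[ℂ] i.H) ∞

instance (α : A ≃⋆ₐ[ℂ] A) : CStarAlgebra (CovariantFamilies α) :=
  let E := lp (fun i : CovariantRep α => i.H →L[ℂ] i.H) ∞
  { lp.inftyNormedRing, lp.inftyStarRing, lp.inftyNormedAlgebra with
    toCompleteSpace := (inferInstance : CompleteSpace E)
    norm_mul_self_le := (inferInstance : CStarRing E).norm_mul_self_le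
    star_smul := (inferInstance : StarModule ℂ E).star_smul }

/-- `a ↦ (φ_i(a))_i`, over all covariant representations `i`. -/
def univEmbed (α : A ≃⋆ₐ[ℂ] A) : A →⋆ₐ[ℂ] CovariantFamilies α where
  toFun a := ⟨fun i => i.φ a, memℓp_infty ⟨‖a‖, by
    rintro _ ⟨i, rfl⟩
    exact NonUnitalStarAlgHom.norm_apply_le i.φ a⟩⟩
  map_one' := by refine lp.ext (funext fun i => ?_); exact map_one i.φ
  map_mul' a b := by refine lp.ext (funext fun i => ?_); exact map_mul i.φ a b
  map_zero' := by refine lp.ext (funext fun i => ?_); exact map_zero i.φ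
  map_add' a b := by refine lp.ext (funext fun i => ?_); exact map_add i.φ a b
  commutes' c := by refine lp.ext (funext fun i => ?_); exact AlgHomClass.commutes i.φ c
  map_star' a := by refine lp.ext (funext fun i => ?_); exact map_star i.φ a

/-- `(V_i)_i`, over all covariant representations `i`. -/
def univUnitary (α : A ≃⋆ₐ[ℂ] A) : CovariantFamilies α :=
  ⟨fun i => (i.V : i.H →L[ℂ] i.H), memℓp_infty ⟨1, by
    rintro _ ⟨i, rfl⟩
    exact (CStarRing.norm_coe_unitary i.V).le⟩⟩

/-- The generators: the elements of `A` and the unitary. -/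
def univGenerators (α : A ≃⋆ₐ[ℂ] A) : Set (CovariantFamilies α) :=
  Set.range (univEmbed α) ∪ {univUnitary α}

/-- The crossed product `A ⋊_α ℤ`, the universal C⋆-algebra generated by `A` and a unitary
implementing `α`: the C⋆-algebra generated by `A` and the unitary in the direct sum of all covariant
representations. -/
def CrossedProduct (α : A ≃⋆ₐ[ℂ] A) : Type (u + 1) := cstarAdjoin (univGenerators α)

instance (α : A ≃⋆ₐ[ℂ] A) : CStarAlgebra (CrossedProduct α) :=
  inferInstanceAs (CStarAlgebra (cstarAdjoin (univGenerators α)))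

namespace CrossedProduct

theorem univEmbed_mem (α : A ≃⋆ₐ[ℂ] A) (a : A) :
    univEmbed α a ∈ cstarAdjoin (univGenerators α) :=
  subset_cstarAdjoin _ (Or.inl (Set.mem_range_self a))

theorem univUnitary_mem (α : A ≃⋆ₐ[ℂ] A) : univUnitary α ∈ cstarAdjoin (univGenerators α) :=
  subset_cstarAdjoin _ (Or.inr rfl)

/-- The canonical homomorphism `A → A ⋊_α ℤ`. -/
def embed (α : A ≃⋆ₐ[ℂ] A) : A →⋆ₐ[ℂ] CrossedProduct α :=
  (univEmbed α).codRestrict (cstarAdjoin (univGenerators α)) (univEmbed_mem α)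

/-- The canonical unitary `u` of `A ⋊_α ℤ`. -/
def u (α : A ≃⋆ₐ[ℂ] A) : CrossedProduct α := ⟨univUnitary α, univUnitary_mem α⟩

theorem u_mem_unitary (α : A ≃⋆ₐ[ℂ] A) : u α ∈ unitary (CrossedProduct α) := by
  constructor
  · refine Subtype.ext (lp.ext (funext fun i => ?_)); exact Unitary.coe_star_mul_self i.V
  · refine Subtype.ext (lp.ext (funext fun i => ?_)); exact Unitary.coe_mul_star_self i.V

theorem u_mul_embed_mul_star (α : A ≃⋆ₐ[ℂ] A) (a : A) :
    u α * embed α a * star (u α) = embed α (α a) := by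
  refine Subtype.ext (lp.ext (funext fun i => ?_)); exact i.covariant a

/-- The representation of `A ⋊_α ℤ` defined by a covariant representation. -/
def toRep {α : A ≃⋆ₐ[ℂ] A} (i : CovariantRep α) : CrossedProduct α →⋆ₐ[ℂ] (i.H →L[ℂ] i.H) where
  toFun b := (Subtype.val b : CovariantFamilies α).1 i
  map_one' := rfl
  map_mul' _ _ := rfl
  map_zero' := rfl
  map_add' _ _ := rfl
  commutes' _ := rfl
  map_star' _ := rfl

theorem toRep_embed {α : A ≃⋆ₐ[ℂ] A} (i : CovariantRep α) (a : A) :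
    toRep i (embed α a) = i.φ a := rfl

theorem toRep_u {α : A ≃⋆ₐ[ℂ] A} (i : CovariantRep α) : toRep i (u α) = i.V := rfl

/-- The covariant representation with the same `φ` and with the unitary `z V`. -/
def rotateRep {α : A ≃⋆ₐ[ℂ] A} (z : Circle) (i : CovariantRep α) : CovariantRep α where
  H := i.H
  φ := i.φ
  V := ⟨(z : ℂ) • (i.V : i.H →L[ℂ] i.H), by
    have h : star (z : ℂ) * (z : ℂ) = 1 := by
      rw [Complex.star_def, mul_comm]; simp [Complex.mul_conj, Circle.normSq_coe]
    have h' : (z : ℂ) * star (z : ℂ) = 1 := by rw [mul_comm]; exact h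
    constructor
    · rw [star_smul, smul_mul_smul_comm, h, one_smul]; exact Unitary.coe_star_mul_self i.V
    · rw [star_smul, smul_mul_smul_comm, h', one_smul]; exact Unitary.coe_mul_star_self i.V⟩
  covariant a := by
    have h' : (z : ℂ) * star (z : ℂ) = 1 := by
      rw [Complex.star_def]; simp [Complex.mul_conj, Circle.normSq_coe]
    change ((z : ℂ) • (i.V : i.H →L[ℂ] i.H)) * i.φ a * star ((z : ℂ) • (i.V : i.H →L[ℂ] i.H)) = _
    rw [star_smul, smul_mul_assoc, smul_mul_smul_comm, h', one_smul]; exact i.covariant a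

/-- Reindexing of the families of operators along `rotateRep z`. -/
def rotate (α : A ≃⋆ₐ[ℂ] A) (z : Circle) : CovariantFamilies α →⋆ₐ[ℂ] CovariantFamilies α where
  toFun f := ⟨fun i => f.1 (rotateRep z i), memℓp_infty ⟨‖f‖, by
    rintro _ ⟨i, rfl⟩
    exact lp.norm_apply_le_norm ENNReal.top_ne_zero f (rotateRep z i)⟩⟩
  map_one' := rfl
  map_mul' _ _ := rfl
  map_zero' := rfl
  map_add' _ _ := rfl
  commutes' _ := rfl
  map_star' _ := rfl

theorem rotate_univEmbed (α : A ≃⋆ₐ[ℂ] A) (z : Circle) (a : A) :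
    rotate α z (univEmbed α a) = univEmbed α a := rfl

theorem rotate_univUnitary (α : A ≃⋆ₐ[ℂ] A) (z : Circle) :
    rotate α z (univUnitary α) = (z : ℂ) • univUnitary α := rfl

theorem rotate_mem (α : A ≃⋆ₐ[ℂ] A) (z : Circle) {f : CovariantFamilies α}
    (hf : f ∈ cstarAdjoin (univGenerators α)) :
    rotate α z f ∈ cstarAdjoin (univGenerators α) := by
  have hle : cstarAdjoin (univGenerators α) ≤
      (cstarAdjoin (univGenerators α)).comap (rotate α z) := by
    refine cstarAdjoin_le ((isClosed_cstarAdjoin _).preimage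
      (continuous_starAlgHom (rotate α z))) ?_
    rintro _ (⟨a, rfl⟩ | rfl)
    · exact univEmbed_mem α a
    · exact (cstarAdjoin (univGenerators α)).smul_mem (univUnitary_mem α) (z : ℂ)
  exact hle hf

/-- The endomorphism of `A ⋊_α ℤ` fixing `A` and sending `u` to `z u`. -/
def dualHom (α : A ≃⋆ₐ[ℂ] A) (z : Circle) : CrossedProduct α →⋆ₐ[ℂ] CrossedProduct α :=
  ((rotate α z).comp (cstarAdjoin (univGenerators α)).subtype).codRestrict
    (cstarAdjoin (univGenerators α)) fun b => rotate_mem α z b.2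

theorem dualHom_embed (α : A ≃⋆ₐ[ℂ] A) (z : Circle) (a : A) :
    dualHom α z (embed α a) = embed α a := rfl

theorem dualHom_u (α : A ≃⋆ₐ[ℂ] A) (z : Circle) : dualHom α z (u α) = (z : ℂ) • u α := rfl

/-- Two ⋆-homomorphisms on `A ⋊_α ℤ` that agree on `A` and on `u` are equal. -/
theorem hom_ext (α : A ≃⋆ₐ[ℂ] A) {B : Type*} [CStarAlgebra B]
    {f g : CrossedProduct α →⋆ₐ[ℂ] B} (h : ∀ a, f (embed α a) = g (embed α a))
    (hu : f (u α) = g (u α)) : f = g := by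
  refine cstarAdjoin_hom_ext (s := univGenerators α) (f := f) (g := g) ?_
  rintro x (⟨a, rfl⟩ | hx)
  · exact h a
  · obtain rfl : x = univUnitary α := hx
    exact hu

theorem dualHom_one (α : A ≃⋆ₐ[ℂ] A) : dualHom α 1 = StarAlgHom.id ℂ (CrossedProduct α) :=
  hom_ext α (fun _ => rfl) (by rw [dualHom_u]; simp)

theorem dualHom_comp (α : A ≃⋆ₐ[ℂ] A) (z w : Circle) :
    (dualHom α z).comp (dualHom α w) = dualHom α (z * w) :=
  hom_ext α (fun _ => rfl) (by
    rw [StarAlgHom.comp_apply, dualHom_u, dualHom_u, map_smul, dualHom_u, smul_smul, mul_comm,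
      Circle.coe_mul])

/-- The dual action of the circle on `A ⋊_α ℤ`: it fixes `A` and multiplies `u` by `z`. -/
def dualAction (α : A ≃⋆ₐ[ℂ] A) : Circle →* (CrossedProduct α ≃⋆ₐ[ℂ] CrossedProduct α) where
  toFun z := StarAlgEquiv.ofStarAlgHom (dualHom α z) (dualHom α z⁻¹)
    (by rw [dualHom_comp, inv_mul_cancel, dualHom_one])
    (by rw [dualHom_comp, mul_inv_cancel, dualHom_one])
  map_one' := by
    ext1 b
    exact DFunLike.congr_fun (dualHom_one α) b
  map_mul' z w := by
    ext1 b
    exact (DFunLike.congr_fun (dualHom_comp α z w) b).symm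

theorem dualAction_embed (α : A ≃⋆ₐ[ℂ] A) (z : Circle) (a : A) :
    dualAction α z (embed α a) = embed α a := rfl

theorem dualAction_u (α : A ≃⋆ₐ[ℂ] A) (z : Circle) : dualAction α z (u α) = (z : ℂ) • u α := rfl

end CrossedProduct

/-- `u⁻¹[D, u]` is bounded and commutes with the elements of `A`. -/
def BoundedCommutingCocycle (α : A ≃⋆ₐ[ℂ] A) (Y : SpectralTriple.{u} (CrossedProduct α)) : Prop :=
  ∃ T : Y.H →L[ℂ] Y.H, IsCommutator Y.D (Y.π (CrossedProduct.u α)) T ∧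
    ∀ a : A, Commute (Y.π (star (CrossedProduct.u α)) * T) (Y.π (CrossedProduct.embed α a))

end CrossedProduct

end

end SpectralMetric

open scoped InnerProductSpace

namespace SpectralMetric
noncomputable section

/-! ### Weak forms and algebra of bounded commutators -/

section Commutators

variable {H : Type*} [NormedAddCommGroup H] [InnerProductSpace ℂ H]

/-! From `X` to `Y`. On two copies of `ℓ²(ℤ, H)` take the regular representation and the Dirac
operator `D ⊗ σ₁ + n ⊗ σ₂` (`crossedTriple`). The commutator with `a` in `A` has the entries `[D,
α⁻ⁿ(a)]`, so an orbit bound is what makes it bounded; the commutator with `u` is `u` times a Pauli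
matrix, which gives (ii). The dual action is implemented by the phases `zⁿ`, which commute with the
Dirac operator, whence (i).

Compactness of `Y` rests on two estimates for an element `b` with `‖[D̂, b]‖ ≤ M`. Its Fourier
coefficients are `aₖ uᵏ` with `‖[D, aₖ]‖ ≤ M` (`lip_of_commutatorBound_monomial`), so each ranges
over a precompact set when the norm of `b` is bounded. Pauli algebra isolates the commutator with
`n`, and integrating it moves `b` by at most `M |θ|` under rotation by `θ`
(`norm_regularHom_dualAction_sub_le`). Hence one fixed trigonometric kernel approximates all such
`b` uniformly by finite sums of coefficients. For (iii), a Baire category argument turns the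
elementwise orbit bounds into one Lipschitz constant (`exists_forall_zpow_mem_lip`).

From `Y` to `X`. By Hahn-Banach and the Jordan decomposition of hermitian functionals, the Connes
metric determines the Lipschitz ball on selfadjoint elements (`mem_of_forall_states`), so (iii)
makes the two Lipschitz seminorms on `A` comparable. Condition (ii) gives `[D̂, u a u⁻¹] = u [D̂, a]
u⁻¹`, so the seminorm of `Y` is `α`-invariant on `A` (`embed_zpow_mem_lip`). Together these bound
`‖[D, αⁿ(a)]‖` uniformly in `n`.

For (c), `X` is the restriction of `Y` to `A`. Condition (i) and the uniform boundedness principle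
make averaging over the circle preserve bounded commutators; the average is a contraction onto `A`,
which gives the density that a spectral triple needs. -/

theorem norm_le_of_dense_inner_le {s : Set H} (hs : Dense s) {v : H} {C : ℝ} (hC : 0 ≤ C)
    (h : ∀ x ∈ s, ‖⟪x, v⟫_ℂ‖ ≤ C * ‖x‖) : ‖v‖ ≤ C := by
  have hall : ∀ x : H, ‖⟪x, v⟫_ℂ‖ ≤ C * ‖x‖ := by
    intro x
    exact closure_minimal (s := s) (t := {x | ‖⟪x, v⟫_ℂ‖ ≤ C * ‖x‖}) h
      (isClosed_le (by fun_prop) (by fun_prop)) (hs x)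
  by_cases hv : ‖v‖ = 0
  · rw [hv]; exact hC
  · have h1 := hall v
    rw [norm_inner_symm, inner_self_eq_norm_sq_to_K] at h1
    have h2 : ‖v‖ * ‖v‖ ≤ C * ‖v‖ := by
      have : ‖((‖v‖ : ℂ)) ^ 2‖ = ‖v‖ * ‖v‖ := by simp [sq]
      rw [← this]; exact h1
    exact le_of_mul_le_mul_right h2 (lt_of_le_of_ne (norm_nonneg _) (Ne.symm hv))

theorem opNorm_le_of_dense_inner_le {s t : Set H} (hs : Dense s) (ht : Dense t) {T : H →L[ℂ] H}
    {C : ℝ} (hC : 0 ≤ C) (h : ∀ x ∈ s, ∀ y ∈ t, ‖⟪x, T y⟫_ℂ‖ ≤ C * ‖x‖ * ‖y‖) : ‖T‖ ≤ C := by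
  refine T.opNorm_le_bound hC fun y => ?_
  refine closure_minimal (s := t) (t := {y | ‖T y‖ ≤ C * ‖y‖}) (fun y hy => ?_)
    (isClosed_le (by fun_prop) (by fun_prop)) (ht y)
  refine norm_le_of_dense_inner_le hs (by positivity) fun x hx => ?_
  calc ‖⟪x, T y⟫_ℂ‖ ≤ C * ‖x‖ * ‖y‖ := h x hx y hy
    _ = C * ‖y‖ * ‖x‖ := by ring

variable {D : H →ₗ.[ℂ] H}

/-- `[D, S]` is bounded, with norm at most `M`. -/
def CommutatorBound (D : H →ₗ.[ℂ] H) (S : H →L[ℂ] H) (M : ℝ) : Prop :=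
  ∃ T : H →L[ℂ] H, IsCommutator D S T ∧ ‖T‖ ≤ M

theorem CommutatorBound.mono {S : H →L[ℂ] H} {M M' : ℝ}
    (h : CommutatorBound D S M) (hM : M ≤ M') : CommutatorBound D S M' := by
  obtain ⟨T, hT, hTM⟩ := h
  exact ⟨T, hT, hTM.trans hM⟩

theorem CommutatorBound.nonneg {S : H →L[ℂ] H} {M : ℝ}
    (h : CommutatorBound D S M) : 0 ≤ M := by
  obtain ⟨T, -, hTM⟩ := h
  exact (norm_nonneg _).trans hTM

variable [CompleteSpace H]

theorem inner_apply_left_eq_right (hD : IsSelfAdjoint D) (x y : D.domain) :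
    ⟪D x, (y : H)⟫_ℂ = ⟪(x : H), D y⟫_ℂ := by
  have h := LinearPMap.adjoint_isFormalAdjoint hD.dense_domain
  rw [LinearPMap.isSelfAdjoint_def.1 hD] at h
  exact h x y

/-- The hypothesis places `x` in the domain of the adjoint, which is `D` itself. -/
theorem exists_domain_of_inner_eq (hD : IsSelfAdjoint D) {x w : H}
    (h : ∀ y : D.domain, ⟪w, (y : H)⟫_ℂ = ⟪x, D y⟫_ℂ) :
    ∃ z : D.domain, (z : H) = x ∧ D z = w := by
  have hd := hD.dense_domain
  have key : ∀ D' : H →ₗ.[ℂ] H, D' = D.adjoint → ∃ z : D'.domain, (z : H) = x ∧ D' z = w := by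
    rintro _ rfl
    have hx := LinearPMap.mem_adjoint_domain_of_exists x ⟨w, h⟩
    exact ⟨⟨x, hx⟩, rfl, LinearPMap.adjoint_apply_eq hd _ h⟩
  exact key D (LinearPMap.isSelfAdjoint_def.1 hD).symm

/-- The weak identity forces `S` to preserve the domain, by selfadjointness. In this form the
commutator is visibly linear in `S` and compatible with adjoints. -/
theorem isCommutator_iff_inner (hD : IsSelfAdjoint D) (S T : H →L[ℂ] H) :
    IsCommutator D S T ↔
      ∀ x y : D.domain, ⟪D x, S y⟫_ℂ - ⟪(x : H), S (D y)⟫_ℂ = ⟪(x : H), T y⟫_ℂ := by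
  rw [isCommutator_iff_of_isClosed hD.isClosed]
  constructor
  · intro h x y
    obtain ⟨z, hz, hz'⟩ := h y
    rw [← hz, inner_apply_left_eq_right hD, ← inner_sub_right, hz']
  · intro h y
    obtain ⟨z, hz, hz'⟩ := exists_domain_of_inner_eq hD (x := S y) (w := S (D y) + T y) (by
      intro x
      rw [← inner_conj_symm, inner_add_right, ← h x y]
      rw [← inner_conj_symm (S (y : H))]
      congr 1
      ring)
    exact ⟨z, hz, by rw [hz']; abel⟩

theorem IsCommutator.unique (hD : IsSelfAdjoint D) {S T T' : H →L[ℂ] H}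
    (h : IsCommutator D S T) (h' : IsCommutator D S T') : T = T' := by
  rw [isCommutator_iff_inner hD] at h h'
  refine ContinuousLinearMap.ext_on (s := (D.domain : Set H)) ?_ fun y hy => ?_
  · simpa using hD.dense_domain
  · refine hD.dense_domain.eq_of_inner_right ℂ fun x hx => ?_
    rw [← h ⟨x, hx⟩ ⟨y, hy⟩, ← h' ⟨x, hx⟩ ⟨y, hy⟩]

theorem IsCommutator.add (hD : IsSelfAdjoint D) {S S' T T' : H →L[ℂ] H}
    (h : IsCommutator D S T) (h' : IsCommutator D S' T') : IsCommutator D (S + S') (T + T') := by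
  rw [isCommutator_iff_inner hD] at *
  intro x y
  simp only [add_apply, inner_add_right, ← h, ← h']
  ring

theorem IsCommutator.smul (hD : IsSelfAdjoint D) {S T : H →L[ℂ] H} (c : ℂ)
    (h : IsCommutator D S T) : IsCommutator D (c • S) (c • T) := by
  rw [isCommutator_iff_inner hD] at *
  intro x y
  simp only [smul_apply, inner_smul_right, ← h]
  ring

theorem IsCommutator.one (hD : IsSelfAdjoint D) : IsCommutator D 1 0 := by
  rw [isCommutator_iff_inner hD]
  intro x y
  simp [inner_apply_left_eq_right hD]

theorem IsCommutator.mul (hD : IsSelfAdjoint D) {S S' T T' : H →L[ℂ] H}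
    (h : IsCommutator D S T) (h' : IsCommutator D S' T') :
    IsCommutator D (S * S') (S * T' + T * S') := by
  rw [isCommutator_iff_of_isClosed hD.isClosed] at *
  intro x
  obtain ⟨y, hy, hy'⟩ := h' x
  obtain ⟨z, hz, hz'⟩ := h y
  refine ⟨z, by rw [hz, hy]; rfl, ?_⟩
  simp only [mul_apply_eq_comp, add_apply, ← hy', ← hy, ← hz',
    map_sub]
  abel

theorem IsCommutator.star (hD : IsSelfAdjoint D) {S T : H →L[ℂ] H}
    (h : IsCommutator D S T) : IsCommutator D (star S) (-star T) := by
  rw [isCommutator_iff_inner hD] at *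
  intro x y
  have := congrArg (starRingEnd ℂ) (h y x)
  simp only [map_sub, inner_conj_symm] at this
  simp only [ContinuousLinearMap.star_eq_adjoint, neg_apply, inner_neg_right,
    ContinuousLinearMap.adjoint_inner_right, ← this]
  ring

/-- A bound on the commutator as a sesquilinear form suffices: it puts `S y` in the domain of the
adjoint, and the resulting densely defined map extends with the same bound. -/
theorem commutatorBound_iff (hD : IsSelfAdjoint D) (S : H →L[ℂ] H) {M : ℝ} (hM : 0 ≤ M) :
    CommutatorBound D S M ↔
      ∀ x y : D.domain, ‖⟪D x, S y⟫_ℂ - ⟪(x : H), S (D y)⟫_ℂ‖ ≤ M * ‖(x : H)‖ * ‖(y : H)‖ := by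
  have hd := hD.dense_domain
  constructor
  · rintro ⟨T, hT, hTM⟩ x y
    rw [(isCommutator_iff_inner hD S T).1 hT x y]
    calc ‖⟪(x : H), T y⟫_ℂ‖ ≤ ‖(x : H)‖ * ‖T y‖ := norm_inner_le_norm _ _
      _ ≤ ‖(x : H)‖ * (M * ‖(y : H)‖) := by gcongr; exact T.le_of_opNorm_le hTM _
      _ = _ := by ring
  · intro h
    have hmem : ∀ y : D.domain, S y ∈ D.domain := by
      intro y
      have hc : S y ∈ D.adjoint.domain := by
        rw [LinearPMap.mem_adjoint_domain_iff]
        refine (LinearMap.mkContinuous _ (M * ‖(y : H)‖ + ‖S (D y)‖) fun x => ?_).continuous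
        change ‖⟪S y, D x⟫_ℂ‖ ≤ _
        rw [norm_inner_symm]
        calc ‖⟪D x, S y⟫_ℂ‖
            = ‖(⟪D x, S y⟫_ℂ - ⟪(x : H), S (D y)⟫_ℂ) + ⟪(x : H), S (D y)⟫_ℂ‖ := by
              rw [sub_add_cancel]
          _ ≤ M * ‖(x : H)‖ * ‖(y : H)‖ + ‖(x : H)‖ * ‖S (D y)‖ :=
              (norm_add_le _ _).trans (add_le_add (h x y) (norm_inner_le_norm _ _))
          _ = (M * ‖(y : H)‖ + ‖S (D y)‖) * ‖(x : H)‖ := by ring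
      rwa [LinearPMap.isSelfAdjoint_def.1 hD] at hc
    let L : D.domain →ₗ[ℂ] H :=
      { toFun := fun y => D ⟨S y, hmem y⟩ - S (D y)
        map_add' := fun y z => by
          have : (⟨S ((y + z : D.domain) : H), hmem (y + z)⟩ : D.domain)
              = ⟨S y, hmem y⟩ + ⟨S z, hmem z⟩ := Subtype.ext (by simp)
          rw [this, LinearPMap.map_add, LinearPMap.map_add, map_add]; abel
        map_smul' := fun c y => by
          have : (⟨S ((c • y : D.domain) : H), hmem (c • y)⟩ : D.domain)
              = c • ⟨S y, hmem y⟩ := Subtype.ext (by simp)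
          rw [this, LinearPMap.map_smul, LinearPMap.map_smul, map_smul, RingHom.id_apply,
            smul_sub] }
    have hinner : ∀ x y : D.domain,
        ⟪D x, S y⟫_ℂ - ⟪(x : H), S (D y)⟫_ℂ = ⟪(x : H), L y⟫_ℂ := by
      intro x y
      have := inner_apply_left_eq_right hD x ⟨S y, hmem y⟩
      simp only [L, LinearMap.coe_mk, AddHom.coe_mk, inner_sub_right, ← this]
    have hL : ∀ y : D.domain, ‖L y‖ ≤ M * ‖D.domain.subtype y‖ := by
      intro y
      refine norm_le_of_dense_inner_le hd (by positivity) fun x hx => ?_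
      rw [← hinner ⟨x, hx⟩ y]
      calc _ ≤ M * ‖x‖ * ‖(y : H)‖ := h ⟨x, hx⟩ y
        _ = _ := by rw [Submodule.subtype_apply]; ring
    have hdr : DenseRange D.domain.subtype := by
      rw [DenseRange]; simpa using hd
    refine ⟨L.extendOfNorm D.domain.subtype, ?_, LinearMap.opNorm_extendOfNorm_le hdr hM hL⟩
    rw [isCommutator_iff_inner hD]
    intro x y
    rw [hinner]
    congr 1
    exact (LinearMap.extendOfNorm_eq hdr ⟨M, hL⟩ y).symm

theorem CommutatorBound.add (hD : IsSelfAdjoint D) {S S' : H →L[ℂ] H} {M M' : ℝ}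
    (h : CommutatorBound D S M) (h' : CommutatorBound D S' M') :
    CommutatorBound D (S + S') (M + M') := by
  obtain ⟨T, hT, hTM⟩ := h
  obtain ⟨T', hT', hTM'⟩ := h'
  exact ⟨T + T', hT.add hD hT', (norm_add_le _ _).trans (add_le_add hTM hTM')⟩

theorem CommutatorBound.smul (hD : IsSelfAdjoint D) {S : H →L[ℂ] H} {M : ℝ} (c : ℂ)
    (h : CommutatorBound D S M) : CommutatorBound D (c • S) (‖c‖ * M) := by
  obtain ⟨T, hT, hTM⟩ := h
  exact ⟨c • T, hT.smul hD c, by rw [norm_smul]; gcongr⟩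

theorem CommutatorBound.star (hD : IsSelfAdjoint D) {S : H →L[ℂ] H} {M : ℝ}
    (h : CommutatorBound D S M) : CommutatorBound D (star S) M := by
  obtain ⟨T, hT, hTM⟩ := h
  exact ⟨-Star.star T, hT.star hD, by rwa [norm_neg, norm_star]⟩

/-- Lower semicontinuity of the Lipschitz seminorm: the form bound is an intersection of conditions
that are closed in `S`. -/
theorem isClosed_commutatorBound (hD : IsSelfAdjoint D) (M : ℝ) :
    IsClosed {S : H →L[ℂ] H | CommutatorBound D S M} := by
  by_cases hM : 0 ≤ M
  · simp only [commutatorBound_iff hD _ hM, Set.ofPred_forall]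
    refine isClosed_iInter fun x => isClosed_iInter fun y => isClosed_le ?_ continuous_const
    fun_prop
  · convert isClosed_empty
    ext S
    simp only [Set.mem_ofPred_eq, Set.mem_empty_iff_false, iff_false]
    exact fun h => hM h.nonneg

end Commutators

/-! ### Total boundedness by approximation and finite sums -/

section TotallyBounded

theorem totallyBounded_of_forall_approx {E : Type*} [PseudoMetricSpace E] {s : Set E}
    (h : ∀ ε > 0, ∃ t : Set E, TotallyBounded t ∧ ∀ x ∈ s, ∃ y ∈ t, dist x y < ε) :
    TotallyBounded s := by
  refine Metric.totallyBounded_iff.2 fun ε hε => ?_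
  obtain ⟨t, ht, hst⟩ := h (ε / 2) (half_pos hε)
  obtain ⟨F, hF, hFt⟩ := Metric.totallyBounded_iff.1 ht (ε / 2) (half_pos hε)
  refine ⟨F, hF, fun x hx => ?_⟩
  obtain ⟨y, hy, hxy⟩ := hst x hx
  obtain ⟨z, hz, hyz⟩ := Set.mem_iUnion₂.1 (hFt hy)
  refine Set.mem_iUnion₂.2 ⟨z, hz, ?_⟩
  have := dist_triangle x y z
  rw [Metric.mem_ball] at hyz ⊢
  linarith

theorem _root_.TotallyBounded.add_set {E : Type*} [SeminormedAddCommGroup E] {s t : Set E}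
    (hs : TotallyBounded s) (ht : TotallyBounded t) :
    TotallyBounded {x : E | ∃ a ∈ s, ∃ b ∈ t, a + b = x} := by
  refine Metric.totallyBounded_iff.2 fun ε hε => ?_
  obtain ⟨F, hF, hFs⟩ := Metric.totallyBounded_iff.1 hs (ε / 2) (half_pos hε)
  obtain ⟨G, hG, hGt⟩ := Metric.totallyBounded_iff.1 ht (ε / 2) (half_pos hε)
  refine ⟨Set.image2 (· + ·) F G, hF.image2 _ hG, ?_⟩
  rintro _ ⟨a, ha, b, hb, rfl⟩
  obtain ⟨y, hy, hay⟩ := Set.mem_iUnion₂.1 (hFs ha)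
  obtain ⟨z, hz, hbz⟩ := Set.mem_iUnion₂.1 (hGt hb)
  refine Set.mem_iUnion₂.2 ⟨y + z, Set.mem_image2_of_mem hy hz, ?_⟩
  have := dist_add_add_le a b y z
  rw [Metric.mem_ball] at hay hbz ⊢
  linarith

theorem _root_.TotallyBounded.finset_sum {E κ : Type*} [SeminormedAddCommGroup E] (F : Finset κ)
    {K : κ → Set E} (hK : ∀ i ∈ F, TotallyBounded (K i)) :
    TotallyBounded {x : E | ∃ f : κ → E, (∀ i ∈ F, f i ∈ K i) ∧ x = ∑ i ∈ F, f i} := by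
  classical
  induction F using Finset.induction_on with
  | empty =>
    refine TotallyBounded.subset ?_ (Set.finite_singleton (0 : E)).totallyBounded
    rintro x ⟨f, -, rfl⟩
    simp
  | insert i F hi ih =>
    have h1 := hK i (Finset.mem_insert_self i F)
    have h2 := ih fun j hj => hK j (Finset.mem_insert_of_mem hj)
    refine (h1.add_set h2).subset ?_
    rintro x ⟨f, hf, rfl⟩
    exact ⟨f i, hf i (Finset.mem_insert_self i F), ∑ j ∈ F, f j,
      ⟨f, fun j hj => hf j (Finset.mem_insert_of_mem hj), rfl⟩, (Finset.sum_insert hi).symm⟩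

end TotallyBounded

/-! ### Compact resolvents and graph balls -/

section Resolvent

variable {H : Type*} [NormedAddCommGroup H] [InnerProductSpace ℂ H]

/-- The ball of radius `M` in the domain of `D`, for the maximum of `‖x‖` and `‖D x‖`. -/
def graphBall (D : H →ₗ.[ℂ] H) (M : ℝ) : Set H :=
  {x | ∃ y : D.domain, (y : H) = x ∧ ‖x‖ ≤ M ∧ ‖D y‖ ≤ M}

/-- The graph ball is contained in the image under the resolvent of a ball of radius `‖z‖ M + M`. -/
theorem HasCompactResolvent.totallyBounded_graphBall {D : H →ₗ.[ℂ] H}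
    (hD : HasCompactResolvent D) (M : ℝ) : TotallyBounded (graphBall D M) := by
  obtain ⟨z, R, hR, -, hR'⟩ := hD
  have h := hR.isCompact_closure_image_closedBall (f := (R : H →ₗ[ℂ] H)) (‖z‖ * M + M)
  refine (h.totallyBounded.subset subset_closure).subset ?_
  rintro _ ⟨y, rfl, hy, hDy⟩
  refine ⟨z • (y : H) - D y, ?_, hR' y⟩
  rw [mem_closedBall_zero_iff]
  refine (norm_sub_le _ _).trans (add_le_add ?_ hDy)
  rw [norm_smul]
  gcongr

variable [CompleteSpace H] {D : H →ₗ.[ℂ] H}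

/-- The cross term vanishes because `⟪D x, x⟫` is real. -/
theorem norm_sq_apply_add_I_smul (hD : IsSelfAdjoint D) (c : ℝ) (x : D.domain) :
    ‖D x + (Complex.I * c) • (x : H)‖ ^ 2 = ‖D x‖ ^ 2 + c ^ 2 * ‖(x : H)‖ ^ 2 := by
  have him : (⟪D x, (x : H)⟫_ℂ).im = 0 := by
    have h := inner_apply_left_eq_right hD x x
    rw [← inner_conj_symm (x : H)] at h
    exact Complex.conj_eq_iff_im.1 h.symm
  rw [norm_add_sq (𝕜 := ℂ), inner_smul_right, norm_smul]
  have : RCLike.re (Complex.I * c * ⟪D x, (x : H)⟫_ℂ) = 0 := by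
    simp [him]
  rw [this]
  simp [mul_pow]

theorem norm_sq_I_smul_sub_apply (hD : IsSelfAdjoint D) (x : D.domain) :
    ‖Complex.I • (x : H) - D x‖ ^ 2 = ‖D x‖ ^ 2 + ‖(x : H)‖ ^ 2 := by
  have := norm_sq_apply_add_I_smul hD (-1) x
  rw [← norm_neg] at this
  simpa [sub_eq_add_neg, add_comm] using this

/-- The range is closed, since `i - D` is bounded below on the complete graph of `D`. A vector
orthogonal to it would be an eigenvector of `D` for `-i`, hence zero. -/
theorem exists_I_smul_sub_apply_eq (hD : IsSelfAdjoint D) (w : H) :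
    ∃ x : D.domain, Complex.I • (x : H) - D x = w := by
  let f : D.graph →L[ℂ] H :=
    ((Complex.I • ContinuousLinearMap.fst ℂ H H) - ContinuousLinearMap.snd ℂ H H).comp
      D.graph.subtypeL
  have hgr : ∀ p : D.graph, ∃ x : D.domain, (x : H) = (p : H × H).1 ∧ D x = (p : H × H).2 :=
    fun p => (LinearPMap.mem_graph_iff _).1 p.2
  have hf : ∀ p, f p = Complex.I • (p : H × H).1 - (p : H × H).2 := fun p => rfl
  have : CompleteSpace D.graph := IsClosed.completeSpace_coe (hs := hD.isClosed)
  have hanti : AntilipschitzWith 1 f := by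
    refine ContinuousLinearMap.antilipschitz_of_bound f fun p => ?_
    obtain ⟨x, hx, hx'⟩ := hgr p
    have h := norm_sq_I_smul_sub_apply hD x
    rw [hf, ← hx, ← hx', NNReal.coe_one, one_mul, Submodule.coe_norm, Prod.norm_def, ← hx, ← hx']
    refine max_le ?_ ?_
    · nlinarith [norm_nonneg (Complex.I • (x : H) - D x), norm_nonneg (x : H), sq_nonneg ‖D x‖]
    · nlinarith [norm_nonneg (Complex.I • (x : H) - D x), norm_nonneg (D x), sq_nonneg ‖(x : H)‖]
  have hcl : IsClosed (LinearMap.range (f : D.graph →ₗ[ℂ] H) : Set H) := by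
    exact hanti.isClosed_range f.uniformContinuous
  have : CompleteSpace (LinearMap.range (f : D.graph →ₗ[ℂ] H)) :=
    IsClosed.completeSpace_coe (hs := hcl)
  have htop : LinearMap.range (f : D.graph →ₗ[ℂ] H) = ⊤ := by
    rw [← Submodule.orthogonal_eq_bot_iff, Submodule.eq_bot_iff]
    intro v hv
    have hv' : ∀ x : D.domain, ⟪v, Complex.I • (x : H) - D x⟫_ℂ = 0 := by
      intro x
      exact (Submodule.mem_orthogonal' _ v).1 hv _ ⟨⟨_, D.mem_graph x⟩, rfl⟩
    obtain ⟨z, hz, hz'⟩ := exists_domain_of_inner_eq hD (x := v) (w := -Complex.I • v) (by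
      intro y
      have := hv' y
      rw [inner_sub_right, inner_smul_right, sub_eq_zero] at this
      rw [← this, inner_smul_left]
      simp)
    have := hv' z
    rw [hz', hz, neg_smul, sub_neg_eq_add, ← add_smul, inner_smul_right] at this
    have hI : Complex.I + Complex.I ≠ 0 := by
      rw [← two_mul]; exact mul_ne_zero two_ne_zero Complex.I_ne_zero
    exact inner_self_eq_zero.1 ((mul_eq_zero.1 this).resolve_left hI)
  obtain ⟨p, hp⟩ : w ∈ LinearMap.range (f : D.graph →ₗ[ℂ] H) := htop ▸ Submodule.mem_top
  obtain ⟨x, hx, hx'⟩ := hgr p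
  exact ⟨x, by rw [hx, hx', ← hp]; rfl⟩

/-- By the norm identity for `i - D`, the resolvent at `i` maps the unit ball into the graph ball of
radius `1`. -/
theorem hasCompactResolvent_of_totallyBounded (hD : IsSelfAdjoint D)
    (h : TotallyBounded (graphBall D 1)) : HasCompactResolvent D := by
  let f : D.domain →ₗ[ℂ] H := Complex.I • D.domain.subtype - D.toFun
  have hf : ∀ x, f x = Complex.I • (x : H) - D x := fun x => rfl
  have hnorm : ∀ x : D.domain, ‖(x : H)‖ ≤ ‖f x‖ ∧ ‖D x‖ ≤ ‖f x‖ := by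
    intro x
    have h := norm_sq_I_smul_sub_apply hD x
    rw [← hf] at h
    exact ⟨by nlinarith [norm_nonneg (f x), norm_nonneg (x : H), sq_nonneg ‖D x‖],
      by nlinarith [norm_nonneg (f x), norm_nonneg (D x), sq_nonneg ‖(x : H)‖]⟩
  have hbij : Function.Bijective f := by
    refine ⟨(injective_iff_map_eq_zero f).2 fun x hx => ?_, exists_I_smul_sub_apply_eq hD⟩
    have := (hnorm x).1
    rw [hx, norm_zero] at this
    exact Subtype.ext (norm_le_zero_iff.1 this)
  let e := LinearEquiv.ofBijective f hbij
  have he : ∀ x, f (e.symm x) = x := fun x => e.apply_symm_apply x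
  let R : H →L[ℂ] H := (D.domain.subtype.comp (e.symm : H →ₗ[ℂ] D.domain)).mkContinuous 1
    fun x => by
      have := (hnorm (e.symm x)).1
      rw [he] at this
      simpa using this
  have hR : ∀ x, R x = (e.symm x : H) := fun x => rfl
  refine ⟨Complex.I, R, ?_, fun x => ⟨e.symm x, rfl, he x⟩, fun y => ?_⟩
  · refine (isCompactOperator_iff_isCompact_closure_image_closedBall (R : H →ₗ[ℂ] H) one_pos).2 ?_
    refine (h.subset (s₁ := (R : H →ₗ[ℂ] H) '' Metric.closedBall 0 1) ?_).closure.isCompact_of_isClosed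
      isClosed_closure
    rintro _ ⟨x, hx, rfl⟩
    rw [mem_closedBall_zero_iff] at hx
    have := hnorm (e.symm x)
    rw [he] at this
    exact ⟨e.symm x, rfl, this.1.trans hx, this.2.trans hx⟩
  · rw [hR, ← hf]
    exact congrArg _ (e.symm_apply_apply y)

end Resolvent
end
end SpectralMetric

namespace SpectralMetric
noncomputable section

/-! ### Permutation-type operators on Hilbert sums -/

section SquareSummable

variable {ι : Type*} {H : Type*} [NormedAddCommGroup H]

/-- The Hilbert sum of copies of `H` indexed by `ι`. -/
abbrev ell2 (ι H : Type*) [NormedAddCommGroup H] := lp (fun _ : ι => H) 2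

theorem ell2_hasSum_norm_sq (ξ : ell2 ι H) : HasSum (fun i => ‖ξ i‖ ^ 2) (‖ξ‖ ^ 2) := by
  have := lp.hasSum_norm (p := 2) (by norm_num) ξ
  simpa using this

theorem memℓp_two_of_norm_le {ξ : ell2 ι H} {f : ι → H} {M : ℝ} (σ : Equiv.Perm ι)
    (h : ∀ i, ‖f (σ i)‖ ≤ M * ‖ξ i‖) : Memℓp f 2 := by
  refine memℓp_gen ?_
  have h1 : Summable fun i => (M * ‖ξ i‖) ^ 2 := by
    simp only [mul_pow]
    exact (ell2_hasSum_norm_sq ξ).summable.mul_left _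
  have h2 : Summable fun i => ‖f (σ i)‖ ^ 2 :=
    h1.of_nonneg_of_le (fun i => by positivity)
      fun i => pow_le_pow_left₀ (norm_nonneg _) (h i) 2
  simpa using (σ.summable_iff (f := fun i => ‖f i‖ ^ 2)).1 h2

theorem ell2_norm_le_of_norm_le {ξ η : ell2 ι H} {M : ℝ} (hM : 0 ≤ M) (σ : Equiv.Perm ι)
    (h : ∀ i, ‖η (σ i)‖ ≤ M * ‖ξ i‖) : ‖η‖ ≤ M * ‖ξ‖ := by
  have h1 : HasSum (fun i => (M * ‖ξ i‖) ^ 2) ((M * ‖ξ‖) ^ 2) := by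
    simp only [mul_pow]
    exact (ell2_hasSum_norm_sq ξ).mul_left _
  have h2 : HasSum (fun i => ‖η (σ i)‖ ^ 2) (‖η‖ ^ 2) :=
    (σ.hasSum_iff (f := fun i => ‖η i‖ ^ 2)).2 (ell2_hasSum_norm_sq η)
  have h3 := hasSum_le (fun i => pow_le_pow_left₀ (norm_nonneg _) (h i) 2) h2 h1
  exact (pow_le_pow_iff_left₀ (norm_nonneg _) (by positivity) two_ne_zero).1 h3

theorem ell2_norm_apply_le (ξ : ell2 ι H) (i : ι) : ‖ξ i‖ ≤ ‖ξ‖ :=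
  lp.norm_apply_le_norm two_ne_zero ξ i

variable [InnerProductSpace ℂ H]

/-- The operator on a Hilbert sum that moves the summand `i` to the summand `σ i` by `T i`. -/
def permOp (σ : Equiv.Perm ι) (T : ι → H →L[ℂ] H) (M : ℝ) (hT : ∀ i, ‖T i‖ ≤ M) :
    ell2 ι H →L[ℂ] ell2 ι H :=
  LinearMap.mkContinuous
    { toFun := fun ξ => ⟨fun i => T (σ.symm i) (ξ (σ.symm i)),
        memℓp_two_of_norm_le (ξ := ξ) (M := M) σ fun i => by
          simpa using (T i).le_of_opNorm_le (hT i) (ξ i)⟩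
      map_add' := fun ξ η => lp.ext (funext fun i => map_add (T (σ.symm i)) _ _)
      map_smul' := fun c ξ => lp.ext (funext fun i => map_smul (T (σ.symm i)) c _) }
    |M| fun ξ => ell2_norm_le_of_norm_le (abs_nonneg M) σ fun i => by
      simpa using (T i).le_of_opNorm_le ((hT i).trans (le_abs_self M)) (ξ i)

variable {σ : Equiv.Perm ι} {T : ι → H →L[ℂ] H} {M : ℝ} {hT : ∀ i, ‖T i‖ ≤ M}

theorem permOp_apply (ξ : ell2 ι H) (i : ι) :
    permOp σ T M hT ξ i = T (σ.symm i) (ξ (σ.symm i)) := rfl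

theorem permOp_apply_perm (ξ : ell2 ι H) (i : ι) : permOp σ T M hT ξ (σ i) = T i (ξ i) := by
  rw [permOp_apply, Equiv.symm_apply_apply]

theorem norm_permOp_le (hM : 0 ≤ M) : ‖permOp σ T M hT‖ ≤ M := by
  have := LinearMap.mkContinuous_norm_le
    (permOp σ T M hT : ell2 ι H →ₗ[ℂ] ell2 ι H) hM fun ξ =>
      ell2_norm_le_of_norm_le hM σ fun i => by
        rw [ContinuousLinearMap.coe_coe, permOp_apply_perm]
        exact (T i).le_of_opNorm_le (hT i) (ξ i)
  exact this

variable [CompleteSpace H]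

theorem star_permOp :
    star (permOp σ T M hT) =
      permOp σ.symm (fun i => star (T (σ.symm i))) M (fun i => by rw [norm_star]; exact hT _) := by
  rw [ContinuousLinearMap.star_eq_adjoint]
  refine ((ContinuousLinearMap.eq_adjoint_iff _ _).2 fun ξ η => ?_).symm
  refine (lp.hasSum_inner _ _).unique ?_
  convert σ.hasSum_iff.2 (lp.hasSum_inner (𝕜 := ℂ) ξ (permOp σ T M hT η)) using 2 with i
  rw [Function.comp_apply, permOp_apply_perm, permOp_apply, Equiv.symm_symm,
    ContinuousLinearMap.star_eq_adjoint, ContinuousLinearMap.adjoint_inner_left,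
    Equiv.symm_apply_apply]

end SquareSummable

/-! ### Dirac operators on a Hilbert sum -/

section DiracSum

variable {ι : Type*} {H : Type*} [NormedAddCommGroup H] [InnerProductSpace ℂ H]

/-- The pairs `(ξ, w)` with `w (τ i) = D (ξ i) + √-1 m(i) ξ(i)` for all `i`. -/
def diracGraph (D : H →ₗ.[ℂ] H) (τ : Equiv.Perm ι) (m : ι → ℝ) :
    Submodule ℂ (ell2 ι H × ell2 ι H) where
  carrier := {p | ∀ i, ∃ x : D.domain, (x : H) = p.1 i ∧
    p.2 (τ i) = D x + (Complex.I * m i) • (x : H)}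
  zero_mem' := fun i => ⟨0, rfl, by simp⟩
  add_mem' := by
    intro p q hp hq i
    obtain ⟨x, hx, hx'⟩ := hp i
    obtain ⟨y, hy, hy'⟩ := hq i
    refine ⟨x + y, by simp [hx, hy], ?_⟩
    have : (p + q).2 (τ i) = p.2 (τ i) + q.2 (τ i) := rfl
    rw [this, hx', hy', LinearPMap.map_add, Submodule.coe_add, smul_add]
    abel
  smul_mem' := by
    intro c p hp i
    obtain ⟨x, hx, hx'⟩ := hp i
    refine ⟨c • x, by simp [hx], ?_⟩
    have : (c • p).2 (τ i) = c • p.2 (τ i) := rfl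
    rw [this, hx', LinearPMap.map_smul, Submodule.coe_smul, smul_add, smul_comm c]

/-- The operator `(ξ i)_i ↦ (D (ξ i) + √-1 m(i) ξ(i))_{τ i}` on its maximal domain. -/
def diracSum (D : H →ₗ.[ℂ] H) (τ : Equiv.Perm ι) (m : ι → ℝ) : ell2 ι H →ₗ.[ℂ] ell2 ι H :=
  (diracGraph D τ m).toLinearPMap

variable {D : H →ₗ.[ℂ] H} {τ : Equiv.Perm ι} {m : ι → ℝ}

theorem diracSum_graph : (diracSum D τ m).graph = diracGraph D τ m := by
  refine Submodule.toLinearPMap_graph_eq _ fun p hp h0 => ?_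
  refine lp.ext (funext fun j => ?_)
  obtain ⟨x, hx, hx'⟩ := hp (τ.symm j)
  have : x = 0 := Subtype.ext (by rw [hx, h0]; rfl)
  rw [Equiv.apply_symm_apply] at hx'
  rw [hx', this]
  simp

theorem diracSum_apply (ξ : (diracSum D τ m).domain) (i : ι) :
    ∃ x : D.domain, (x : H) = (ξ : ell2 ι H) i ∧
      diracSum D τ m ξ (τ i) = D x + (Complex.I * m i) • (x : H) := by
  have := (diracSum D τ m).mem_graph ξ
  rw [diracSum_graph] at this
  exact this i

theorem exists_diracSum_domain {ξ w : ell2 ι H} (h : ∀ i, ∃ x : D.domain, (x : H) = ξ i ∧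
    w (τ i) = D x + (Complex.I * m i) • (x : H)) :
    ∃ η : (diracSum D τ m).domain, (η : ell2 ι H) = ξ ∧ diracSum D τ m η = w := by
  have : (ξ, w) ∈ (diracSum D τ m).graph := by rw [diracSum_graph]; exact h
  exact (LinearPMap.mem_graph_iff _).1 this

variable [DecidableEq ι]

theorem diracSum_single (i : ι) (x : D.domain) :
    ∃ η : (diracSum D τ m).domain, (η : ell2 ι H) = lp.single 2 i (x : H) ∧
      diracSum D τ m η = lp.single 2 (τ i) (D x + (Complex.I * m i) • (x : H)) := by
  refine exists_diracSum_domain fun j => ?_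
  by_cases hj : j = i
  · subst hj
    exact ⟨x, by rw [lp.single_apply_self], by rw [lp.single_apply_self]⟩
  · refine ⟨0, ?_, ?_⟩
    · rw [lp.single_apply_ne _ _ _ hj]; rfl
    · rw [lp.single_apply_ne _ _ _ (fun h => hj (τ.injective h))]; simp

theorem dense_of_single_mem {S : Submodule ℂ (ell2 ι H)} {s : Set H} (hs : Dense s)
    (h : ∀ i, ∀ x ∈ s, (lp.single 2 i x : ell2 ι H) ∈ S) : Dense (S : Set (ell2 ι H)) := by
  rw [Submodule.dense_iff_topologicalClosure_eq_top, Submodule.eq_top_iff']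
  intro ξ
  have hsing : ∀ i (x : H), (lp.single 2 i x : ell2 ι H) ∈ S.topologicalClosure := by
    intro i x
    have hcl : IsClosed {x : H | (lp.single 2 i x : ell2 ι H) ∈ S.topologicalClosure} :=
      S.isClosed_topologicalClosure.preimage (lp.isometry_single i).continuous
    exact closure_minimal (s := s) (fun x hx => S.le_topologicalClosure (h i x hx)) hcl (hs x)
  refine S.isClosed_topologicalClosure.mem_of_tendsto (lp.hasSum_single ENNReal.ofNat_ne_top ξ)
    (Filter.Eventually.of_forall fun F => Submodule.sum_mem _ fun i _ => hsing i _)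

variable [CompleteSpace H]

/-- Oddness of `m` under the involution `τ` compensates the conjugation of `i m`, so the operator is
symmetric. Testing the adjoint on vectors with a single nonzero coordinate shows that every vector
of its domain is coordinatewise in the domain of `D`, i.e. in the maximal domain. -/
theorem isSelfAdjoint_diracSum (hD : IsSelfAdjoint D) (hτ : ∀ i, τ (τ i) = i)
    (hm : ∀ i, m (τ i) = - m i) : IsSelfAdjoint (diracSum D τ m) := by
  have hdense : Dense ((diracSum D τ m).domain : Set (ell2 ι H)) := by
    refine dense_of_single_mem hD.dense_domain fun i x hx => ?_
    obtain ⟨η, hη, -⟩ := diracSum_single (τ := τ) (m := m) i ⟨x, hx⟩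
    rw [← hη]; exact η.2
  have hsymm : (diracSum D τ m).IsFormalAdjoint (diracSum D τ m) := by
    intro ξ η
    have h1 := τ.hasSum_iff.2 (lp.hasSum_inner (𝕜 := ℂ) (diracSum D τ m ξ) (η : ell2 ι H))
    have h2 := lp.hasSum_inner (𝕜 := ℂ) (ξ : ell2 ι H) (diracSum D τ m η)
    refine h1.unique ?_
    convert h2 using 2 with i
    obtain ⟨x, hx, hx'⟩ := diracSum_apply ξ i
    obtain ⟨y, hy, hy'⟩ := diracSum_apply η (τ i)
    rw [hτ] at hy'
    simp only [Function.comp_apply]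
    rw [hx', hy', ← hx, ← hy, inner_add_left, inner_add_right, inner_apply_left_eq_right hD,
      inner_smul_left, inner_smul_right, hm]
    simp
  rw [LinearPMap.isSelfAdjoint_def]
  refine le_antisymm ?_ (hsymm.le_adjoint hdense)
  refine LinearPMap.le_of_le_graph ?_
  rintro ⟨y, w⟩ hyw
  obtain ⟨η, hη, hη'⟩ := (LinearPMap.mem_graph_iff _).1 hyw
  dsimp only at hη hη'
  have hadj : ∀ x : (diracSum D τ m).domain, ⟪w, (x : ell2 ι H)⟫_ℂ = ⟪y, diracSum D τ m x⟫_ℂ := by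
    intro x
    rw [← hη, ← hη']
    exact LinearPMap.adjoint_isFormalAdjoint hdense η x
  rw [diracSum_graph]
  intro i
  obtain ⟨z, hz, hz'⟩ := exists_domain_of_inner_eq hD (x := y i)
    (w := w (τ i) - (Complex.I * m i) • y i) (by
      intro v
      obtain ⟨x, hx, hx'⟩ := diracSum_single (τ := τ) (m := m) (τ i) v
      have := hadj x
      rw [hx, hx', lp.inner_single_right, lp.inner_single_right, hτ, hm, inner_add_right,
        inner_smul_right] at this
      rw [inner_sub_left, this, inner_smul_left]
      simp)
  exact ⟨z, hz, by rw [hz', hz]; simp⟩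

/-- Each coordinate `x` of a vector in the unit graph ball satisfies `‖D x‖² + m(i)² ‖x‖² ≤ 1`.
Coordinates with large weight are therefore uniformly negligible, and the finitely many others lie
in the precompact graph ball of `D`. -/
theorem hasCompactResolvent_diracSum (hD : IsSelfAdjoint D) (hτ : ∀ i, τ (τ i) = i)
    (hm : ∀ i, m (τ i) = - m i) (hDc : HasCompactResolvent D)
    (hmc : Filter.Tendsto (fun i => |m i|) Filter.cofinite Filter.atTop) :
    HasCompactResolvent (diracSum D τ m) := by
  refine hasCompactResolvent_of_totallyBounded (isSelfAdjoint_diracSum hD hτ hm) ?_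
  refine totallyBounded_of_forall_approx fun ε hε => ?_
  have hfin : {i | ¬ 2 / ε ≤ |m i|}.Finite := hmc.eventually_ge_atTop (2 / ε)
  let F := hfin.toFinset
  refine ⟨_, TotallyBounded.finset_sum F (K := fun i => lp.single (E := fun _ => H) 2 i ''
    graphBall D 1) (fun i _ =>
      (hDc.totallyBounded_graphBall 1).image (lp.isometry_single i).uniformContinuous), ?_⟩
  rintro _ ⟨ξ, rfl, hξ, hDξ⟩
  have hcoord : ∀ i, ∃ x : D.domain, (x : H) = (ξ : ell2 ι H) i ∧
      ‖D x‖ ≤ ‖diracSum D τ m ξ (τ i)‖ ∧ |m i| * ‖(x : H)‖ ≤ ‖diracSum D τ m ξ (τ i)‖ := by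
    intro i
    obtain ⟨x, hx, hx'⟩ := diracSum_apply ξ i
    have h := norm_sq_apply_add_I_smul hD (m i) x
    rw [← hx', ← sq_abs (m i), ← mul_pow] at h
    have h1 := norm_nonneg (diracSum D τ m ξ (τ i))
    exact ⟨x, hx, abs_le_of_sq_le_sq' (by nlinarith [sq_nonneg (|m i| * ‖(x : H)‖)]) h1 |>.2,
      abs_le_of_sq_le_sq' (by nlinarith [sq_nonneg ‖D x‖]) h1 |>.2⟩
  refine ⟨∑ i ∈ F, lp.single 2 i ((ξ : ell2 ι H) i), ⟨_, fun i _ => ?_, rfl⟩, ?_⟩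
  · obtain ⟨x, hx, hx', -⟩ := hcoord i
    exact ⟨_, ⟨x, hx, (ell2_norm_apply_le _ i).trans hξ,
      hx'.trans ((ell2_norm_apply_le _ _).trans hDξ)⟩, rfl⟩
  · rw [dist_eq_norm]
    -- Off `F` the weight is at least `2 / ε`, so each coordinate of `ξ` is at most `ε / 2` times
    -- the coordinate of its image at `τ i`.
    have hle : ‖(ξ : ell2 ι H) - ∑ i ∈ F, lp.single 2 i ((ξ : ell2 ι H) i)‖
        ≤ (ε / 2) * ‖diracSum D τ m ξ‖ := by
      refine ell2_norm_le_of_norm_le (by positivity) τ.symm fun j => ?_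
      obtain ⟨i, rfl⟩ := τ.surjective j
      rw [Equiv.symm_apply_apply]
      have hval : ((ξ : ell2 ι H) - ∑ i ∈ F, lp.single 2 i ((ξ : ell2 ι H) i) : ell2 ι H) i =
          if i ∈ F then 0 else (ξ : ell2 ι H) i := by
        rw [lp.coeFn_sub, Pi.sub_apply, lp.coeFn_sum, Finset.sum_apply]
        simp only [lp.single_apply, Pi.single_apply]
        split_ifs <;> simp_all
      rw [hval]
      split_ifs with hi
      · rw [norm_zero]; positivity
      · obtain ⟨x, hx, -, hx'⟩ := hcoord i
        have h2 : 2 / ε ≤ |m i| := by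
          by_contra hcon
          exact hi (hfin.mem_toFinset.2 hcon)
        rw [← hx]
        calc ‖(x : H)‖ = (ε / 2) * ((2 / ε) * ‖(x : H)‖) := by field_simp
          _ ≤ (ε / 2) * (|m i| * ‖(x : H)‖) := by gcongr
          _ ≤ _ := by gcongr
    calc _ ≤ (ε / 2) * ‖diracSum D τ m ξ‖ := hle
      _ ≤ (ε / 2) * 1 := by gcongr
      _ < ε := by linarith

end DiracSum
end
end SpectralMetric

namespace SpectralMetric
noncomputable section

/-! ### Positive functionals, states and Hahn-Banach separation -/

section States

open scoped ComplexStarModule ComplexOrder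

variable {A : Type*} [CStarAlgebra A]

/-- Positivity of a functional on a C⋆-algebra. -/
def IsPositiveFunctional (g : A →L[ℂ] ℂ) : Prop :=
  ∀ a : A, ∃ r : ℝ, 0 ≤ r ∧ g (star a * a) = r

attribute [local instance] CStarAlgebra.spectralOrder CStarAlgebra.spectralOrderedRing

/-- Positivity on `‖a‖ • 1 ± a` gives `|G a| ≤ G 1 * ‖a‖`; the complex-linear extension then costs a
factor `2`, one for each of the real and imaginary parts. -/
theorem exists_extension_of_nonneg (G : selfAdjoint A →ₗ[ℝ] ℝ)
    (hG : ∀ a : selfAdjoint A, 0 ≤ (a : A) → 0 ≤ G a) :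
    ∃ g : A →L[ℂ] ℂ, IsPositiveFunctional g ∧ (∀ a : selfAdjoint A, g a = G a) ∧
      ∀ a, ‖g a‖ ≤ 2 * G 1 * ‖a‖ := by
  have hbound : ∀ a : selfAdjoint A, |G a| ≤ G 1 * ‖(a : A)‖ := by
    intro a
    have h1 : 0 ≤ G (‖(a : A)‖ • 1 - a) := hG _ (by
      have := IsSelfAdjoint.le_algebraMap_norm_self (a := (a : A)) a.2
      rw [Algebra.algebraMap_eq_smul_one] at this
      simpa using this)
    have h2 : 0 ≤ G (‖(a : A)‖ • 1 + a) := hG _ (by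
      have := IsSelfAdjoint.neg_algebraMap_norm_le_self (a := (a : A)) a.2
      rw [Algebra.algebraMap_eq_smul_one, neg_le_iff_add_nonneg'] at this
      simpa using this)
    rw [map_sub, map_smul, smul_eq_mul] at h1
    rw [map_add, map_smul, smul_eq_mul] at h2
    rw [abs_le]
    constructor <;> linarith
  let g₀ : A →ₗ[ℂ] ℂ :=
    { toFun := fun a => (G (ℜ a) : ℂ) + Complex.I * (G (ℑ a) : ℂ)
      map_add' := fun a b => by simp only [map_add]; push_cast; ring
      map_smul' := fun z a => by
        rw [realPart_smul, imaginaryPart_smul]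
        apply Complex.ext <;> simp }
  have hg₀ : ∀ a, g₀ a = (G (ℜ a) : ℂ) + Complex.I * (G (ℑ a) : ℂ) := fun a => rfl
  have h1 : 0 ≤ G 1 := hG 1 (by simp)
  have hb : ∀ a, ‖g₀ a‖ ≤ 2 * G 1 * ‖a‖ := by
    intro a
    rw [hg₀]
    refine (norm_add_le _ _).trans ?_
    rw [norm_mul, Complex.norm_I, one_mul, Complex.norm_real, Complex.norm_real,
      Real.norm_eq_abs, Real.norm_eq_abs]
    have h3 : ‖((ℜ a : selfAdjoint A) : A)‖ ≤ ‖a‖ := realPart.norm_le a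
    have h4 : ‖((ℑ a : selfAdjoint A) : A)‖ ≤ ‖a‖ := imaginaryPart.norm_le a
    calc _ ≤ G 1 * ‖((ℜ a : selfAdjoint A) : A)‖ + G 1 * ‖((ℑ a : selfAdjoint A) : A)‖ :=
          add_le_add (hbound _) (hbound _)
      _ ≤ G 1 * ‖a‖ + G 1 * ‖a‖ := by gcongr
      _ = _ := by ring
  have hsa : ∀ a : selfAdjoint A, g₀ a = G a := by
    intro a
    have hr : ℜ (a : A) = a := Subtype.ext (IsSelfAdjoint.coe_realPart a.2)
    rw [hg₀, hr, IsSelfAdjoint.imaginaryPart a.2]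
    simp
  refine ⟨g₀.mkContinuous _ hb, fun a => ?_, hsa, hb⟩
  exact ⟨G ⟨star a * a, IsSelfAdjoint.star_mul_self a⟩, hG _ (star_mul_self_nonneg a),
    hsa ⟨star a * a, IsSelfAdjoint.star_mul_self a⟩⟩

theorem ext_of_selfAdjoint {f g : A →L[ℂ] ℂ} (h : ∀ a : selfAdjoint A, f a = g a) : f = g := by
  ext a
  rw [← realPart_add_I_smul_imaginaryPart a, map_add, map_add, map_smul, map_smul, h, h]

/-- Jordan decomposition by the M. Riesz extension theorem on pairs of selfadjoint elements. On the
pairs with `p + q = t • 1` consider `f (p - q) / 2 + ‖f‖ t`. A positive extension `G` has the two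
parts `G (a, 0)` and `G (0, a)`, whose difference is `G (a, -a) = f a`. -/
theorem exists_sub_eq_of_hermitian (f : A →L[ℂ] ℂ)
    (hf : ∀ a : selfAdjoint A, (f a).im = 0) :
    ∃ G₁ G₂ : selfAdjoint A →ₗ[ℝ] ℝ,
      (∀ a : selfAdjoint A, 0 ≤ (a : A) → 0 ≤ G₁ a) ∧
      (∀ a : selfAdjoint A, 0 ≤ (a : A) → 0 ≤ G₂ a) ∧
      ∀ a : selfAdjoint A, f a = G₁ a - G₂ a := by
  rcases subsingleton_or_nontrivial A with hA | hA
  · refine ⟨0, 0, by simp, by simp, fun a => ?_⟩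
    rw [Subsingleton.elim (a : A) 0]; simp
  -- A functional with value `1` at the unit reads off the scalar `t` from `t • 1` linearly.
  obtain ⟨t₀, -, ht₀⟩ := exists_dual_vector'' ℂ (1 : A)
  rw [CStarRing.norm_one] at ht₀
  let C : PointedCone ℝ (selfAdjoint A × selfAdjoint A) :=
    { carrier := {p | 0 ≤ (p.1 : A) ∧ 0 ≤ (p.2 : A)}
      zero_mem' := by simp
      add_mem' := fun {p q} hp hq => ⟨add_nonneg hp.1 hq.1, add_nonneg hp.2 hq.2⟩
      smul_mem' := fun c p hp => ⟨smul_nonneg c.2 hp.1, smul_nonneg c.2 hp.2⟩ }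
  have hC : ∀ p : selfAdjoint A × selfAdjoint A, p ∈ C ↔ 0 ≤ (p.1 : A) ∧ 0 ≤ (p.2 : A) := fun p => Iff.rfl
  let N : Submodule ℝ (selfAdjoint A × selfAdjoint A) :=
    { carrier := {p | ∃ t : ℝ, (p.1 : A) + p.2 = t • (1 : A)}
      zero_mem' := ⟨0, by simp⟩
      add_mem' := by
        rintro p q ⟨s, hs⟩ ⟨t, ht⟩
        refine ⟨s + t, ?_⟩
        rw [add_smul, ← hs, ← ht]
        simp only [Prod.fst_add, Prod.snd_add, AddSubgroup.coe_add]
        abel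
      smul_mem' := by
        rintro c p ⟨s, hs⟩
        exact ⟨c * s, by rw [mul_smul, ← hs]; simp⟩ }
  let F₀ : (selfAdjoint A × selfAdjoint A) →ₗ[ℝ] ℝ :=
    { toFun := fun p => (f p.1 - f p.2).re / 2 + ‖f‖ * (t₀ ((p.1 : A) + p.2)).re
      map_add' := fun p q => by
        simp only [Prod.fst_add, Prod.snd_add, AddSubgroup.coe_add, map_add, Complex.sub_re,
          Complex.add_re]
        ring
      map_smul' := fun c p => by
        simp only [Prod.smul_fst, Prod.smul_snd, selfAdjoint.val_smul, map_add,
          Complex.sub_re, Complex.add_re, RingHom.id_apply, smul_eq_mul]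
        rw [← Complex.coe_smul c (p.1 : A), ← Complex.coe_smul c (p.2 : A)]
        simp only [map_smul, smul_eq_mul, Complex.re_ofReal_mul]
        ring }
  have hF₀ : ∀ p : selfAdjoint A × selfAdjoint A, F₀ p = (f p.1 - f p.2).re / 2 + ‖f‖ * (t₀ ((p.1 : A) + p.2)).re :=
    fun p => rfl
  let F : (selfAdjoint A × selfAdjoint A) →ₗ.[ℝ] ℝ := ⟨N, F₀.comp N.subtype⟩
  -- For positive `p` and `q` with sum `t • 1`, both norms are at most `t`, so `f (p - q) / 2` is at
  -- least `-‖f‖ t`. The second obligation holds because a large multiple of `(1, 1)` dominates any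
  -- pair.
  obtain ⟨G, hG, hG'⟩ := riesz_extension C F (by
    rintro ⟨p, t, ht⟩ hp
    rw [hC] at hp
    change 0 ≤ F₀ p
    obtain ⟨h1, h2⟩ := hp
    simp only at h1 h2
    have h3 : ‖((p.1 : A) + p.2)‖ = |t| := by rw [ht, norm_smul, CStarRing.norm_one]; simp
    have h4 : ‖(p.1 : A)‖ ≤ |t| := h3 ▸
      CStarAlgebra.norm_le_norm_of_nonneg_of_le h1 (le_add_of_nonneg_right h2)
    have h5 : ‖(p.2 : A)‖ ≤ |t| := h3 ▸
      CStarAlgebra.norm_le_norm_of_nonneg_of_le h2 (le_add_of_nonneg_left h1)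
    have h6 : 0 ≤ t := by
      have h7 : (0 : A) ≤ t • 1 := ht ▸ add_nonneg h1 h2
      by_contra hneg
      have h8 : t • (1 : A) ≤ 0 := by
        have : (0 : A) ≤ (-t) • 1 := smul_nonneg (by linarith) zero_le_one
        rw [neg_smul] at this
        exact neg_nonneg.1 this
      have h9 := le_antisymm h8 h7
      rw [smul_eq_zero] at h9
      rcases h9 with h9 | h9
      · linarith
      · exact one_ne_zero h9
    rw [abs_of_nonneg h6] at h4 h5
    have h10 : ‖f p.1 - f p.2‖ ≤ ‖f‖ * t + ‖f‖ * t := by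
      refine (norm_sub_le _ _).trans (add_le_add ?_ ?_)
      · exact (f.le_opNorm _).trans (by gcongr)
      · exact (f.le_opNorm _).trans (by gcongr)
    have h11 := (abs_le.1 ((Complex.abs_re_le_norm _).trans h10)).1
    rw [hF₀, ht, ← Complex.coe_smul, map_smul, ht₀]
    simp only [smul_eq_mul, RCLike.ofReal_one, mul_one,
      Complex.ofReal_re]
    linarith) (by
    intro y
    let t : ℝ := ‖(y.1 : A)‖ + ‖(y.2 : A)‖
    refine ⟨⟨(t • 1, t • 1), 2 * t, ?_⟩, ?_⟩
    · simp [two_mul, add_smul]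
    · have key : ∀ a : selfAdjoint A, ‖(a : A)‖ ≤ t → 0 ≤ ((t • (1 : selfAdjoint A) + a : selfAdjoint A) : A) := by
        intro a ha
        have h1 := IsSelfAdjoint.neg_algebraMap_norm_le_self (a := (a : A)) a.2
        rw [Algebra.algebraMap_eq_smul_one, neg_le_iff_add_nonneg'] at h1
        have h2 : (0 : A) ≤ (t - ‖(a : A)‖) • 1 := smul_nonneg (by linarith) zero_le_one
        have := add_nonneg h1 h2
        rw [sub_smul] at this
        convert this using 1
        simp only [AddSubgroup.coe_add, selfAdjoint.val_smul, selfAdjoint.val_one]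
        abel
      exact ⟨key y.1 (le_add_of_nonneg_right (norm_nonneg _)),
        key y.2 (le_add_of_nonneg_left (norm_nonneg _))⟩)
  refine ⟨G.comp (LinearMap.inl ℝ _ _), G.comp (LinearMap.inr ℝ _ _),
    fun a ha => hG' _ ⟨ha, le_rfl⟩, fun a ha => hG' _ ⟨le_rfl, ha⟩, fun a => ?_⟩
  have h1 := hG ⟨(a, -a), 0, by simp⟩
  have h2 : ((a, -a) : selfAdjoint A × selfAdjoint A) = (a, 0) - (0, a) := by simp
  have h3 : F ⟨(a, -a), 0, by simp⟩ = (f a).re := by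
    change F₀ (a, -a) = _
    rw [hF₀]
    simp
  rw [h3] at h1
  simp only [h2, map_sub] at h1
  simp only [LinearMap.comp_apply, LinearMap.inl_apply, LinearMap.inr_apply]
  apply Complex.ext
  · rw [← h1]; simp
  · simp [hf a]

theorem exists_hermitianPart (f : A →L[ℂ] ℂ) :
    ∃ F : A →L[ℂ] ℂ, ∀ a, F a = (f a + starRingEnd ℂ (f (star a))) / 2 := by
  let F₀ : A →ₗ[ℂ] ℂ :=
    { toFun := fun a => (f a + starRingEnd ℂ (f (star a))) / 2
      map_add' := fun a b => by simp only [map_add, star_add]; ring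
      map_smul' := fun z a => by
        simp only [map_smul, star_smul, smul_eq_mul, map_mul, RingHom.id_apply, Complex.star_def,
          Complex.conj_conj]
        ring }
  refine ⟨F₀.mkContinuous ‖f‖ fun a => ?_, fun a => rfl⟩
  change ‖(f a + starRingEnd ℂ (f (star a))) / 2‖ ≤ _
  rw [norm_div, Complex.norm_ofNat, div_le_iff₀ two_pos]
  refine (norm_add_le _ _).trans ?_
  rw [RCLike.norm_conj]
  have h1 := f.le_opNorm a
  have h2 := f.le_opNorm (star a)
  rw [norm_star] at h2
  linarith

/-- Decompose the hermitian part of a functional that norms `star a * a`: one of the two positive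
parts must be nonzero there. -/
theorem exists_isPositiveFunctional_ne_zero {a : A} (ha : a ≠ 0) :
    ∃ g : A →L[ℂ] ℂ, IsPositiveFunctional g ∧ g (star a * a) ≠ 0 := by
  have hb : star a * a ≠ 0 := fun h => ha (CStarRing.star_mul_self_eq_zero_iff a |>.1 h)
  obtain ⟨f, -, hf⟩ := exists_dual_vector'' ℂ (star a * a)
  obtain ⟨F, hF⟩ := exists_hermitianPart f
  have hsa : ∀ c : selfAdjoint A, F c = (f c).re := fun c => by
    rw [hF, show star (c : A) = c from c.2, Complex.add_conj]
    simp
  obtain ⟨G₁, G₂, h₁, h₂, hG⟩ := exists_sub_eq_of_hermitian F fun c => by rw [hsa]; simp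
  let b : selfAdjoint A := ⟨star a * a, IsSelfAdjoint.star_mul_self a⟩
  have hval : F b ≠ 0 := by
    rw [hsa b]
    change ((f (star a * a)).re : ℂ) ≠ 0
    rw [hf]
    simpa using hb
  obtain ⟨g₁, hg₁, hg₁', -⟩ := exists_extension_of_nonneg G₁ h₁
  obtain ⟨g₂, hg₂, hg₂', -⟩ := exists_extension_of_nonneg G₂ h₂
  by_contra! hcon
  have e1 : g₁ b = 0 := hcon g₁ hg₁
  have e2 : g₂ b = 0 := hcon g₂ hg₂
  rw [hg₁'] at e1
  rw [hg₂'] at e2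
  exact hval (by rw [hG, e1, e2, sub_zero])

/-- A nonzero hermitian functional that vanishes at `1` is a positive multiple of a difference of
two states. -/
theorem exists_states_of_hermitian {F : A →L[ℂ] ℂ}
    (hF : ∀ a : selfAdjoint A, (F a).im = 0) (h1 : F 1 = 0) (h0 : F ≠ 0) :
    ∃ (c : ℝ) (ρ ω : A →L[ℂ] ℂ), 0 < c ∧ IsState ρ ∧ IsState ω ∧ ∀ a, F a = c * (ρ a - ω a) := by
  obtain ⟨G₁, G₂, h₁, h₂, hG⟩ := exists_sub_eq_of_hermitian F hF
  obtain ⟨g₁, hg₁, hg₁', hb₁⟩ := exists_extension_of_nonneg G₁ h₁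
  obtain ⟨g₂, hg₂, hg₂', hb₂⟩ := exists_extension_of_nonneg G₂ h₂
  have hFg : F = g₁ - g₂ := ext_of_selfAdjoint fun a => by
    rw [hG, sub_apply, hg₁', hg₂']
  -- Since `F 1 = 0`, both positive parts have the same mass, and one constant normalizes both to
  -- states.
  have heq : G₁ 1 = G₂ 1 := by
    have := hG 1
    rw [selfAdjoint.val_one, h1, eq_comm, sub_eq_zero] at this
    exact_mod_cast this
  have hpos : 0 ≤ G₁ 1 := h₁ 1 (by simp)
  have hne : G₁ 1 ≠ 0 := by
    intro hz
    apply h0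
    rw [← heq, hz] at hb₂
    rw [hz] at hb₁
    ext a
    have e1 : g₁ a = 0 := by simpa using hb₁ a
    have e2 : g₂ a = 0 := by simpa using hb₂ a
    rw [hFg, sub_apply, e1, e2]
    simp
  have hc : ((G₁ 1 : ℝ) : ℂ) ≠ 0 := by exact_mod_cast hne
  have hst : ∀ g : A →L[ℂ] ℂ, IsPositiveFunctional g → g 1 = G₁ 1 →
      IsState (((G₁ 1)⁻¹ : ℂ) • g) := by
    intro g hg hg1
    refine ⟨fun a => ?_, by rw [smul_apply, hg1, smul_eq_mul, inv_mul_cancel₀ hc]⟩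
    obtain ⟨r, hr, hr'⟩ := hg a
    exact ⟨(G₁ 1)⁻¹ * r, by positivity, by rw [smul_apply, hr']; simp⟩
  have e1 : g₁ 1 = G₁ 1 := by simpa using hg₁' 1
  have e2 : g₂ 1 = G₁ 1 := by rw [heq]; simpa using hg₂' 1
  refine ⟨G₁ 1, _, _, lt_of_le_of_ne hpos (Ne.symm hne), hst g₁ hg₁ e1, hst g₂ hg₂ e2,
    fun a => ?_⟩
  rw [hFg]
  simp only [sub_apply, smul_apply, smul_eq_mul]
  field_simp

/-- A closed, balanced, convex, `star`-invariant set containing the scalars is determined on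
selfadjoint elements by the differences of states. -/
theorem mem_of_forall_states {C : Set A} (hcl : IsClosed C) (hconv : Convex ℝ C)
    (hbal : ∀ b ∈ C, ∀ z : ℂ, ‖z‖ = 1 → z • b ∈ C) (hstar : ∀ b ∈ C, star b ∈ C)
    (hone : ∀ z : ℂ, z • (1 : A) ∈ C) {a : A} (ha : IsSelfAdjoint a)
    (h : ∀ ρ ω : A →L[ℂ] ℂ, IsState ρ → IsState ω → ∀ r : ℝ,
      (∀ b ∈ C, ‖ρ b - ω b‖ ≤ r) → ‖ρ a - ω a‖ ≤ r) : a ∈ C := by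
  by_contra haC
  obtain ⟨f, u, hfu, hua⟩ := RCLike.geometric_hahn_banach_closed_point (𝕜 := ℂ) hconv hcl haC
  simp only [RCLike.re_to_complex] at hfu hua
  -- Passing to the hermitian part keeps the separation, as `a` is selfadjoint and `C` is stable
  -- under `star`.
  obtain ⟨F, hF⟩ := exists_hermitianPart f
  have hre : ∀ b, (F b).re = ((f b).re + (f (star b)).re) / 2 := fun b => by
    rw [hF, ← Complex.ofReal_ofNat, Complex.div_ofReal_re]
    simp
  have hFC : ∀ b ∈ C, (F b).re < u := fun b hb => by
    rw [hre]
    have := hfu b hb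
    have := hfu _ (hstar b hb)
    linarith
  have hFa : u < (F a).re := by
    rw [hre, ha.star_eq]
    linarith
  have hu : 0 < u := by simpa using hFC _ (hone 0)
  have hnorm : ∀ b ∈ C, ‖F b‖ ≤ u := by
    intro b hb
    by_cases hz : F b = 0
    · rw [hz, norm_zero]; exact hu.le
    · have hz' : (‖F b‖ : ℂ) ≠ 0 := by simpa using hz
      have := hFC _ (hbal b hb (starRingEnd ℂ (F b) / ‖F b‖) (by
        rw [norm_div, RCLike.norm_conj, Complex.norm_real, norm_norm]
        exact div_self (by simpa using hz)))
      rw [map_smul, smul_eq_mul, div_mul_eq_mul_div, mul_comm, Complex.mul_conj,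
        Complex.normSq_eq_norm_sq, Complex.ofReal_pow, sq, mul_div_assoc, div_self hz',
        mul_one, Complex.ofReal_re] at this
      exact this.le
  have hF1 : F 1 = 0 := by
    by_contra hne
    -- If `F 1` were nonzero, this multiple of the unit would have value `u + 1`, above the bound
    -- `u` on `C`.
    have := hnorm _ (hone (((u + 1) : ℝ) / F 1))
    rw [map_smul, smul_eq_mul, div_mul_cancel₀ _ hne, Complex.norm_real, Real.norm_eq_abs,
      abs_of_pos (by linarith)] at this
    linarith
  obtain ⟨c, ρ, ω, hc, hρ, hω, hFρ⟩ := exists_states_of_hermitian (F := F) (fun b => by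
    rw [hF, show star (b : A) = b from b.2, Complex.add_conj]
    simp) hF1 (by
      rintro rfl
      simp only [zero_apply, Complex.zero_re] at hFa
      linarith)
  have hn : ∀ b, ‖F b‖ = c * ‖ρ b - ω b‖ := fun b => by
    rw [hFρ, norm_mul, Complex.norm_real, Real.norm_eq_abs, abs_of_pos hc]
  have := h ρ ω hρ hω (u / c) fun b hb => by
    rw [le_div_iff₀ hc, mul_comm, ← hn]
    exact hnorm b hb
  rw [le_div_iff₀ hc, mul_comm, ← hn] at this
  have h2 := Complex.re_le_norm (F a)
  linarith

/-- In the GNS representation of a positive `g` with `g (star a * a) ≠ 0`, the operator of `a` does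
not kill the class of the unit. -/
theorem exists_representation_ne_zero {A : Type u} [CStarAlgebra A] {a : A} (ha : a ≠ 0) :
    ∃ (H : Type u) (_ : NormedAddCommGroup H) (_ : InnerProductSpace ℂ H) (_ : CompleteSpace H)
      (φ : A →⋆ₐ[ℂ] (H →L[ℂ] H)), φ a ≠ 0 := by
  obtain ⟨g, hg, hga⟩ := exists_isPositiveFunctional_ne_zero ha
  let f : A →ₚ[ℂ] ℂ := PositiveLinearMap.mk₀ (g : A →ₗ[ℂ] ℂ) (fun b hb => by
    obtain ⟨c, rfl⟩ := CStarAlgebra.nonneg_iff_eq_star_mul_self.1 hb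
    obtain ⟨r, hr, hr'⟩ := hg c
    change 0 ≤ g (star c * c)
    rw [hr']
    exact_mod_cast hr)
  refine ⟨f.GNS, inferInstance, inferInstance, inferInstance, f.gnsStarAlgHom, fun h0 => hga ?_⟩
  have h1 := DFunLike.congr_fun h0 ((f.toPreGNS 1 : f.PreGNS) : f.GNS)
  have h2 : f.gnsStarAlgHom a ((f.toPreGNS 1 : f.PreGNS) : f.GNS) =
      ((f.toPreGNS a : f.PreGNS) : f.GNS) := by
    change f.gnsNonUnitalStarAlgHom a _ = _
    rw [PositiveLinearMap.gnsNonUnitalStarAlgHom_apply_coe]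
    simp
  rw [h2, zero_apply] at h1
  have h3 : ‖f.toPreGNS a‖ = 0 := by
    rw [← UniformSpace.Completion.norm_coe, h1, norm_zero]
  have h4 := f.preGNS_norm_sq (f.toPreGNS a)
  rw [h3] at h4
  have h5 : f (star a * a) = 0 := by simpa using h4.symm
  exact h5

end States
end
end SpectralMetric

/-! ### Lipschitz balls and their recovery from the Connes metric -/

namespace SpectralMetric
noncomputable section

/-- The elements with bounded commutator, as a ⋆-subalgebra. -/
def commutatorSubalgebra {B : Type*} [CStarAlgebra B] {H : Type*} [NormedAddCommGroup H]
    [InnerProductSpace ℂ H] [CompleteSpace H] {D : H →ₗ.[ℂ] H} (hD : IsSelfAdjoint D)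
    (π : B →⋆ₐ[ℂ] (H →L[ℂ] H)) : StarSubalgebra ℂ B where
  carrier := {b | ∃ T : H →L[ℂ] H, IsCommutator D (π b) T}
  mul_mem' := fun ⟨_, hS⟩ ⟨_, hT⟩ => ⟨_, by rw [map_mul]; exact hS.mul hD hT⟩
  add_mem' := fun ⟨_, hS⟩ ⟨_, hT⟩ => ⟨_, by rw [map_add]; exact hS.add hD hT⟩
  algebraMap_mem' := fun z => ⟨z • 0, by
    rw [Algebra.algebraMap_eq_smul_one, map_smul, map_one]
    exact (IsCommutator.one hD).smul hD z⟩
  star_mem' := fun ⟨_, hS⟩ => ⟨_, by rw [map_star]; exact hS.star hD⟩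

namespace SpectralTriple

variable {B : Type*} [CStarAlgebra B] (X : SpectralTriple.{u} B)

/-- The elements `b` with `‖[D, b]‖ ≤ M`. -/
def lip (M : ℝ) : Set B := {b | CommutatorBound X.D (X.π b) M}

theorem mem_C1_iff {b : B} : b ∈ X.C1 ↔ ∃ M, b ∈ X.lip M :=
  ⟨fun ⟨T, hT⟩ => ⟨‖T‖, T, hT, le_rfl⟩, fun ⟨_, T, hT, _⟩ => ⟨T, hT⟩⟩

theorem isClosed_lip (M : ℝ) : IsClosed (X.lip M) :=
  (isClosed_commutatorBound X.isSelfAdjoint M).preimage (continuous_starAlgHom X.π)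

variable {X} {a b : B} {M M' : ℝ}

theorem lip_mono (h : b ∈ X.lip M) (hM : M ≤ M') : b ∈ X.lip M' := CommutatorBound.mono h hM

theorem lip_nonneg (h : b ∈ X.lip M) : 0 ≤ M := CommutatorBound.nonneg h

theorem lip_add (ha : a ∈ X.lip M) (hb : b ∈ X.lip M') : a + b ∈ X.lip (M + M') := by
  have := CommutatorBound.add X.isSelfAdjoint ha hb
  rwa [← map_add] at this

theorem lip_smul (z : ℂ) (hb : b ∈ X.lip M) : z • b ∈ X.lip (‖z‖ * M) := by
  have := CommutatorBound.smul X.isSelfAdjoint z hb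
  rwa [← map_smul] at this

theorem lip_sub (ha : a ∈ X.lip M) (hb : b ∈ X.lip M') : a - b ∈ X.lip (M + M') := by
  have := lip_add ha (lip_smul (-1) hb)
  simpa [sub_eq_add_neg] using this

theorem lip_star (hb : b ∈ X.lip M) : star b ∈ X.lip M := by
  have := CommutatorBound.star X.isSelfAdjoint hb
  rwa [← map_star] at this

theorem smul_one_mem_lip (z : ℂ) (hM : 0 ≤ M) : z • (1 : B) ∈ X.lip M := by
  refine ⟨z • 0, ?_, by simpa using hM⟩
  rw [map_smul, map_one]
  exact (IsCommutator.one X.isSelfAdjoint).smul X.isSelfAdjoint z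

theorem add_smul_one_mem_lip (z : ℂ) (hb : b ∈ X.lip M) : b + z • (1 : B) ∈ X.lip M := by
  have := lip_add hb (smul_one_mem_lip (X := X) z le_rfl)
  rwa [add_zero] at this

theorem convex_lip (X : SpectralTriple.{u} B) (M : ℝ) : Convex ℝ (X.lip M) := by
  intro a ha b hb s t hs ht hst
  have := lip_add (lip_smul (s : ℂ) ha) (lip_smul (t : ℂ) hb)
  rw [Complex.norm_real, Complex.norm_real, Real.norm_of_nonneg hs, Real.norm_of_nonneg ht,
    ← add_mul, hst, one_mul, Complex.coe_smul, Complex.coe_smul] at this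
  exact this

end SpectralTriple

open SpectralTriple

section Comparison

open scoped ComplexStarModule

variable {A : Type v} [CStarAlgebra A] {B₁ B₂ : Type*} [CStarAlgebra B₁] [CStarAlgebra B₂]
  {Y₁ : SpectralTriple.{u} B₁} {j₁ : A →⋆ₐ[ℂ] B₁} {Y₂ : SpectralTriple.{u} B₂} {j₂ : A →⋆ₐ[ℂ] B₂}

theorem inducedConnesDist_le {K : ℝ} (hK : 0 < K) {ρ ω : A →L[ℂ] ℂ} {r : ℝ}
    (h : ∀ b, j₁ b ∈ Y₁.lip K → ‖ρ b - ω b‖ ≤ r) :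
    inducedConnesDist Y₁ j₁ ρ ω ≤ ENNReal.ofReal (r / K) := by
  refine iSup₂_le fun b hb => ?_
  rw [← ofReal_norm]
  refine ENNReal.ofReal_le_ofReal ?_
  have h1 : j₁ ((K : ℂ) • b) ∈ Y₁.lip K := by
    rw [map_smul]
    refine lip_mono (lip_smul (K : ℂ) hb) ?_
    rw [Complex.norm_real, Real.norm_of_nonneg hK.le, mul_one]
  have h2 := h _ h1
  rw [map_smul, map_smul, ← smul_sub, norm_smul, Complex.norm_real, Real.norm_of_nonneg hK.le] at h2
  rw [le_div_iff₀ hK, mul_comm]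
  exact h2

theorem norm_sub_le_inducedConnesDist {ρ ω : A →L[ℂ] ℂ} {a : A} (ha : j₁ a ∈ Y₁.lip 1) :
    ENNReal.ofReal ‖ρ a - ω a‖ ≤ inducedConnesDist Y₁ j₁ ρ ω := by
  rw [ofReal_norm]
  exact le_iSup₂ (f := fun (a : A) (_ : j₁ a ∈ Y₁.lipBall) => ‖ρ a - ω a‖ₑ) a ha

/-- For selfadjoint elements this is the bipolar statement `mem_of_forall_states` applied to a
Lipschitz ball of `Y₂`. Radius `K + 1` keeps the constant positive when `K = 0`; the factor `2`
comes from splitting into real and imaginary parts. -/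
theorem lip_of_inducedConnesDist_le {K : ℝ≥0}
    (h : ∀ ρ ω : A →L[ℂ] ℂ, IsState ρ → IsState ω →
      inducedConnesDist Y₁ j₁ ρ ω ≤ K * inducedConnesDist Y₂ j₂ ρ ω) {a : A}
    (ha : j₁ a ∈ Y₁.lip 1) : j₂ a ∈ Y₂.lip (2 * (K + 1)) := by
  have hK : (0 : ℝ) < K + 1 := by positivity
  have hsa : ∀ a : selfAdjoint A, j₁ a ∈ Y₁.lip 1 → j₂ a ∈ Y₂.lip (K + 1) := by
    intro a ha
    refine mem_of_forall_states (C := j₂ ⁻¹' Y₂.lip (K + 1))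
      ((Y₂.isClosed_lip _).preimage (continuous_starAlgHom j₂)) ?_ ?_ ?_ ?_ a.2 ?_
    · exact (convex_lip Y₂ _).is_linear_preimage
        ⟨fun x y => map_add j₂ x y, fun c x => by
          rw [← Complex.coe_smul, map_smul, Complex.coe_smul]⟩
    · intro b hb z hz
      have := lip_smul z hb
      rw [hz, one_mul, ← map_smul] at this
      exact this
    · intro b hb
      have := lip_star hb
      rwa [← map_star] at this
    · intro z
      rw [Set.mem_preimage, map_smul, map_one]
      exact smul_one_mem_lip z hK.le
    · intro ρ ω hρ hω r hr
      have hr0 : 0 ≤ r := (norm_nonneg _).trans (hr 0 (by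
        rw [Set.mem_preimage, map_zero]
        have := smul_one_mem_lip (X := Y₂) 0 hK.le
        rwa [zero_smul] at this))
      have h1 := (norm_sub_le_inducedConnesDist (ρ := ρ) (ω := ω) ha).trans (h ρ ω hρ hω)
      have h2 : (K : ℝ≥0∞) ≤ ENNReal.ofReal (K + 1) := by
        rw [← ENNReal.ofReal_coe_nnreal]
        exact ENNReal.ofReal_le_ofReal (by linarith)
      have h3 := h1.trans (mul_le_mul' h2 (inducedConnesDist_le hK hr))
      rw [← ENNReal.ofReal_mul hK.le, mul_div_cancel₀ _ hK.ne'] at h3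
      exact (ENNReal.ofReal_le_ofReal_iff hr0).1 h3
  have hhalf : ‖(2⁻¹ : ℂ)‖ = 2⁻¹ := by simp
  have hre : j₁ (ℜ a : selfAdjoint A) ∈ Y₁.lip 1 := by
    rw [realPart_apply_coe, ← Complex.coe_smul, map_smul, map_add, map_star]
    have := lip_smul ((2⁻¹ : ℝ) : ℂ) (lip_add ha (lip_star ha))
    refine lip_mono this ?_
    rw [Complex.norm_real]; norm_num
  have him : j₁ (ℑ a : selfAdjoint A) ∈ Y₁.lip 1 := by
    rw [imaginaryPart_apply_coe, ← Complex.coe_smul, map_smul, map_smul, map_sub, map_star]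
    have := lip_smul (-Complex.I) (lip_smul ((2⁻¹ : ℝ) : ℂ) (lip_sub ha (lip_star ha)))
    refine lip_mono this ?_
    rw [Complex.norm_real, norm_neg, Complex.norm_I]; norm_num
  rw [← realPart_add_I_smul_imaginaryPart a, map_add, map_smul]
  refine lip_mono (lip_add (hsa _ hre) (lip_smul Complex.I (hsa _ him))) ?_
  rw [Complex.norm_I]
  linarith

end Comparison
end
end SpectralMetric

namespace SpectralMetric
noncomputable section

/-! ### Vector-valued Fourier coefficients on the circle -/

section Fourier

open MeasureTheory AddCircle

variable {E : Type*} [NormedAddCommGroup E] [NormedSpace ℂ E]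

theorem continuous_integrable_addCircle {F : Type*} [NormedAddCommGroup F]
    {f : UnitAddCircle → F} (hf : Continuous f) :
    Integrable f (haarAddCircle (T := 1)) :=
  hf.integrable_of_hasCompactSupport (HasCompactSupport.of_compactSpace f)

theorem exists_bump_addCircle {δ : ℝ} (hδ : 0 < δ) :
    ∃ φ : C(UnitAddCircle, ℝ), (∀ t, 0 ≤ φ t) ∧ (∀ t, φ t ≠ 0 → ‖t‖ < δ) ∧
      ∫ t, φ t ∂(haarAddCircle (T := 1)) = 1 := by
  let ψ : C(UnitAddCircle, ℝ) := ⟨fun t => max 0 (δ - ‖t‖), by fun_prop⟩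
  have hψ : ∀ t, ψ t = max 0 (δ - ‖t‖) := fun t => rfl
  have hψ0 : ∀ t, 0 ≤ ψ t := fun t => le_max_left _ _
  have hpos : 0 < ∫ t, ψ t ∂(haarAddCircle (T := 1)) :=
    ψ.continuous.integral_pos_of_hasCompactSupport_nonneg_nonzero
      (HasCompactSupport.of_compactSpace _) hψ0 (x := 0) (by
        rw [hψ, norm_zero, sub_zero, max_eq_right hδ.le]; exact hδ.ne')
  refine ⟨(∫ t, ψ t ∂(haarAddCircle (T := 1)))⁻¹ • ψ, fun t => ?_, fun t ht => ?_, ?_⟩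
  · exact mul_nonneg (inv_nonneg.2 hpos.le) (hψ0 t)
  · by_contra hcon
    apply ht
    rw [ContinuousMap.smul_apply, hψ, max_eq_left (by linarith), smul_zero]
  · simp only [ContinuousMap.smul_apply, smul_eq_mul]
    rw [integral_const_mul, inv_mul_cancel₀ hpos.ne']

/-- Trigonometric polynomials approximating the Dirac mass at `0`. -/
theorem exists_fourier_approx (E : Type*) [NormedAddCommGroup E] [NormedSpace ℂ E]
    [CompleteSpace E] {δ ε : ℝ} (hδ : 0 < δ) (hε : 0 < ε) :
    ∃ c : ℤ →₀ ℂ, ∀ (f : UnitAddCircle → E) (R s : ℝ), Continuous f → (∀ t, ‖f t‖ ≤ R) →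
      (∀ t, ‖t‖ < δ → ‖f t - f 0‖ ≤ s) →
      ‖f 0 - ∑ k ∈ c.support, c k • fourierCoeff f (-k)‖ ≤ s + ε * R := by
  obtain ⟨φ, hφ0, hφδ, hφ1⟩ := exists_bump_addCircle hδ
  let φc : C(UnitAddCircle, ℂ) := ⟨fun t => (φ t : ℂ), by fun_prop⟩
  have hmem : φc ∈ closure (Submodule.span ℂ (Set.range (fourier (T := 1))) :
      Set C(UnitAddCircle, ℂ)) := by
    rw [← Submodule.topologicalClosure_coe, span_fourier_closure_eq_top]
    exact Submodule.mem_top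
  obtain ⟨p, hp, hpε⟩ := Metric.mem_closure_iff.1 hmem ε hε
  obtain ⟨c, rfl⟩ := Finsupp.mem_span_range_iff_exists_finsupp.1 hp
  refine ⟨c, fun f R s hf hR hs => ?_⟩
  let p : C(UnitAddCircle, ℂ) := c.sum fun i a => a • fourier i
  have hpt : ∀ t, p t = ∑ k ∈ c.support, c k • fourier k t := by
    intro t
    change (∑ k ∈ c.support, c k • fourier k : C(UnitAddCircle, ℂ)) t = _
    rw [ContinuousMap.sum_apply]
    rfl
  -- The index is `-k` because the coefficient at `-k` integrates against the character `k`.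
  have hsum : ∑ k ∈ c.support, c k • fourierCoeff f (-k) =
      ∫ t, p t • f t ∂(haarAddCircle (T := 1)) := by
    simp only [hpt, Finset.sum_smul, fourierCoeff, neg_neg]
    rw [integral_finsetSum]
    · refine Finset.sum_congr rfl fun k _ => ?_
      rw [← integral_smul]
      simp only [smul_assoc]
    · intro k _
      exact continuous_integrable_addCircle (by fun_prop)
  have hzero : f 0 = ∫ t, φc t • f 0 ∂(haarAddCircle (T := 1)) := by
    rw [integral_smul_const]
    have : ∫ t, φc t ∂(haarAddCircle (T := 1)) = ((1 : ℝ) : ℂ) :=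
      (integral_ofReal (f := φ)).trans (congrArg _ hφ1)
    rw [this, Complex.ofReal_one, one_smul]
  -- Split into the oscillation of `f` on the support of the bump and the uniform error between the
  -- bump and the trigonometric polynomial.
  have hbound : ∀ t, ‖φc t • f 0 - p t • f t‖ ≤ φ t * s + ε * R := by
    intro t
    have h1 : φc t • f 0 - p t • f t = φc t • (f 0 - f t) + (φc t - p t) • f t := by
      rw [smul_sub, sub_smul]; abel
    rw [h1]
    refine (norm_add_le _ _).trans (add_le_add ?_ ?_)
    · rw [norm_smul]
      have h2 : ‖φc t‖ = φ t := by
        change ‖(φ t : ℂ)‖ = _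
        rw [Complex.norm_real, Real.norm_of_nonneg (hφ0 t)]
      rw [h2]
      by_cases h3 : φ t = 0
      · rw [h3, zero_mul, zero_mul]
      · rw [norm_sub_rev]
        exact mul_le_mul_of_nonneg_left (hs t (hφδ t h3)) (hφ0 t)
    · rw [norm_smul]
      have h4 : ‖φc t - p t‖ ≤ ε := by
        have := (ContinuousMap.dist_apply_le_dist (f := φc) (g := p) t).trans hpε.le
        rwa [dist_eq_norm] at this
      exact mul_le_mul h4 (hR t) (norm_nonneg _) hε.le
  rw [hsum]
  nth_rewrite 1 [hzero]
  rw [← integral_sub (continuous_integrable_addCircle (by fun_prop))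
    (continuous_integrable_addCircle (by fun_prop))]
  refine (norm_integral_le_of_norm_le (g := fun t => φ t * s + ε * R)
    (continuous_integrable_addCircle (by fun_prop)) (Filter.Eventually.of_forall hbound)).trans ?_
  rw [integral_add (continuous_integrable_addCircle (by fun_prop))
    (continuous_integrable_addCircle (by fun_prop)), integral_mul_const, hφ1]
  simp

/-- With all coefficients zero the approximating sums vanish, so `f 0` is arbitrarily small. -/
theorem eq_zero_of_fourierCoeff_eq_zero [CompleteSpace E] {f : UnitAddCircle → E}
    (hf : Continuous f) (h : ∀ k, fourierCoeff f k = 0) : f 0 = 0 := by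
  obtain ⟨R, hR⟩ := isCompact_univ.exists_bound_of_continuousOn hf.continuousOn
  have hR0 : 0 ≤ R := (norm_nonneg _).trans (hR 0 trivial)
  refine norm_le_zero_iff.1 (le_of_forall_pos_le_add fun ε hε => ?_)
  obtain ⟨δ, hδ, hfδ⟩ := Metric.continuous_iff.1 hf 0 (ε / 2) (half_pos hε)
  obtain ⟨c, hc⟩ := exists_fourier_approx E hδ (ε := ε / (2 * (R + 1))) (by positivity)
  have := hc f R (ε / 2) hf (fun t => hR t trivial) fun t ht => by
    rw [← dist_eq_norm]
    exact (hfδ t (by rwa [dist_zero_right])).le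
  simp only [h, smul_zero, Finset.sum_const_zero, sub_zero] at this
  have h2 : ε / (2 * (R + 1)) * R ≤ ε / 2 := by
    rw [div_mul_eq_mul_div, div_le_div_iff₀ (by positivity) two_pos]
    nlinarith
  linarith

theorem norm_fourierCoeff_le {f : UnitAddCircle → E} {R : ℝ} (hR : ∀ t, ‖f t‖ ≤ R) (k : ℤ) :
    ‖fourierCoeff f k‖ ≤ R := by
  have := norm_integral_le_of_norm_le_const (μ := haarAddCircle (T := 1))
    (f := fun t => fourier (-k) t • f t) (C := R) (Filter.Eventually.of_forall fun t => by
      rw [norm_smul, fourier_apply, Circle.norm_coe, one_mul]; exact hR t)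
  simpa [fourierCoeff] using this

theorem fourierCoeff_fourier_smul_const [CompleteSpace E] (k l : ℤ) (v : E) :
    fourierCoeff (fun t : UnitAddCircle => fourier l t • v) k = if k = l then v else 0 := by
  simp only [fourierCoeff, ← smul_assoc, smul_eq_mul, ← fourier_add]
  rw [integral_smul_const]
  split_ifs with h
  · subst h
    simp
  · have h' : -k + l ≠ 0 := by omega
    rw [integral_eq_zero_of_add_right_eq_neg (μ := haarAddCircle)
      (fourier_add_half_inv_index h' one_pos), zero_smul]

/-- Fourier coefficients lie in every closed convex set that contains the twisted orbit. -/
theorem fourierCoeff_mem [CompleteSpace E] {f : UnitAddCircle → E} (hf : Continuous f) (k : ℤ)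
    {C : Set E} (hC : Convex ℝ C) (hcl : IsClosed C) (h : ∀ t, fourier (-k) t • f t ∈ C) :
    fourierCoeff f k ∈ C :=
  hC.integral_mem hcl (Filter.Eventually.of_forall h)
    (continuous_integrable_addCircle (by fun_prop))

end Fourier

/-! ### Monomials and Fourier coefficients in the crossed product -/

namespace CrossedProduct

variable {A : Type u} [CStarAlgebra A] {α : A ≃⋆ₐ[ℂ] A}

theorem mem_of_generators {S : StarSubalgebra ℂ (CrossedProduct α)}
    (hS : IsClosed (S : Set (CrossedProduct α))) (hA : ∀ a, embed α a ∈ S) (hu : u α ∈ S)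
    (b : CrossedProduct α) : b ∈ S := by
  let φ : CrossedProduct α →⋆ₐ[ℂ] CovariantFamilies α :=
    (cstarAdjoin (univGenerators α)).subtype
  have hφ : Topology.IsClosedEmbedding φ := (isClosed_cstarAdjoin _).isClosedEmbedding_subtypeVal
  have hle : cstarAdjoin (univGenerators α) ≤ S.map φ := by
    refine cstarAdjoin_le ?_ ?_
    · exact hφ.isClosedMap _ hS
    · rintro _ (⟨a, rfl⟩ | rfl)
      · exact ⟨embed α a, hA a, rfl⟩
      · exact ⟨u α, hu, rfl⟩
  obtain ⟨c, hc, hcb⟩ := hle b.2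
  have : c = b := hφ.injective hcb
  exact this ▸ hc

/-- The canonical unitary, as a unitary element. -/
def uUnitary (α : A ≃⋆ₐ[ℂ] A) : unitary (CrossedProduct α) := ⟨u α, u_mem_unitary α⟩

/-- The monomial `a uᵏ`. -/
def monomial (k : ℤ) : A →L[ℂ] CrossedProduct α :=
  (ContinuousLinearMap.mul ℂ (CrossedProduct α)).flip ((uUnitary α ^ k : unitary _) :
    CrossedProduct α) ∘L ⟨(embed α : A →ₗ[ℂ] CrossedProduct α), continuous_starAlgHom (embed α)⟩

theorem monomial_apply (k : ℤ) (a : A) :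
    monomial k a = embed α a * ((uUnitary α ^ k : unitary _) : CrossedProduct α) := rfl

theorem monomial_zero (a : A) : monomial 0 a = embed α a := by
  rw [monomial_apply, zpow_zero, OneMemClass.coe_one, mul_one]

theorem u_mul_embed (a : A) : u α * embed α a = embed α (α a) * u α := by
  rw [← u_mul_embed_mul_star, mul_assoc, (u_mem_unitary α).1, mul_one]

theorem star_u_mul_embed (a : A) : star (u α) * embed α a = embed α (α.symm a) * star (u α) := by
  have h := u_mul_embed (α := α) (α.symm a)
  rw [StarAlgEquiv.apply_symm_apply] at h
  have h2 := congrArg (fun x => star (u α) * x * star (u α)) h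
  simp only [← mul_assoc] at h2
  rw [(u_mem_unitary α).1, one_mul, mul_assoc _ (u α), (u_mem_unitary α).2, mul_one] at h2
  exact h2.symm

theorem uUnitary_zpow_mul_embed (k : ℤ) (a : A) :
    ((uUnitary α ^ k : unitary _) : CrossedProduct α) * embed α a =
      embed α ((α ^ k) a) * ((uUnitary α ^ k : unitary _) : CrossedProduct α) := by
  induction k using Int.induction_on generalizing a with
  | zero => simp
  | succ n ih =>
    rw [zpow_add_one, zpow_add_one, Submonoid.coe_mul, mul_assoc]
    change _ * (u α * embed α a) = _ * (_ * u α)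
    rw [u_mul_embed, ← mul_assoc, ih, mul_assoc]
    rfl
  | pred n ih =>
    rw [zpow_sub_one, zpow_sub_one, Submonoid.coe_mul, mul_assoc]
    change _ * (star (u α) * embed α a) = _ * (_ * star (u α))
    rw [star_u_mul_embed, ← mul_assoc, ih, mul_assoc]
    rfl

theorem monomial_mul (k l : ℤ) (a b : A) :
    (monomial k a * monomial l b : CrossedProduct α) = monomial (k + l) (a * (α ^ k) b) := by
  rw [monomial_apply, monomial_apply, monomial_apply, zpow_add, Submonoid.coe_mul, map_mul]
  rw [mul_assoc, ← mul_assoc _ (embed α b), uUnitary_zpow_mul_embed]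
  simp only [mul_assoc]

theorem star_monomial (k : ℤ) (a : A) :
    (star (monomial k a) : CrossedProduct α) = monomial (-k) ((α ^ (-k)) (star a)) := by
  rw [monomial_apply, monomial_apply, star_mul, ← map_star, ← uUnitary_zpow_mul_embed, zpow_neg,
    ← Unitary.star_eq_inv]
  rfl

/-- The span of the monomials. -/
def monomialSpan (α : A ≃⋆ₐ[ℂ] A) : Submodule ℂ (CrossedProduct α) :=
  Submodule.span ℂ (Set.range fun p : ℤ × A => (monomial p.1 p.2 : CrossedProduct α))

theorem monomial_mem_span (k : ℤ) (a : A) : monomial k a ∈ monomialSpan α :=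
  Submodule.subset_span ⟨(k, a), rfl⟩

theorem mul_mem_monomialSpan {x y : CrossedProduct α} (hx : x ∈ monomialSpan α)
    (hy : y ∈ monomialSpan α) : x * y ∈ monomialSpan α := by
  refine Submodule.span_induction₂ (p := fun x y _ _ => x * y ∈ monomialSpan α)
    ?_ ?_ ?_ ?_ ?_ ?_ ?_ hx hy
  · rintro _ _ ⟨p, rfl⟩ ⟨q, rfl⟩
    dsimp only
    rw [monomial_mul]
    exact monomial_mem_span _ _
  · intro y _
    rw [zero_mul]; exact Submodule.zero_mem _
  · intro x _
    rw [mul_zero]; exact Submodule.zero_mem _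
  · intro x y z _ _ _ hx hy
    rw [add_mul]; exact Submodule.add_mem _ hx hy
  · intro x y z _ _ _ hx hy
    rw [mul_add]; exact Submodule.add_mem _ hx hy
  · intro r x y _ _ h
    rw [smul_mul_assoc]; exact Submodule.smul_mem _ _ h
  · intro r x y _ _ h
    rw [mul_smul_comm]; exact Submodule.smul_mem _ _ h

theorem star_mem_monomialSpan {x : CrossedProduct α} (hx : x ∈ monomialSpan α) :
    star x ∈ monomialSpan α := by
  refine Submodule.span_induction (p := fun x _ => star x ∈ monomialSpan α) ?_ ?_ ?_ ?_ hx
  · rintro _ ⟨p, rfl⟩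
    dsimp only
    rw [star_monomial]
    exact monomial_mem_span _ _
  · rw [star_zero]; exact Submodule.zero_mem _
  · intro x y _ _ hx hy
    rw [star_add]; exact Submodule.add_mem _ hx hy
  · intro z x _ hx
    rw [star_smul]; exact Submodule.smul_mem _ _ hx

/-- Covariance moves powers of `u` past `A`, so the span of the `a uᵏ` is already a ⋆-subalgebra
containing the generators. -/
theorem dense_monomialSpan : Dense (monomialSpan α : Set (CrossedProduct α)) := by
  let S : StarSubalgebra ℂ (CrossedProduct α) :=
    { carrier := monomialSpan α
      mul_mem' := fun hx hy => mul_mem_monomialSpan hx hy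
      add_mem' := fun hx hy => Submodule.add_mem _ hx hy
      algebraMap_mem' := fun z => by
        have := monomial_mem_span (α := α) 0 1
        rw [monomial_zero, map_one] at this
        rw [Algebra.algebraMap_eq_smul_one]
        exact Submodule.smul_mem _ z this
      star_mem' := fun hx => star_mem_monomialSpan hx }
  have hA : ∀ a, embed α a ∈ S := fun a => by
    have := monomial_mem_span (α := α) 0 a
    rwa [monomial_zero] at this
  have hu : u α ∈ S := by
    have := monomial_mem_span (α := α) 1 1
    rwa [monomial_apply, map_one, one_mul, zpow_one] at this
  intro b
  have h := mem_of_generators (S := S.topologicalClosure) S.isClosed_topologicalClosure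
    (fun a => S.le_topologicalClosure (hA a)) (S.le_topologicalClosure hu) b
  rwa [← SetLike.mem_coe, StarSubalgebra.topologicalClosure_coe] at h

theorem norm_dualAction_le (z : Circle) (b : CrossedProduct α) : ‖dualAction α z b‖ ≤ ‖b‖ :=
  NonUnitalStarAlgHom.norm_apply_le (dualHom α z) b

theorem dualAction_monomial (z : Circle) (k : ℤ) (a : A) :
    dualAction α z (monomial k a) = ((z ^ k : Circle) : ℂ) • monomial k a := by
  have h : ∀ k : ℤ, dualAction α z ((uUnitary α ^ k : unitary _) : CrossedProduct α) =
      ((z ^ k : Circle) : ℂ) • ((uUnitary α ^ k : unitary _) : CrossedProduct α) := by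
    intro k
    induction k using Int.induction_on with
    | zero => simp
    | succ n ih =>
      rw [zpow_add_one, zpow_add_one, Submonoid.coe_mul, map_mul, ih, Circle.coe_mul,
        ← smul_mul_smul_comm]
      rfl
    | pred n ih =>
      rw [zpow_sub_one, zpow_sub_one, Submonoid.coe_mul, map_mul, ih, Circle.coe_mul,
        ← smul_mul_smul_comm]
      congr 1
      change dualAction α z (star (u α)) = _ • star (u α)
      rw [map_star, dualAction_u, star_smul, Circle.coe_inv_eq_conj]
      rfl
  rw [monomial_apply, map_mul, dualAction_embed, h, mul_smul_comm]

/-- On monomials the orbit is `zᵏ` times a constant; contractivity makes the orbit of `b` a uniform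
limit of orbits of elements of the span. -/
theorem continuous_dualAction (b : CrossedProduct α) :
    Continuous fun z : Circle => dualAction α z b := by
  refine continuous_of_uniform_approx_of_continuous fun V hV => ?_
  obtain ⟨ε, hε, hεV⟩ := Metric.mem_uniformity_dist.1 hV
  obtain ⟨c, hc, hbc⟩ := Metric.mem_closure_iff.1 (dense_monomialSpan (α := α) b) ε hε
  refine ⟨fun z => dualAction α z c, ?_, fun z => hεV ?_⟩
  · refine Submodule.span_induction (p := fun c _ => Continuous fun z => dualAction α z c)
      ?_ ?_ ?_ ?_ hc
    · rintro _ ⟨p, rfl⟩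
      simp only [dualAction_monomial]
      have h1 : Continuous ((↑) : Circle → ℂ) := by fun_prop
      have h2 : Continuous fun z : Circle => z ^ p.1 := continuous_zpow _
      exact (h1.comp h2).smul continuous_const
    · simp only [map_zero]; fun_prop
    · intro x y _ _ hx hy
      simp only [map_add]; fun_prop
    · intro w x _ hx
      simp only [map_smul]; fun_prop
  · rw [dist_eq_norm, ← map_sub]
    refine (norm_dualAction_le z _).trans_lt ?_
    rwa [← dist_eq_norm]

/-- The Fourier coefficients of an element for the dual action. -/
def coeff (k : ℤ) (b : CrossedProduct α) : CrossedProduct α :=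
  fourierCoeff (fun t : UnitAddCircle => dualAction α (AddCircle.toCircle t) b) k

theorem continuous_orbit (b : CrossedProduct α) :
    Continuous fun t : UnitAddCircle => dualAction α (AddCircle.toCircle t) b :=
  (continuous_dualAction b).comp AddCircle.continuous_toCircle

theorem orbit_zero (b : CrossedProduct α) :
    dualAction α (AddCircle.toCircle (0 : UnitAddCircle)) b = b := by
  rw [AddCircle.toCircle_zero, map_one]; rfl

theorem norm_coeff_le (k : ℤ) (b : CrossedProduct α) : ‖coeff k b‖ ≤ ‖b‖ :=
  norm_fourierCoeff_le (fun _ => norm_dualAction_le _ b) k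

/-- `coeff` as a bounded operator. -/
def coeffL (k : ℤ) : CrossedProduct α →L[ℂ] CrossedProduct α :=
  LinearMap.mkContinuous
    { toFun := coeff k
      map_add' := fun b c => by
        have := congrFun (fourierCoeff.add (continuous_integrable_addCircle (continuous_orbit b))
          (continuous_integrable_addCircle (continuous_orbit c))) k
        refine Eq.trans ?_ this
        simp only [coeff, map_add]
        rfl
      map_smul' := fun z b => by
        have := fourierCoeff.const_smul
          (fun t : UnitAddCircle => dualAction α (AddCircle.toCircle t) b) z k
        refine Eq.trans ?_ this
        simp only [coeff, map_smul]
        rfl } 1 fun b => by rw [one_mul]; exact norm_coeff_le k b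

theorem coeffL_apply (k : ℤ) (b : CrossedProduct α) : coeffL k b = coeff k b := rfl

theorem coeff_monomial (k l : ℤ) (a : A) :
    (coeff k (monomial l a) : CrossedProduct α) = if k = l then monomial l a else 0 := by
  rw [← fourierCoeff_fourier_smul_const]
  simp only [coeff, dualAction_monomial, fourier_apply, AddCircle.toCircle_zsmul]

/-- Injectivity makes `a ↦ a uᵏ` isometric, so its range is closed; the coefficient map sends
monomials into it, hence everything by density. -/
theorem exists_coeff_eq_monomial (hinj : Function.Injective (embed α)) (k : ℤ)
    (b : CrossedProduct α) : ∃ a : A, coeff k b = monomial k a := by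
  have hiso : Isometry (monomial k : A →L[ℂ] CrossedProduct α) :=
    AddMonoidHomClass.isometry_of_norm _ fun a => by
      rw [monomial_apply, CStarRing.norm_mul_coe_unitary]
      exact NonUnitalStarAlgHom.norm_map (embed α) hinj a
  let R : Submodule ℂ (CrossedProduct α) := LinearMap.range (monomial k : A →L[ℂ] CrossedProduct α).toLinearMap
  have hR : IsClosed (R : Set (CrossedProduct α)) := hiso.isClosedEmbedding.isClosed_range
  let N : Submodule ℂ (CrossedProduct α) := R.comap (coeffL k : CrossedProduct α →L[ℂ] CrossedProduct α).toLinearMap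
  have hN : IsClosed (N : Set (CrossedProduct α)) := hR.preimage (coeffL k).continuous
  have hle : monomialSpan α ≤ N := by
    refine Submodule.span_le.2 ?_
    rintro _ ⟨⟨l, a⟩, rfl⟩
    change coeff k (monomial l a) ∈ R
    rw [coeff_monomial]
    split_ifs with h
    · subst h; exact ⟨a, rfl⟩
    · exact R.zero_mem
  obtain ⟨a, ha⟩ := closure_minimal hle hN (dense_monomialSpan b)
  exact ⟨a, ha.symm⟩

theorem eq_zero_of_coeff_eq_zero {b : CrossedProduct α} (h : ∀ k, coeff k b = 0) : b = 0 := by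
  have := eq_zero_of_fourierCoeff_eq_zero (continuous_orbit b) h
  rwa [orbit_zero] at this

end CrossedProduct
end
end SpectralMetric

namespace SpectralMetric
noncomputable section

set_option linter.unusedSectionVars false

/-! ### The regular representation and its faithfulness -/

section RegularRepresentation

open CrossedProduct

/-- Translation of the first coordinate. -/
def shiftPerm : Equiv.Perm (ℤ × Bool) := (Equiv.addRight (1 : ℤ)).prodCongr (Equiv.refl Bool)

theorem shiftPerm_apply (i : ℤ × Bool) : shiftPerm i = (i.1 + 1, i.2) := rfl

/-- Exchange of the second coordinate. -/
def flipPerm : Equiv.Perm (ℤ × Bool) := (Equiv.refl ℤ).prodCongr Equiv.boolNot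

theorem flipPerm_apply (i : ℤ × Bool) : flipPerm i = (i.1, !i.2) := rfl

theorem flipPerm_flipPerm (i : ℤ × Bool) : flipPerm (flipPerm i) = i := by
  simp [flipPerm_apply]

variable {A : Type u} [CStarAlgebra A] (α : A ≃⋆ₐ[ℂ] A) {H : Type u} [NormedAddCommGroup H]
  [InnerProductSpace ℂ H] [CompleteSpace H] (φ : A →⋆ₐ[ℂ] (H →L[ℂ] H))

theorem norm_rep_zpow_le (a : A) (k : ℤ) : ‖φ ((α ^ k) a)‖ ≤ ‖a‖ :=
  (NonUnitalStarAlgHom.norm_apply_le φ _).trans (NonUnitalStarAlgHom.norm_apply_le (α ^ k) a)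

/-- The representation of `A` by `a ↦ φ (α⁻ⁿ a)` on the summands `(n, s)`. -/
def diagRep : A →⋆ₐ[ℂ] (ell2 (ℤ × Bool) H →L[ℂ] ell2 (ℤ × Bool) H) where
  toFun a := permOp (Equiv.refl _) (fun i => φ ((α ^ (-i.1)) a)) ‖a‖
    fun i => norm_rep_zpow_le α φ a (-i.1)
  map_one' := by
    ext ξ : 1
    refine lp.ext (funext fun i => ?_)
    rw [permOp_apply, map_one, map_one]
    rfl
  map_mul' a b := by
    ext ξ : 1
    refine lp.ext (funext fun i => ?_)
    rw [permOp_apply, map_mul, map_mul]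
    rfl
  map_zero' := by
    ext ξ : 1
    refine lp.ext (funext fun i => ?_)
    rw [permOp_apply, map_zero, map_zero]
    rfl
  map_add' a b := by
    ext ξ : 1
    refine lp.ext (funext fun i => ?_)
    rw [permOp_apply, map_add, map_add]
    rfl
  commutes' z := by
    ext ξ : 1
    refine lp.ext (funext fun i => ?_)
    rw [permOp_apply, Algebra.algebraMap_eq_smul_one, map_smul, map_one, map_smul, map_one]
    rfl
  map_star' a := by
    rw [star_permOp]
    ext ξ : 1
    refine lp.ext (funext fun i => ?_)
    rw [permOp_apply, permOp_apply, map_star, map_star]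
    rfl

theorem diagRep_apply (a : A) (ξ : ell2 (ℤ × Bool) H) (i : ℤ × Bool) :
    diagRep α φ a ξ i = φ ((α ^ (-i.1)) a) (ξ i) := rfl

/-- The bilateral shift. -/
def shiftOp (H : Type u) [NormedAddCommGroup H] [InnerProductSpace ℂ H] :
    ell2 (ℤ × Bool) H →L[ℂ] ell2 (ℤ × Bool) H :=
  permOp shiftPerm (fun _ => 1) 1 fun _ => ContinuousLinearMap.norm_id_le

theorem shiftOp_apply (ξ : ell2 (ℤ × Bool) H) (i : ℤ × Bool) :
    shiftOp H ξ i = ξ (i.1 - 1, i.2) := rfl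

theorem star_shiftOp_apply (ξ : ell2 (ℤ × Bool) H) (i : ℤ × Bool) :
    (star (shiftOp H) ξ : ell2 (ℤ × Bool) H) i = ξ (i.1 + 1, i.2) := by
  rw [shiftOp, star_permOp, permOp_apply, star_one]
  rfl

theorem shiftOp_mem_unitary : shiftOp H ∈ unitary (ell2 (ℤ × Bool) H →L[ℂ] ell2 (ℤ × Bool) H) := by
  constructor
  · ext ξ : 1
    refine lp.ext (funext fun i => ?_)
    rw [mul_apply_eq_comp, star_shiftOp_apply, shiftOp_apply, one_apply_eq_self, add_sub_cancel_right]
  · ext ξ : 1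
    refine lp.ext (funext fun i => ?_)
    rw [mul_apply_eq_comp, shiftOp_apply, star_shiftOp_apply, one_apply_eq_self, sub_add_cancel]

theorem shiftOp_covariant (a : A) :
    shiftOp H * diagRep α φ a * star (shiftOp H) = diagRep α φ (α a) := by
  ext ξ : 1
  refine lp.ext (funext fun i => ?_)
  rw [mul_apply_eq_comp, mul_apply_eq_comp, shiftOp_apply, diagRep_apply, star_shiftOp_apply,
    diagRep_apply, sub_add_cancel]
  congr 2
  rw [neg_sub, sub_eq_neg_add, zpow_add_one, StarAlgEquiv.mul_apply]

theorem exists_regularHom :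
    ∃ Λ : CrossedProduct α →⋆ₐ[ℂ] (ell2 (ℤ × Bool) H →L[ℂ] ell2 (ℤ × Bool) H),
      (∀ a, Λ (embed α a) = diagRep α φ a) ∧ Λ (u α) = shiftOp H := by
  -- Covariant representations act on nonzero spaces; on the zero space all operators coincide and
  -- the zero map is a unital homomorphism.
  rcases subsingleton_or_nontrivial (ell2 (ℤ × Bool) H) with h | h
  · have : Subsingleton (ell2 (ℤ × Bool) H →L[ℂ] ell2 (ℤ × Bool) H) :=
      ⟨fun S T => ContinuousLinearMap.ext fun x => Subsingleton.elim _ _⟩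
    exact ⟨{ toFun := fun _ => 0
             map_one' := Subsingleton.elim _ _
             map_mul' := fun _ _ => Subsingleton.elim _ _
             map_zero' := Subsingleton.elim _ _
             map_add' := fun _ _ => Subsingleton.elim _ _
             commutes' := fun _ => Subsingleton.elim _ _
             map_star' := fun _ => Subsingleton.elim _ _ },
      fun _ => Subsingleton.elim _ _, Subsingleton.elim _ _⟩
  · let i : CovariantRep α :=
      { H := ell2 (ℤ × Bool) H
        φ := diagRep α φ
        V := ⟨shiftOp H, shiftOp_mem_unitary⟩
        covariant := shiftOp_covariant α φ }
    exact ⟨toRep i, toRep_embed i, toRep_u i⟩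

/-- The regular representation of the crossed product induced by a representation of `A`, on two
copies of `ℓ²(ℤ, H)`. -/
def regularHom : CrossedProduct α →⋆ₐ[ℂ] (ell2 (ℤ × Bool) H →L[ℂ] ell2 (ℤ × Bool) H) :=
  (exists_regularHom α φ).choose

theorem regularHom_embed (a : A) : regularHom α φ (embed α a) = diagRep α φ a :=
  (exists_regularHom α φ).choose_spec.1 a

theorem regularHom_u : regularHom α φ (u α) = shiftOp H :=
  (exists_regularHom α φ).choose_spec.2

theorem regularHom_zpow (k : ℤ) (ξ : ell2 (ℤ × Bool) H) (i : ℤ × Bool) :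
    regularHom α φ ((uUnitary α ^ k : unitary _) : CrossedProduct α) ξ i = ξ (i.1 - k, i.2) := by
  induction k using Int.induction_on generalizing ξ with
  | zero => simp
  | succ n ih =>
    rw [zpow_add_one, Submonoid.coe_mul, map_mul, mul_apply_eq_comp, ih]
    change regularHom α φ (u α) ξ _ = _
    rw [regularHom_u, shiftOp_apply, sub_sub]
  | pred n ih =>
    rw [zpow_sub_one, Submonoid.coe_mul, map_mul, mul_apply_eq_comp, ih]
    change regularHom α φ (star (u α)) ξ _ = _
    rw [map_star, regularHom_u, star_shiftOp_apply, sub_sub_eq_add_sub, add_sub_right_comm]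

theorem regularHom_monomial (k : ℤ) (a : A) (ξ : ell2 (ℤ × Bool) H) (i : ℤ × Bool) :
    regularHom α φ (monomial k a) ξ i = φ ((α ^ (-i.1)) a) (ξ (i.1 - k, i.2)) := by
  rw [monomial_apply, map_mul, mul_apply_eq_comp, regularHom_embed, diagRep_apply,
    regularHom_zpow]

theorem rep_eq_zero_of_regularHom_monomial {k : ℤ} {a : A}
    (h : regularHom α φ (monomial k a) = 0) : φ a = 0 := by
  ext v
  have h1 := regularHom_monomial α φ k a (lp.single 2 (0 - k, false) v) (0, false)
  rw [h, lp.single_apply_self] at h1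
  simpa using h1.symm

/-- A nonzero `a` survives in some representation of `A`, and the induced regular representation
contains it as the summand over `0`. -/
theorem embed_injective : Function.Injective (embed α) := by
  refine (injective_iff_map_eq_zero _).2 fun a ha => ?_
  by_contra hne
  obtain ⟨H, _, _, _, φ, hφ⟩ := exists_representation_ne_zero hne
  refine hφ (rep_eq_zero_of_regularHom_monomial α φ (k := 0) ?_)
  rw [monomial_zero, ha, map_zero]

/-- The unitary `zⁿ` on the summands `(n, s)`. -/
def phaseOp (H : Type u) [NormedAddCommGroup H] [InnerProductSpace ℂ H] (z : Circle) :
    ell2 (ℤ × Bool) H →L[ℂ] ell2 (ℤ × Bool) H :=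
  permOp (Equiv.refl _) (fun i => ((z ^ i.1 : Circle) : ℂ) • 1) 1 fun i => by
    rw [norm_smul, Circle.norm_coe, one_mul]
    exact ContinuousLinearMap.norm_id_le

theorem phaseOp_apply (z : Circle) (ξ : ell2 (ℤ × Bool) H) (i : ℤ × Bool) :
    phaseOp H z ξ i = ((z ^ i.1 : Circle) : ℂ) • ξ i := rfl

theorem phaseOp_single (z : Circle) (i : ℤ × Bool) (x : H) :
    phaseOp H z (lp.single 2 i x) =
      ((z ^ i.1 : Circle) : ℂ) • (lp.single 2 i x : ell2 (ℤ × Bool) H) := by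
  refine lp.ext (funext fun j => ?_)
  rw [phaseOp_apply, lp.coeFn_smul, Pi.smul_apply]
  by_cases hj : j = i
  · rw [hj]
  · rw [lp.single_apply_ne _ _ _ hj, smul_zero, smul_zero]

theorem norm_phaseOp_le (z : Circle) : ‖phaseOp H z‖ ≤ 1 := norm_permOp_le zero_le_one

theorem phaseOp_mul (z w : Circle) : phaseOp H z * phaseOp H w = phaseOp H (z * w) := by
  ext ξ : 1
  refine lp.ext (funext fun i => ?_)
  rw [mul_apply_eq_comp, phaseOp_apply, phaseOp_apply, phaseOp_apply, smul_smul, mul_zpow,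
    Circle.coe_mul]

theorem phaseOp_one : phaseOp H 1 = 1 := by
  ext ξ : 1
  refine lp.ext (funext fun i => ?_)
  rw [phaseOp_apply, one_zpow, Circle.coe_one, one_smul]
  rfl

theorem phaseOp_mul_inv (z : Circle) : phaseOp H z * phaseOp H z⁻¹ = 1 := by
  rw [phaseOp_mul, mul_inv_cancel, phaseOp_one]

theorem star_phaseOp (z : Circle) : star (phaseOp H z) = phaseOp H z⁻¹ := by
  rw [phaseOp, star_permOp]
  ext ξ : 1
  refine lp.ext (funext fun i => ?_)
  rw [permOp_apply, phaseOp_apply, star_smul, star_one, inv_zpow, Circle.coe_inv_eq_conj]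
  rfl

theorem inner_phaseOp_left (z : Circle) (ξ ζ : ell2 (ℤ × Bool) H) :
    ⟪phaseOp H z ξ, ζ⟫_ℂ = ⟪ξ, phaseOp H z⁻¹ ζ⟫_ℂ := by
  rw [← star_phaseOp, ContinuousLinearMap.star_eq_adjoint, ContinuousLinearMap.adjoint_inner_right]

/-- A closed subspace containing the monomials is everything. -/
theorem mem_of_monomial_mem {N : Submodule ℂ (CrossedProduct α)}
    (hN : IsClosed (N : Set (CrossedProduct α))) (h : ∀ k a, monomial k a ∈ N)
    (b : CrossedProduct α) : b ∈ N := by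
  refine closure_minimal (s := (monomialSpan α : Set (CrossedProduct α))) ?_ hN (dense_monomialSpan b)
  refine Submodule.span_le.2 ?_
  rintro _ ⟨p, rfl⟩
  exact h p.1 p.2

theorem eq_of_eq_on_monomial {F : Type*} [NormedAddCommGroup F] [NormedSpace ℂ F]
    {f g : CrossedProduct α →ₗ[ℂ] F} (hf : Continuous f) (hg : Continuous g)
    (h : ∀ k a, f (monomial k a) = g (monomial k a)) (b : CrossedProduct α) : f b = g b :=
  mem_of_monomial_mem α (N := LinearMap.eqLocus f g) (isClosed_eq hf hg) h b

/-- On `a uᵏ` both sides carry the phase `zⁿ` at the site `n`: on the left it arises as `zᵏ` from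
the dual action and `zⁿ⁻ᵏ` from the site moved by the shift. -/
theorem regularHom_dualAction_mul_phaseOp (z : Circle) (b : CrossedProduct α) :
    regularHom α φ (dualAction α z b) * phaseOp H z = phaseOp H z * regularHom α φ b := by
  have hc := continuous_starAlgHom (regularHom α φ)
  have hd : Continuous (dualAction α z) := continuous_starAlgHom (dualHom α z)
  refine eq_of_eq_on_monomial α
    (f := LinearMap.mulRight ℂ (phaseOp H z) ∘ₗ (regularHom α φ).toAlgHom.toLinearMap ∘ₗ
      (dualHom α z).toAlgHom.toLinearMap)
    (g := LinearMap.mulLeft ℂ (phaseOp H z) ∘ₗ (regularHom α φ).toAlgHom.toLinearMap)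
    ?_ ?_ (fun k a => ?_) b
  · exact (hc.comp hd).mul (continuous_const (y := phaseOp H z))
  · exact (continuous_const (y := phaseOp H z)).mul hc
  change regularHom α φ (dualAction α z (monomial k a)) * phaseOp H z = _ * regularHom α φ _
  rw [dualAction_monomial, map_smul]
  ext ξ : 1
  refine lp.ext (funext fun i => ?_)
  rw [mul_apply_eq_comp, mul_apply_eq_comp, smul_apply, lp.coeFn_smul, Pi.smul_apply,
    regularHom_monomial, phaseOp_apply, phaseOp_apply, regularHom_monomial, map_smul, smul_smul,
    ← Circle.coe_mul, ← zpow_add, add_sub_cancel]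

theorem regularHom_dualAction (z : Circle) (b : CrossedProduct α) :
    regularHom α φ (dualAction α z b) = phaseOp H z * (regularHom α φ b * phaseOp H z⁻¹) := by
  rw [← mul_assoc, ← regularHom_dualAction_mul_phaseOp, mul_assoc, phaseOp_mul_inv, mul_one]

/-- The phases implement the dual action, so the kernel is rotation-invariant and contains the
Fourier coefficients of its elements. A monomial `a uᵏ` in the kernel has `φ a = 0`, hence `a = 0`,
and an element with no coefficients is zero. -/
theorem regularHom_injective (hφ : Function.Injective φ) :
    Function.Injective (regularHom α φ) := by
  refine (injective_iff_map_eq_zero _).2 fun b hb => eq_zero_of_coeff_eq_zero fun k => ?_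
  obtain ⟨a, ha⟩ := exists_coeff_eq_monomial (embed_injective α) k b
  have hker : coeff k b ∈ {c | regularHom α φ c = 0} := by
    refine fourierCoeff_mem (continuous_orbit b) k ?_ ?_ fun t => ?_
    · intro x hx y hy s t _ _ _
      simp only [Set.mem_ofPred_eq] at hx hy ⊢
      rw [map_add, ← Complex.coe_smul, ← Complex.coe_smul, map_smul, map_smul, hx, hy]
      simp
    · exact isClosed_eq (continuous_starAlgHom (regularHom α φ)) continuous_const
    · simp only [Set.mem_ofPred_eq]
      rw [map_smul, regularHom_dualAction, hb, zero_mul, mul_zero, smul_zero]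
  rw [ha] at hker ⊢
  have := rep_eq_zero_of_regularHom_monomial α φ hker
  rw [(injective_iff_map_eq_zero φ).1 hφ a this, map_zero]

end RegularRepresentation
end
end SpectralMetric

namespace SpectralMetric
noncomputable section

/-! ### The spectral triple on the crossed product, with conditions (i) and (ii) -/

section CrossedTriple

open CrossedProduct SpectralTriple

/-- The weight `±n` on the summand `(n, s)`. -/
def weight (i : ℤ × Bool) : ℝ := if i.2 then -i.1 else i.1

theorem weight_flipPerm (i : ℤ × Bool) : weight (flipPerm i) = -weight i := by
  rcases i with ⟨n, s⟩
  cases s <;> simp [weight, flipPerm_apply]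

theorem tendsto_abs_weight : Filter.Tendsto (fun i => |weight i|) Filter.cofinite Filter.atTop := by
  refine Filter.tendsto_atTop.2 fun R => ?_
  have hfin : (Set.Icc (-⌈R⌉) ⌈R⌉ ×ˢ (Set.univ : Set Bool)).Finite :=
    (Set.finite_Icc _ _).prod Set.finite_univ
  refine Filter.mem_of_superset hfin.compl_mem_cofinite fun i hi => ?_
  simp only [Set.mem_ofPred_eq]
  by_contra hcon
  apply hi
  have habs : |weight i| = |(i.1 : ℝ)| := by
    unfold weight
    split_ifs
    · rw [abs_neg]
    · rfl
  rw [habs, not_le] at hcon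
  have h1 : |(i.1 : ℝ)| < (⌈R⌉ : ℝ) := hcon.trans_le (Int.le_ceil R)
  have h2 : |i.1| < ⌈R⌉ := by exact_mod_cast h1
  exact ⟨⟨(abs_lt.1 h2).1.le, (abs_lt.1 h2).2.le⟩, Set.mem_univ _⟩

variable {A : Type u} [CStarAlgebra A] (X : SpectralTriple.{u} A) (α : A ≃⋆ₐ[ℂ] A)

/-- The operator `D ⊗ σ₁ + n ⊗ σ₂` on two copies of `ℓ²(ℤ, H)`. -/
def crossedDirac : ell2 (ℤ × Bool) X.H →ₗ.[ℂ] ell2 (ℤ × Bool) X.H :=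
  diracSum X.D flipPerm weight

theorem isSelfAdjoint_crossedDirac : IsSelfAdjoint (crossedDirac X) :=
  isSelfAdjoint_diracSum X.isSelfAdjoint flipPerm_flipPerm weight_flipPerm

theorem hasCompactResolvent_crossedDirac : HasCompactResolvent (crossedDirac X) :=
  hasCompactResolvent_diracSum X.isSelfAdjoint flipPerm_flipPerm weight_flipPerm
    X.hasCompactResolvent tendsto_abs_weight

theorem isCommutator_crossedDirac_iff {S T : ell2 (ℤ × Bool) X.H →L[ℂ] ell2 (ℤ × Bool) X.H} :
    IsCommutator (crossedDirac X) S T ↔ ∀ ξ : (crossedDirac X).domain, ∀ i, ∃ x : X.D.domain,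
      (x : X.H) = S ξ i ∧ (S (crossedDirac X ξ) + T ξ : ell2 (ℤ × Bool) X.H) (flipPerm i) =
        X.D x + (Complex.I * weight i) • (x : X.H) := by
  rw [isCommutator_iff_of_isClosed (isSelfAdjoint_crossedDirac X).isClosed]
  constructor
  · intro h ξ i
    obtain ⟨η, hη, hη'⟩ := h ξ
    obtain ⟨x, hx, hx'⟩ := diracSum_apply η i
    refine ⟨x, by rw [hx, hη], ?_⟩
    rw [← hx', ← hη', add_sub_cancel]
    rfl
  · intro h ξ
    obtain ⟨η, hη, hη'⟩ := exists_diracSum_domain (h ξ)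
    exact ⟨η, hη, by rw [sub_eq_iff_eq_add']; exact hη'⟩

/-- The scalar weights commute with the diagonal action of `a`, so only the commutators `[D,
α⁻ⁿ(a)]` remain, one for each site, composed with the flip. -/
theorem commutatorBound_regularHom_embed {a : A} {M : ℝ}
    (h : ∀ n : ℤ, (α ^ n) a ∈ X.lip M) :
    CommutatorBound (crossedDirac X) (regularHom α X.π (embed α a)) M := by
  choose T hT hTM using h
  refine ⟨permOp flipPerm (fun i => T (-i.1)) M fun i => hTM _, ?_,
    norm_permOp_le (lip_nonneg ⟨T 0, hT 0, hTM 0⟩)⟩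
  rw [isCommutator_crossedDirac_iff]
  intro ξ i
  obtain ⟨x, hx, hx'⟩ := diracSum_apply ξ i
  obtain ⟨y, hy, hy'⟩ :=
    (isCommutator_iff_of_isClosed X.isSelfAdjoint.isClosed _ _).1 (hT (-i.1)) x
  refine ⟨y, ?_, ?_⟩
  · rw [regularHom_embed, diagRep_apply, ← hx, hy]
  · rw [regularHom_embed, lp.coeFn_add, Pi.add_apply, permOp_apply_perm, diagRep_apply]
    change X.π ((α ^ (-(flipPerm i).1)) a) (diracSum X.D flipPerm weight ξ (flipPerm i)) + _ = _
    rw [hx', map_add, map_smul, ← hx, ← hy', flipPerm_apply, hy]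
    abel

theorem weight_shiftPerm_sub (i : ℤ × Bool) :
    weight (shiftPerm i) - weight i = if i.2 then -1 else 1 := by
  rcases i with ⟨n, s⟩
  cases s <;> simp [weight, shiftPerm_apply]

/-- The second Pauli matrix, as a unitary. -/
def pauliOp : ell2 (ℤ × Bool) X.H →L[ℂ] ell2 (ℤ × Bool) X.H :=
  permOp flipPerm (fun i => (Complex.I * (if i.2 then -1 else 1)) • 1) 1 fun i => by
    rw [norm_smul]
    refine mul_le_one₀ ?_ (norm_nonneg _) ContinuousLinearMap.norm_id_le
    split_ifs <;> simp

theorem pauliOp_apply (ξ : ell2 (ℤ × Bool) X.H) (i : ℤ × Bool) :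
    pauliOp X ξ (flipPerm i) = (Complex.I * (if i.2 then -1 else 1)) • ξ i := by
  rw [pauliOp, permOp_apply_perm]
  rfl

/-- The shift commutes with the part coming from `D`, while the weight jumps by `±1` between
neighbouring sites; the jump is the second Pauli matrix. -/
theorem isCommutator_regularHom_u :
    IsCommutator (crossedDirac X) (regularHom α X.π (u α)) (shiftOp X.H * pauliOp X) := by
  rw [isCommutator_crossedDirac_iff]
  intro ξ i
  obtain ⟨j, rfl⟩ := shiftPerm.surjective i
  obtain ⟨x, hx, hx'⟩ := diracSum_apply ξ j
  have h1 : ∀ ζ : ell2 (ℤ × Bool) X.H, shiftOp X.H ζ (flipPerm (shiftPerm j)) = ζ (flipPerm j) := by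
    intro ζ
    rw [shiftOp_apply, flipPerm_apply, shiftPerm_apply, flipPerm_apply, add_sub_cancel_right]
  have h2 : weight (shiftPerm j) = weight j + if j.2 then -1 else 1 := by
    rw [← weight_shiftPerm_sub]; ring
  refine ⟨x, ?_, ?_⟩
  · rw [regularHom_u, shiftOp_apply, hx, shiftPerm_apply, add_sub_cancel_right]
  · rw [regularHom_u, lp.coeFn_add, Pi.add_apply, mul_apply_eq_comp, h1, h1, pauliOp_apply]
    change diracSum X.D flipPerm weight ξ (flipPerm j) + _ = _
    rw [hx', ← hx, add_assoc, ← add_smul, h2]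
    congr 2
    push_cast
    split_ifs <;> simp <;> ring

theorem commute_pauliOp (a : A) : Commute (pauliOp X) (diagRep α X.π a) := by
  ext ξ : 1
  refine lp.ext (funext fun i => ?_)
  obtain ⟨j, rfl⟩ := flipPerm.surjective i
  rw [mul_apply_eq_comp, mul_apply_eq_comp, pauliOp_apply, diagRep_apply, diagRep_apply,
    pauliOp_apply, map_smul]
  rfl

theorem mem_C1_iff_of_isEquicontinuousAut {X : SpectralTriple.{u} A} {α : A ≃⋆ₐ[ℂ] A}
    (h : X.IsEquicontinuousAut α) {a : A} (ha : a ∈ X.C1) :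
    ∃ M, ∀ n : ℤ, (α ^ n) a ∈ X.lip M := by
  have h1 : a ∈ X.C1bAction (zpowersHom (A ≃⋆ₐ[ℂ] A) α) := by
    rw [← h]; exact ha
  obtain ⟨-, M, hM⟩ := h1
  exact ⟨M, fun n => hM (Multiplicative.ofAdd n)⟩

/-- The elements with bounded commutator form a ⋆-subalgebra, whose closure contains `u` and, by
equicontinuity and the density of `X.C1`, all of `A`. -/
theorem dense_commutator_regularHom (h : X.IsEquicontinuousAut α) :
    Dense {b | ∃ T, IsCommutator (crossedDirac X) (regularHom α X.π b) T} := by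
  let S := commutatorSubalgebra (isSelfAdjoint_crossedDirac X) (regularHom α X.π)
  have hemb : ∀ a, embed α a ∈ S.topologicalClosure := by
    intro a
    have h1 : a ∈ closure X.C1 := X.dense_bounded_commutator a
    have h2 : X.C1 ⊆ embed α ⁻¹' (S.topologicalClosure : Set (CrossedProduct α)) := by
      intro c hc
      obtain ⟨M, hM⟩ := mem_C1_iff_of_isEquicontinuousAut h hc
      obtain ⟨T, hT, -⟩ := commutatorBound_regularHom_embed X α hM
      exact S.le_topologicalClosure ⟨T, hT⟩
    exact closure_minimal h2
      (S.isClosed_topologicalClosure.preimage (continuous_starAlgHom (embed α))) h1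
  have hu : u α ∈ S.topologicalClosure :=
    S.le_topologicalClosure ⟨_, isCommutator_regularHom_u X α⟩
  intro b
  have := mem_of_generators S.isClosed_topologicalClosure hemb hu b
  rwa [← SetLike.mem_coe, StarSubalgebra.topologicalClosure_coe] at this

/-- The spectral triple on the crossed product by an equicontinuous action. -/
def crossedTriple (h : X.IsEquicontinuousAut α) : SpectralTriple.{u} (CrossedProduct α) where
  H := ell2 (ℤ × Bool) X.H
  π := regularHom α X.π
  π_injective := regularHom_injective α X.π X.π_injective
  D := crossedDirac X
  isSelfAdjoint := isSelfAdjoint_crossedDirac X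
  hasCompactResolvent := hasCompactResolvent_crossedDirac X
  dense_bounded_commutator := dense_commutator_regularHom X α h

/-- The phase depends only on the site, and the Dirac operator preserves the site. -/
theorem isCommutator_phaseOp (z : Circle) : IsCommutator (crossedDirac X) (phaseOp X.H z) 0 := by
  rw [isCommutator_crossedDirac_iff]
  intro ξ i
  obtain ⟨x, hx, hx'⟩ := diracSum_apply ξ i
  refine ⟨((z ^ i.1 : Circle) : ℂ) • x, ?_, ?_⟩
  · rw [phaseOp_apply, Submodule.coe_smul, hx]
  · rw [zero_apply, add_zero, phaseOp_apply]
    change _ • diracSum X.D flipPerm weight ξ (flipPerm i) = _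
    rw [hx', LinearPMap.map_smul, Submodule.coe_smul, smul_add, smul_comm, flipPerm_apply]

theorem isCommutator_dualAction {b : CrossedProduct α}
    {T : ell2 (ℤ × Bool) X.H →L[ℂ] ell2 (ℤ × Bool) X.H}
    (hT : IsCommutator (crossedDirac X) (regularHom α X.π b) T) (z : Circle) :
    IsCommutator (crossedDirac X) (regularHom α X.π (dualAction α z b))
      (phaseOp X.H z * (T * phaseOp X.H z⁻¹)) := by
  have hD := isSelfAdjoint_crossedDirac X
  have := (isCommutator_phaseOp X z).mul hD (hT.mul hD (isCommutator_phaseOp X z⁻¹))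
  rwa [← regularHom_dualAction, mul_zero, zero_add, zero_mul, add_zero] at this

theorem commutatorBound_dualAction {b : CrossedProduct α} {M : ℝ}
    (h : CommutatorBound (crossedDirac X) (regularHom α X.π b) M) (z : Circle) :
    CommutatorBound (crossedDirac X) (regularHom α X.π (dualAction α z b)) M := by
  obtain ⟨T, hT, hTM⟩ := h
  refine ⟨_, isCommutator_dualAction X α hT z, ?_⟩
  calc _ ≤ ‖phaseOp X.H z‖ * (‖T‖ * ‖phaseOp X.H z⁻¹‖) :=
        (norm_mul_le _ _).trans (mul_le_mul_of_nonneg_left (norm_mul_le _ _) (norm_nonneg _))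
    _ ≤ 1 * (M * 1) := by
        gcongr
        · exact norm_phaseOp_le z
        · exact (norm_nonneg _).trans hTM
        · exact norm_phaseOp_le z⁻¹
    _ = M := by ring

theorem continuous_phaseOp :
    Continuous fun p : Circle × ell2 (ℤ × Bool) X.H => phaseOp X.H p.1 p.2 := by
  let N : Submodule ℂ (ell2 (ℤ × Bool) X.H) :=
    { carrier := {ξ | Continuous fun z => phaseOp X.H z ξ}
      add_mem' := fun {x y} hx hy => by
        simp only [Set.mem_ofPred_eq, map_add] at hx hy ⊢
        exact hx.add hy
      zero_mem' := by
        simp only [Set.mem_ofPred_eq, map_zero]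
        exact continuous_const
      smul_mem' := fun c x hx => by
        simp only [Set.mem_ofPred_eq, map_smul] at hx ⊢
        exact hx.const_smul c }
  have hN : Dense (N : Set (ell2 (ℤ × Bool) X.H)) := by
    refine dense_of_single_mem dense_univ fun i x _ => ?_
    change Continuous fun z => phaseOp X.H z (lp.single 2 i x)
    simp only [phaseOp_single]
    have h1 : Continuous ((↑) : Circle → ℂ) := by fun_prop
    have h2 : Continuous fun z : Circle => z ^ i.1 := continuous_zpow _
    exact (h1.comp h2).smul continuous_const
  refine continuous_prod_of_dense_continuous_lipschitzWith' _ 1 hN (fun z => ?_) fun ξ hξ => hξ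
  exact (phaseOp X.H z).lipschitzWith_of_opNorm_le (norm_phaseOp_le z)

theorem continuous_phaseOp_conj (T : ell2 (ℤ × Bool) X.H →L[ℂ] ell2 (ℤ × Bool) X.H)
    (ξ : ell2 (ℤ × Bool) X.H) :
    Continuous fun z => (phaseOp X.H z * (T * phaseOp X.H z⁻¹)) ξ :=
  (continuous_phaseOp X).comp (continuous_id.prodMk (T.continuous.comp
    ((continuous_phaseOp X).comp (continuous_inv.prodMk continuous_const))))

/-- Conjugating the commutator by the phases gives the commutator of the rotated element, and the
phases are strongly continuous in `z`. -/
theorem isQuasiIsometric_crossedTriple (h : X.IsEquicontinuousAut α) :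
    (crossedTriple X α h).IsQuasiIsometric (dualAction α) := by
  refine Set.Subset.antisymm ?_ ?_
  · rintro b ⟨T, hT⟩
    exact ⟨_, isCommutator_dualAction X α hT, continuous_phaseOp_conj X T⟩
  · rintro b ⟨T, hT, -⟩
    refine ⟨T 1, ?_⟩
    have := hT 1
    rwa [map_one] at this

theorem boundedCommutingCocycle_crossedTriple (h : X.IsEquicontinuousAut α) :
    BoundedCommutingCocycle α (crossedTriple X α h) := by
  refine ⟨shiftOp X.H * pauliOp X, isCommutator_regularHom_u X α, fun a => ?_⟩
  change Commute (regularHom α X.π (star (u α)) * (shiftOp X.H * pauliOp X))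
    (regularHom α X.π (embed α a))
  rw [map_star, regularHom_u, ← mul_assoc, shiftOp_mem_unitary.1, one_mul, regularHom_embed]
  exact commute_pauliOp X α a

end CrossedTriple
end
end SpectralMetric

namespace SpectralMetric
noncomputable section

set_option linter.unusedSectionVars false

/-! ### Coefficient estimates and the number operator -/

section Estimates

open CrossedProduct SpectralTriple

variable {A : Type u} [CStarAlgebra A]

/-- Lipschitz balls are closed, convex and balanced, so the circle average defining a coefficient
stays inside. -/
theorem coeff_mem_lip {α : A ≃⋆ₐ[ℂ] A} {Y : SpectralTriple.{u} (CrossedProduct α)}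
    {b : CrossedProduct α} {M : ℝ} (h : ∀ z, dualAction α z b ∈ Y.lip M) (k : ℤ) :
    coeff k b ∈ Y.lip M := by
  refine fourierCoeff_mem (continuous_orbit b) k (convex_lip Y M) (Y.isClosed_lip M) fun t => ?_
  have := lip_smul (fourier (-k) t) (h (AddCircle.toCircle t))
  rwa [fourier_apply, Circle.norm_coe, one_mul, ← fourier_apply] at this

variable (X : SpectralTriple.{u} A) (α : A ≃⋆ₐ[ℂ] A)

/-- Matrix entry of the commutator from the site `-k` to the site `0`: there `a` acts untwisted and
the weight is zero, which leaves `[D, a]` up to the weight of the source. -/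
theorem exists_commutator_monomial_apply {k : ℤ} {a : A}
    {T : ell2 (ℤ × Bool) X.H →L[ℂ] ell2 (ℤ × Bool) X.H}
    (hT : IsCommutator (crossedDirac X) (regularHom α X.π (monomial k a)) T)
    (v : X.D.domain) (s : Bool) :
    ∃ y : X.D.domain, (y : X.H) = X.π a v ∧ X.D y - X.π a (X.D v) =
      T (lp.single 2 (-k, s) (v : X.H)) (0, !s) + (Complex.I * weight (-k, s)) • X.π a v := by
  obtain ⟨ξ, hξ, hξ'⟩ := diracSum_single (D := X.D) (τ := flipPerm) (m := weight) (-k, s) v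
  obtain ⟨y, hy, hy'⟩ := (isCommutator_crossedDirac_iff X).1 hT ξ (0, s)
  have e1 : (α ^ (-(0 : ℤ))) a = a := by rw [neg_zero, zpow_zero]; rfl
  refine ⟨y, ?_, ?_⟩
  · rw [hy, hξ, regularHom_monomial, zero_sub, lp.single_apply_self, e1]
  · have hw : weight (0, s) = 0 := by cases s <;> simp [weight]
    rw [hw, Complex.ofReal_zero, mul_zero, zero_smul, add_zero, lp.coeFn_add, Pi.add_apply] at hy'
    change (regularHom α X.π (monomial k a)) (diracSum X.D flipPerm weight ξ) (flipPerm (0, s)) + _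
      = _ at hy'
    rw [hξ', regularHom_monomial, hξ] at hy'
    rw [flipPerm_apply, flipPerm_apply] at hy'
    dsimp only at hy'
    rw [zero_sub, lp.single_apply_self, e1, map_add, map_smul] at hy'
    rw [← hy']
    abel

/-- The source weights for the two spinor components are `-k` and `k`. Averaging the two matrix
entries cancels them and isolates `[D, a]` without loss in the constant. -/
theorem lip_of_commutatorBound_monomial {k : ℤ} {a : A} {M : ℝ}
    (h : CommutatorBound (crossedDirac X) (regularHom α X.π (monomial k a)) M) : a ∈ X.lip M := by
  have hM := h.nonneg
  obtain ⟨T, hT, hTM⟩ := h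
  have hTn : ∀ (v : X.H) (s : Bool), ‖T (lp.single 2 (-k, s) v) (0, !s)‖ ≤ M * ‖v‖ := by
    intro v s
    refine (ell2_norm_apply_le _ _).trans ((T.le_of_opNorm_le hTM _).trans_eq ?_)
    rw [lp.norm_single (by norm_num)]
  have hv : ∀ v : X.D.domain, ∃ y : X.D.domain, (y : X.H) = X.π a v ∧
      ‖X.D y - X.π a (X.D v)‖ ≤ M * ‖(v : X.H)‖ := by
    intro v
    obtain ⟨y, hy, hy'⟩ := exists_commutator_monomial_apply X α hT v false
    obtain ⟨z, hz, hz'⟩ := exists_commutator_monomial_apply X α hT v true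
    obtain rfl : y = z := Subtype.ext (hy.trans hz.symm)
    have w1 : weight (-k, false) = -k := by simp [weight]
    have w2 : weight (-k, true) = k := by simp [weight]
    rw [w1] at hy'
    rw [w2] at hz'
    refine ⟨y, hy, ?_⟩
    have h2 : (2 : ℂ) • (X.D y - X.π a (X.D v)) =
        T (lp.single 2 (-k, false) (v : X.H)) (0, !false) +
        T (lp.single 2 (-k, true) (v : X.H)) (0, !true) := by
      rw [two_smul]
      nth_rewrite 1 [hy']
      rw [hz']
      push_cast
      module
    have h3 := congrArg norm h2
    rw [norm_smul, Complex.norm_ofNat] at h3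
    have := h3.trans_le ((norm_add_le _ _).trans (add_le_add (hTn v false) (hTn v true)))
    linarith
  refine (commutatorBound_iff X.isSelfAdjoint _ hM).2 fun x v => ?_
  obtain ⟨y, hy, hy'⟩ := hv v
  rw [← hy, inner_apply_left_eq_right X.isSelfAdjoint, ← inner_sub_right]
  calc _ ≤ ‖(x : X.H)‖ * ‖X.D y - X.π a (X.D v)‖ := norm_inner_le_norm _ _
    _ ≤ ‖(x : X.H)‖ * (M * ‖(v : X.H)‖) := by gcongr
    _ = _ := by ring

/-- The first Pauli matrix. -/
def flipOp : ell2 (ℤ × Bool) X.H →L[ℂ] ell2 (ℤ × Bool) X.H :=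
  permOp flipPerm (fun _ => 1) 1 fun _ => ContinuousLinearMap.norm_id_le

/-- The third Pauli matrix. -/
def signOp : ell2 (ℤ × Bool) X.H →L[ℂ] ell2 (ℤ × Bool) X.H :=
  permOp (Equiv.refl _) (fun i => (if i.2 then (-1 : ℂ) else 1) • 1) 1 fun i => by
    rw [norm_smul]
    refine mul_le_one₀ ?_ (norm_nonneg _) ContinuousLinearMap.norm_id_le
    split_ifs <;> simp

theorem flipOp_apply (ξ : ell2 (ℤ × Bool) X.H) (i : ℤ × Bool) :
    flipOp X ξ i = ξ (i.1, !i.2) := rfl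

theorem signOp_apply (ξ : ell2 (ℤ × Bool) X.H) (i : ℤ × Bool) :
    signOp X ξ i = (if i.2 then (-1 : ℂ) else 1) • ξ i := rfl

theorem flipOp_flipOp (ξ : ell2 (ℤ × Bool) X.H) : flipOp X (flipOp X ξ) = ξ := by
  refine lp.ext (funext fun i => ?_)
  rw [flipOp_apply, flipOp_apply, Bool.not_not]

theorem signOp_signOp (ξ : ell2 (ℤ × Bool) X.H) : signOp X (signOp X ξ) = ξ := by
  refine lp.ext (funext fun i => ?_)
  rw [signOp_apply, signOp_apply, smul_smul]
  split_ifs <;> simp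

theorem signOp_flipOp (ξ : ell2 (ℤ × Bool) X.H) :
    signOp X (flipOp X ξ) = -flipOp X (signOp X ξ) := by
  refine lp.ext (funext fun i => ?_)
  rw [lp.coeFn_neg, Pi.neg_apply, signOp_apply, flipOp_apply, flipOp_apply, signOp_apply]
  rcases i with ⟨n, s⟩
  cases s <;> simp

theorem inner_flipOp_left (ξ ζ : ell2 (ℤ × Bool) X.H) : ⟪flipOp X ξ, ζ⟫_ℂ = ⟪ξ, flipOp X ζ⟫_ℂ := by
  have h : star (flipOp X) = flipOp X := by
    rw [flipOp, star_permOp]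
    ext ξ : 1
    refine lp.ext (funext fun i => ?_)
    rw [permOp_apply, permOp_apply, star_one]
    rfl
  nth_rewrite 1 [← h]
  rw [ContinuousLinearMap.star_eq_adjoint, ContinuousLinearMap.adjoint_inner_left]

theorem inner_signOp_left (ξ ζ : ell2 (ℤ × Bool) X.H) : ⟪signOp X ξ, ζ⟫_ℂ = ⟪ξ, signOp X ζ⟫_ℂ := by
  have h : star (signOp X) = signOp X := by
    rw [signOp, star_permOp]
    ext ξ : 1
    refine lp.ext (funext fun i => ?_)
    rw [permOp_apply, permOp_apply, star_smul, star_one]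
    change (star (if i.2 then (-1 : ℂ) else 1) • (1 : X.H →L[ℂ] X.H)) (ξ i) =
      ((if i.2 then (-1 : ℂ) else 1) • (1 : X.H →L[ℂ] X.H)) (ξ i)
    split_ifs <;> simp
  nth_rewrite 1 [← h]
  rw [ContinuousLinearMap.star_eq_adjoint, ContinuousLinearMap.adjoint_inner_left]

theorem norm_flipOp_apply (ξ : ell2 (ℤ × Bool) X.H) : ‖flipOp X ξ‖ ≤ ‖ξ‖ := by
  simpa using (flipOp X).le_of_opNorm_le (norm_permOp_le zero_le_one) ξ

theorem norm_signOp_apply (ξ : ell2 (ℤ × Bool) X.H) : ‖signOp X ξ‖ ≤ ‖ξ‖ := by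
  simpa using (signOp X).le_of_opNorm_le (norm_permOp_le zero_le_one) ξ

theorem regularHom_flipOp (b : CrossedProduct α) (ξ : ell2 (ℤ × Bool) X.H) :
    regularHom α X.π b (flipOp X ξ) = flipOp X (regularHom α X.π b ξ) := by
  have hc : Continuous fun b => regularHom α X.π b := continuous_starAlgHom (regularHom α X.π)
  refine eq_of_eq_on_monomial α
    (f := (ContinuousLinearMap.apply ℂ (ell2 (ℤ × Bool) X.H) (flipOp X ξ)).toLinearMap ∘ₗ
      (regularHom α X.π).toAlgHom.toLinearMap)
    (g := (flipOp X).toLinearMap ∘ₗ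
      (ContinuousLinearMap.apply ℂ (ell2 (ℤ × Bool) X.H) ξ).toLinearMap ∘ₗ
      (regularHom α X.π).toAlgHom.toLinearMap) ?_ ?_ (fun k a => ?_) b
  · exact hc.clm_apply continuous_const
  · exact (flipOp X).continuous.comp (hc.clm_apply continuous_const)
  · change regularHom α X.π (monomial k a) (flipOp X ξ) =
      flipOp X (regularHom α X.π (monomial k a) ξ)
    refine lp.ext (funext fun i => ?_)
    rw [regularHom_monomial, flipOp_apply, flipOp_apply, regularHom_monomial]

theorem regularHom_signOp (b : CrossedProduct α) (ξ : ell2 (ℤ × Bool) X.H) :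
    regularHom α X.π b (signOp X ξ) = signOp X (regularHom α X.π b ξ) := by
  have hc : Continuous fun b => regularHom α X.π b := continuous_starAlgHom (regularHom α X.π)
  refine eq_of_eq_on_monomial α
    (f := (ContinuousLinearMap.apply ℂ (ell2 (ℤ × Bool) X.H) (signOp X ξ)).toLinearMap ∘ₗ
      (regularHom α X.π).toAlgHom.toLinearMap)
    (g := (signOp X).toLinearMap ∘ₗ
      (ContinuousLinearMap.apply ℂ (ell2 (ℤ × Bool) X.H) ξ).toLinearMap ∘ₗ
      (regularHom α X.π).toAlgHom.toLinearMap) ?_ ?_ (fun k a => ?_) b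
  · exact hc.clm_apply continuous_const
  · exact (signOp X).continuous.comp (hc.clm_apply continuous_const)
  · change regularHom α X.π (monomial k a) (signOp X ξ) =
      signOp X (regularHom α X.π (monomial k a) ξ)
    refine lp.ext (funext fun i => ?_)
    rw [regularHom_monomial, signOp_apply, signOp_apply, regularHom_monomial, map_smul]

/-- `d` and `n` are the images of `ξ` under the diagonal operators `D` and `n`. -/
def DiagonalImages (ξ d n : ell2 (ℤ × Bool) X.H) : Prop :=
  ∀ i, ∃ x : X.D.domain, (x : X.H) = ξ i ∧ d i = X.D x ∧ n i = (i.1 : ℂ) • (x : X.H)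

variable {X}

theorem DiagonalImages.flip {ξ d n : ell2 (ℤ × Bool) X.H} (h : DiagonalImages X ξ d n) :
    DiagonalImages X (flipOp X ξ) (flipOp X d) (flipOp X n) := by
  intro i
  obtain ⟨x, hx, hd, hn⟩ := h (i.1, !i.2)
  exact ⟨x, hx, hd, hn⟩

theorem DiagonalImages.sign {ξ d n : ell2 (ℤ × Bool) X.H} (h : DiagonalImages X ξ d n) :
    DiagonalImages X (signOp X ξ) (signOp X d) (signOp X n) := by
  intro i
  obtain ⟨x, hx, hd, hn⟩ := h i
  refine ⟨(if i.2 then (-1 : ℂ) else 1) • x, ?_, ?_, ?_⟩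
  · rw [Submodule.coe_smul, hx, signOp_apply]
  · rw [LinearPMap.map_smul, signOp_apply, hd]
  · rw [Submodule.coe_smul, signOp_apply, hn, smul_comm]

theorem DiagonalImages.exists_domain {ξ d n : ell2 (ℤ × Bool) X.H} (h : DiagonalImages X ξ d n) :
    ∃ η : (crossedDirac X).domain, (η : ell2 (ℤ × Bool) X.H) = ξ ∧
      crossedDirac X η = flipOp X (d + Complex.I • signOp X n) := by
  refine exists_diracSum_domain fun i => ?_
  obtain ⟨x, hx, hd, hn⟩ := h i
  refine ⟨x, hx, ?_⟩
  rw [flipOp_apply, flipPerm_apply, Bool.not_not]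
  change (d + Complex.I • signOp X n : ell2 (ℤ × Bool) X.H) i = _
  rw [lp.coeFn_add, Pi.add_apply, lp.coeFn_smul, Pi.smul_apply, signOp_apply, hd, hn, smul_smul,
    smul_smul]
  congr 2
  unfold weight
  split_ifs <;> push_cast <;> ring

/-- With `F` the flip and `S` the sign, the Dirac operator is `F (D + i S n)`. Both `F` and `S`
commute with `b` and anticommute with each other, so comparing the commutator form at `(F S ξ, ξ')`
and `(S ξ, F ξ')` cancels the `D` terms and doubles the `n` terms. -/
theorem norm_number_commutator_le {b : CrossedProduct α} {M : ℝ}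
    (h : CommutatorBound (crossedDirac X) (regularHom α X.π b) M)
    {ξ d n ξ' d' n' : ell2 (ℤ × Bool) X.H} (h1 : DiagonalImages X ξ d n)
    (h2 : DiagonalImages X ξ' d' n') :
    ‖⟪n, regularHom α X.π b ξ'⟫_ℂ - ⟪ξ, regularHom α X.π b n'⟫_ℂ‖ ≤ M * ‖ξ‖ * ‖ξ'‖ := by
  have hM := h.nonneg
  have hb := (commutatorBound_iff (isSelfAdjoint_crossedDirac X) _ hM).1 h
  obtain ⟨η₁, e₁, f₁⟩ := h1.sign.exists_domain
  obtain ⟨η₂, e₂, f₂⟩ := h2.flip.exists_domain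
  obtain ⟨η₃, e₃, f₃⟩ := h1.sign.flip.exists_domain
  obtain ⟨η₄, e₄, f₄⟩ := h2.exists_domain
  have b1 := hb η₁ η₂
  have b2 := hb η₃ η₄
  rw [e₁, e₂, f₁, f₂] at b1
  rw [e₃, e₄, f₃, f₄] at b2
  have n1 : M * ‖signOp X ξ‖ * ‖flipOp X ξ'‖ ≤ M * ‖ξ‖ * ‖ξ'‖ := by
    gcongr
    · exact norm_signOp_apply X ξ
    · exact norm_flipOp_apply X ξ'
  have n2 : M * ‖flipOp X (signOp X ξ)‖ * ‖ξ'‖ ≤ M * ‖ξ‖ * ‖ξ'‖ := by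
    gcongr
    exact (norm_flipOp_apply X _).trans (norm_signOp_apply X ξ)
  have hn1 := b1.trans n1
  have hn2 := b2.trans n2
  have key : (2 * Complex.I) * (⟪n, regularHom α X.π b ξ'⟫_ℂ - ⟪ξ, regularHom α X.π b n'⟫_ℂ) =
      (⟪flipOp X (flipOp X (signOp X d) + Complex.I • signOp X (flipOp X (signOp X n))),
        regularHom α X.π b ξ'⟫_ℂ - ⟪flipOp X (signOp X ξ),
        regularHom α X.π b (flipOp X (d' + Complex.I • signOp X n'))⟫_ℂ) -
      (⟪flipOp X (signOp X d + Complex.I • signOp X (signOp X n)),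
        regularHom α X.π b (flipOp X ξ')⟫_ℂ - ⟪signOp X ξ, regularHom α X.π b
          (flipOp X (flipOp X d' + Complex.I • signOp X (flipOp X n')))⟫_ℂ) := by
    simp only [map_add, map_smul, signOp_flipOp, signOp_signOp, flipOp_flipOp, map_neg, smul_neg,
      regularHom_flipOp, regularHom_signOp, inner_flipOp_left, inner_signOp_left, inner_add_left,
      inner_add_right, inner_smul_left, inner_smul_right, inner_neg_left, inner_neg_right,
      Complex.conj_I]
    ring
  have hle := (norm_sub_le _ _).trans (add_le_add hn2 hn1)
  rw [← key, norm_mul, norm_mul, Complex.norm_I, Complex.norm_ofNat] at hle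
  linarith

end Estimates
end
end SpectralMetric

namespace SpectralMetric
noncomputable section

set_option linter.unusedSectionVars false

/-! ### Rotation moves Lipschitz elements at bounded speed -/

section Rotation

open CrossedProduct SpectralTriple

variable {A : Type u} [CStarAlgebra A] (X : SpectralTriple.{u} A) (α : A ≃⋆ₐ[ℂ] A)

/-- `ξ` lies in the domains of the diagonal operators, and `n` is its derivative under the phases. -/
def NumberImage (ξ n : ell2 (ℤ × Bool) X.H) : Prop :=
  (∃ d, DiagonalImages X ξ d n) ∧ ∀ θ : ℝ, HasDerivAt
    (fun θ : ℝ => phaseOp X.H (Circle.exp θ)⁻¹ ξ) (-Complex.I • phaseOp X.H (Circle.exp θ)⁻¹ n) θ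

/-- The vectors on which the phases are differentiable and whose components lie in the domain. -/
def numberCore : Submodule ℂ (ell2 (ℤ × Bool) X.H) where
  carrier := {ξ | ∃ n, NumberImage X ξ n}
  zero_mem' := by
    refine ⟨0, ⟨0, fun i => ⟨0, rfl, ?_, ?_⟩⟩, fun θ => ?_⟩
    · rw [LinearPMap.map_zero]; rfl
    · rw [Submodule.coe_zero, smul_zero]; rfl
    · simp only [map_zero, smul_zero]
      exact hasDerivAt_const _ _
  add_mem' := by
    rintro ξ ζ ⟨n, ⟨d, hd⟩, hn⟩ ⟨n', ⟨d', hd'⟩, hn'⟩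
    refine ⟨n + n', ⟨d + d', fun i => ?_⟩, fun θ => ?_⟩
    · obtain ⟨x, h1, h2, h3⟩ := hd i
      obtain ⟨y, h4, h5, h6⟩ := hd' i
      refine ⟨x + y, ?_, ?_, ?_⟩
      · rw [Submodule.coe_add, h1, h4]; rfl
      · rw [LinearPMap.map_add, ← h2, ← h5]; rfl
      · rw [Submodule.coe_add, smul_add, ← h3, ← h6]; rfl
    · simp only [map_add, smul_add]
      exact (hn θ).add (hn' θ)
  smul_mem' := by
    rintro c ξ ⟨n, ⟨d, hd⟩, hn⟩
    refine ⟨c • n, ⟨c • d, fun i => ?_⟩, fun θ => ?_⟩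
    · obtain ⟨x, h1, h2, h3⟩ := hd i
      refine ⟨c • x, ?_, ?_, ?_⟩
      · rw [Submodule.coe_smul, h1]; rfl
      · rw [LinearPMap.map_smul, ← h2]; rfl
      · rw [Submodule.coe_smul, smul_comm, ← h3]; rfl
    · simp only [map_smul]
      rw [smul_comm]
      exact (hn θ).const_smul c

theorem hasDerivAt_circle_exp_inv_zpow (k : ℤ) (θ : ℝ) :
    HasDerivAt (fun θ : ℝ => (((Circle.exp θ)⁻¹ ^ k : Circle) : ℂ))
      (-Complex.I * k * (((Circle.exp θ)⁻¹ ^ k : Circle) : ℂ)) θ := by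
  have h : ∀ θ : ℝ, (((Circle.exp θ)⁻¹ ^ k : Circle) : ℂ) = Complex.exp (-Complex.I * k * θ) := by
    intro θ
    rw [Circle.coe_zpow, Circle.coe_inv, Circle.coe_exp, ← Complex.exp_neg, ← Complex.exp_int_mul]
    congr 1; ring
  simp only [h]
  have h1 : HasDerivAt (fun θ : ℝ => -Complex.I * k * (θ : ℂ)) (-Complex.I * k) θ := by
    simpa using (Complex.ofRealCLM.hasDerivAt (x := θ)).const_mul (-Complex.I * k)
  simpa [mul_comm] using h1.cexp

theorem dense_numberCore : Dense (numberCore X : Set (ell2 (ℤ × Bool) X.H)) := by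
  refine dense_of_single_mem X.isSelfAdjoint.dense_domain fun i x hx => ?_
  refine ⟨(i.1 : ℂ) • lp.single 2 i x, ⟨lp.single 2 i (X.D ⟨x, hx⟩), fun j => ?_⟩, fun θ => ?_⟩
  · by_cases hj : j = i
    · subst hj
      refine ⟨⟨x, hx⟩, ?_, ?_, ?_⟩
      · rw [lp.single_apply_self]
      · rw [lp.single_apply_self]
      · rw [lp.coeFn_smul, Pi.smul_apply, lp.single_apply_self]
    · refine ⟨0, ?_, ?_, ?_⟩
      · rw [lp.single_apply_ne _ _ _ hj]; rfl
      · rw [lp.single_apply_ne _ _ _ hj, LinearPMap.map_zero]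
      · rw [lp.coeFn_smul, Pi.smul_apply, lp.single_apply_ne _ _ _ hj, smul_zero,
          Submodule.coe_zero, smul_zero]
  · simp only [map_smul, phaseOp_single]
    refine ((hasDerivAt_circle_exp_inv_zpow i.1 θ).smul_const
      (lp.single 2 i x : ell2 (ℤ × Bool) X.H)).congr_deriv ?_
    rw [smul_smul, smul_smul, mul_assoc]

/-- The matrix entries of the rotated element between vectors of the core are differentiable in `θ`.
Their derivative is `i` times the commutator form of the rotated element with `n`, bounded by `M ‖x‖
‖y‖` because rotation preserves the Lipschitz bound; the mean value inequality concludes. -/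
theorem norm_regularHom_dualAction_sub_le {b : CrossedProduct α} {M : ℝ}
    (h : CommutatorBound (crossedDirac X) (regularHom α X.π b) M) (θ : ℝ) :
    ‖dualAction α (Circle.exp θ) b - b‖ ≤ M * |θ| := by
  have hM := h.nonneg
  rw [← NonUnitalStarAlgHom.norm_map (regularHom α X.π) (regularHom_injective α X.π X.π_injective)]
  refine opNorm_le_of_dense_inner_le (dense_numberCore X) (dense_numberCore X) (by positivity) ?_
  rintro x ⟨n, ⟨d, hd⟩, hx⟩ y ⟨n', ⟨d', hd'⟩, hy⟩
  let B := regularHom α X.π b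
  let f : ℝ → ℂ := fun θ => ⟪phaseOp X.H (Circle.exp θ)⁻¹ x, B (phaseOp X.H (Circle.exp θ)⁻¹ y)⟫_ℂ
  have hinner : ∀ (θ : ℝ) v w, ⟪phaseOp X.H (Circle.exp θ)⁻¹ v, B (phaseOp X.H (Circle.exp θ)⁻¹ w)⟫_ℂ
      = ⟪v, regularHom α X.π (dualAction α (Circle.exp θ) b) w⟫_ℂ := by
    intro θ v w
    rw [inner_phaseOp_left, inv_inv, regularHom_dualAction]
    rfl
  have hf : ∀ θ, HasDerivAt f (Complex.I * (⟪n, regularHom α X.π (dualAction α (Circle.exp θ) b) y⟫_ℂ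
      - ⟪x, regularHom α X.π (dualAction α (Circle.exp θ) b) n'⟫_ℂ)) θ := by
    intro θ
    have h2 := ((B.restrictScalars ℝ).hasFDerivAt (x := phaseOp X.H (Circle.exp θ)⁻¹ y)).comp_hasDerivAt
      θ (hy θ)
    have h1 := (hx θ).inner ℂ h2
    refine h1.congr_deriv ?_
    rw [← hinner, ← hinner]
    change ⟪_, B _⟫_ℂ + ⟪_, B _⟫_ℂ = _
    rw [map_smul, inner_smul_right, inner_smul_left, map_neg, Complex.conj_I]
    ring
  have hb : ∀ θ, ‖Complex.I * (⟪n, regularHom α X.π (dualAction α (Circle.exp θ) b) y⟫_ℂ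
      - ⟪x, regularHom α X.π (dualAction α (Circle.exp θ) b) n'⟫_ℂ)‖ ≤ M * ‖x‖ * ‖y‖ := by
    intro θ
    rw [norm_mul, Complex.norm_I, one_mul]
    exact norm_number_commutator_le α (commutatorBound_dualAction X α h _) hd hd'
  have hmv := convex_univ.norm_image_sub_le_of_norm_hasDerivWithin_le
    (fun θ _ => (hf θ).hasDerivWithinAt) (fun θ _ => hb θ) (Set.mem_univ 0) (Set.mem_univ θ)
  have h0 : f 0 = ⟪x, B y⟫_ℂ := by
    change ⟪phaseOp X.H (Circle.exp 0)⁻¹ x, B (phaseOp X.H (Circle.exp 0)⁻¹ y)⟫_ℂ = _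
    rw [Circle.exp_zero, inv_one, phaseOp_one]; rfl
  rw [h0, sub_zero, Real.norm_eq_abs] at hmv
  rw [map_sub, sub_apply, inner_sub_right, ← hinner]
  refine hmv.trans_eq ?_
  ring

theorem norm_dualAction_toCircle_sub_le {b : CrossedProduct α} {M : ℝ}
    (h : CommutatorBound (crossedDirac X) (regularHom α X.π b) M) (t : UnitAddCircle) :
    ‖dualAction α (AddCircle.toCircle t) b - b‖ ≤ 2 * Real.pi * M * ‖t‖ := by
  -- Subtracting the nearest integer gives the representative of least absolute value.
  obtain ⟨x, hx, rfl⟩ : ∃ x : ℝ, |x| = ‖t‖ ∧ (x : UnitAddCircle) = t := by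
    induction t using QuotientAddGroup.induction_on with
    | H z =>
      refine ⟨z - round z, (UnitAddCircle.norm_eq).symm, ?_⟩
      rw [QuotientAddGroup.mk_sub, sub_eq_self]
      exact (AddCircle.coe_eq_zero_iff 1).2 ⟨round z, by simp⟩
  rw [AddCircle.toCircle_apply_mk, ← hx]
  refine (norm_regularHom_dualAction_sub_le X α h _).trans_eq ?_
  rw [div_one, abs_mul, abs_of_pos Real.two_pi_pos]
  ring

end Rotation
end
end SpectralMetric

namespace SpectralMetric
noncomputable section

set_option linter.unusedSectionVars false

/-! ### Precompactness modulo scalars and on norm-bounded sets -/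

section CompactMetric

variable {B : Type v} [CStarAlgebra B] {X : SpectralTriple.{u} B}

namespace SpectralTriple

theorem mem_metricCommutant_iff {b : B} : b ∈ X.metricCommutant ↔ b ∈ X.lip 0 := by
  constructor
  · intro h
    exact ⟨0, h, norm_zero.le⟩
  · rintro ⟨T, hT, hT0⟩
    rw [norm_le_zero_iff.1 hT0] at hT
    exact hT

theorem span_one_subset_metricCommutant (X : SpectralTriple.{u} B) :
    ((Submodule.span ℂ {(1 : B)} : Submodule ℂ B) : Set B) ⊆ X.metricCommutant := by
  intro b hb
  obtain ⟨z, rfl⟩ := Submodule.mem_span_singleton.1 hb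
  exact mem_metricCommutant_iff.2 (smul_one_mem_lip z le_rfl)

theorem IsCompactMetric.exists_eq_smul_one (hX : X.IsCompactMetric) {b : B} (hb : b ∈ X.lip 0) :
    ∃ z : ℂ, b = z • (1 : B) := by
  have h := mem_metricCommutant_iff.2 hb
  rw [hX.commutant_trivial] at h
  obtain ⟨z, hz⟩ := Submodule.mem_span_singleton.1 h
  exact ⟨z, hz.symm⟩

theorem exists_norm_sub_smul_one_lt {b : B} {r : ℝ}
    (h : ‖(Submodule.span ℂ {(1 : B)}).mkQ b‖ < r) : ∃ z : ℂ, ‖b - z • (1 : B)‖ < r := by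
  obtain ⟨c, hc, hcr⟩ := QuotientAddGroup.norm_lt_iff.1 h
  have : b - c ∈ Submodule.span ℂ {(1 : B)} := (Submodule.Quotient.eq _).1 hc.symm
  obtain ⟨z, hz⟩ := Submodule.mem_span_singleton.1 this
  refine ⟨z, ?_⟩
  rwa [hz, sub_sub_cancel]

theorem IsCompactMetric.exists_norm_sub_le (hX : X.IsCompactMetric) :
    ∃ C : ℝ, 0 ≤ C ∧ ∀ b ∈ X.lip 1, ∃ z : ℂ, ‖b - z • (1 : B)‖ ≤ C := by
  obtain ⟨C, hC⟩ := hX.lipBall_precompact.isBounded.exists_norm_le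
  refine ⟨|C| + 1, by positivity, fun b hb => ?_⟩
  obtain ⟨z, hz⟩ := exists_norm_sub_smul_one_lt (b := b) (r := |C| + 1)
    (((hC _ (Set.mem_image_of_mem _ hb)).trans (le_abs_self C)).trans_lt (lt_add_one _))
  exact ⟨z, hz.le⟩

theorem totallyBounded_span_one (R : ℝ) :
    TotallyBounded {b : B | b ∈ Submodule.span ℂ {(1 : B)} ∧ ‖b‖ ≤ R} := by
  have h := (isCompact_closedBall (0 : Submodule.span ℂ {(1 : B)}) R).totallyBounded.image
    (Submodule.span ℂ {(1 : B)}).subtypeL.uniformContinuous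
  refine h.subset ?_
  rintro b ⟨hb, hbR⟩
  exact ⟨⟨b, hb⟩, by simpa using hbR, rfl⟩

/-- Lift a finite net of the quotient. The scalar left over is bounded because `b` and the lifts
are, and bounded sets of scalars are precompact. -/
theorem IsCompactMetric.totallyBounded_lip (hX : X.IsCompactMetric) (R : ℝ) :
    TotallyBounded {b : B | b ∈ X.lip 1 ∧ ‖b‖ ≤ R} := by
  refine totallyBounded_of_forall_approx fun ε hε => ?_
  obtain ⟨F, hF, hFX⟩ := Metric.totallyBounded_iff.1 hX.lipBall_precompact ε hε
  choose g hg using (Submodule.span ℂ {(1 : B)}).mkQ_surjective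
  obtain ⟨C, hC⟩ := (hF.image g).isBounded.exists_norm_le
  refine ⟨_, (hF.image g).totallyBounded.add_set (totallyBounded_span_one (R + C + ε)), ?_⟩
  rintro b ⟨hb, hbR⟩
  obtain ⟨q, hq, hbq⟩ := Set.mem_iUnion₂.1 (hFX (Set.mem_image_of_mem _ hb))
  rw [Metric.mem_ball, ← hg q, dist_eq_norm, ← map_sub] at hbq
  obtain ⟨z, hz⟩ := exists_norm_sub_smul_one_lt hbq
  refine ⟨g q + z • (1 : B), ⟨g q, Set.mem_image_of_mem _ hq, z • 1, ⟨Submodule.mem_span_singleton.2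
    ⟨z, rfl⟩, ?_⟩, rfl⟩, ?_⟩
  · have h1 : z • (1 : B) = b - g q - (b - g q - z • (1 : B)) := by abel
    rw [h1]
    refine (norm_sub_le _ _).trans (add_le_add ((norm_sub_le _ _).trans (add_le_add hbR ?_)) hz.le)
    exact hC _ (Set.mem_image_of_mem _ hq)
  · rwa [dist_eq_norm, ← sub_sub]

theorem totallyBounded_mkQ_lipBall {R : ℝ} (h : TotallyBounded {b : B | b ∈ X.lip 1 ∧ ‖b‖ ≤ R})
    (hR : ∀ b ∈ X.lip 1, ∃ z : ℂ, ‖b - z • (1 : B)‖ ≤ R) :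
    TotallyBounded ((Submodule.span ℂ {(1 : B)}).mkQ '' X.lipBall) := by
  have hlip : LipschitzWith 1 (Submodule.span ℂ {(1 : B)}).mkQ :=
    AddMonoidHomClass.lipschitz_of_bound_nnnorm _ 1 fun b => by
      rw [one_mul]; exact Submodule.Quotient.norm_mk_le _ b
  refine (h.image hlip.uniformContinuous).subset ?_
  rintro _ ⟨b, hb, rfl⟩
  obtain ⟨z, hz⟩ := hR b hb
  refine ⟨b - z • 1, ⟨?_, hz⟩, ?_⟩
  · rw [sub_eq_add_neg, ← neg_smul]
    exact add_smul_one_mem_lip _ hb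
  · rw [map_sub, sub_eq_self]
    exact (Submodule.Quotient.mk_eq_zero _).2 (Submodule.mem_span_singleton.2 ⟨z, rfl⟩)

end SpectralTriple

end CompactMetric

/-! ### Compactness of the spectral triple on the crossed product -/

section CrossedCompact

open CrossedProduct SpectralTriple

variable {A : Type u} [CStarAlgebra A] {X : SpectralTriple.{u} A} {α : A ≃⋆ₐ[ℂ] A}
  (h : X.IsEquicontinuousAut α)

theorem norm_monomial (k : ℤ) (a : A) : ‖(monomial k a : CrossedProduct α)‖ = ‖a‖ := by
  rw [monomial_apply, CStarRing.norm_mul_coe_unitary]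
  exact NonUnitalStarAlgHom.norm_map (embed α) (embed_injective α) a

theorem exists_coeff_eq_of_mem_lip {b : CrossedProduct α} {M : ℝ}
    (hb : b ∈ (crossedTriple X α h).lip M) (k : ℤ) :
    ∃ a ∈ X.lip M, ‖a‖ ≤ ‖b‖ ∧ coeff k b = monomial k a := by
  obtain ⟨a, ha⟩ := exists_coeff_eq_monomial (embed_injective α) k b
  refine ⟨a, ?_, ?_, ha⟩
  · have h1 : coeff k b ∈ (crossedTriple X α h).lip M :=
      coeff_mem_lip (fun z => commutatorBound_dualAction X α hb z) k
    rw [ha] at h1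
    exact lip_of_commutatorBound_monomial X α h1
  · rw [← norm_monomial k a, ← ha]
    exact norm_coeff_le k b

/-- The coefficient is the average of the orbit, and every orbit point is within `2 π M ‖t‖ ≤ π M`
of `b`. -/
theorem norm_coeff_zero_sub_le {b : CrossedProduct α} {M : ℝ}
    (hb : b ∈ (crossedTriple X α h).lip M) : ‖coeff 0 b - b‖ ≤ Real.pi * M := by
  rw [← dist_eq_norm, ← Metric.mem_closedBall]
  refine fourierCoeff_mem (continuous_orbit b) 0 (convex_closedBall _ _) Metric.isClosed_closedBall
    fun t => ?_
  rw [neg_zero, fourier_zero, one_smul, mem_closedBall_iff_norm]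
  refine (norm_dualAction_toCircle_sub_le X α hb t).trans ?_
  have ht : ‖t‖ ≤ 1 / 2 := by simpa using AddCircle.norm_le_half_period 1 (x := t) one_ne_zero
  have := lip_nonneg hb
  calc 2 * Real.pi * M * ‖t‖ ≤ 2 * Real.pi * M * (1 / 2) := by
        have := Real.pi_pos
        gcongr
    _ = _ := by ring

theorem totallyBounded_lip_crossedTriple (hX : X.IsCompactMetric) {R : ℝ} (hR : 0 ≤ R) :
    TotallyBounded {b | b ∈ (crossedTriple X α h).lip 1 ∧ ‖b‖ ≤ R} := by
  refine totallyBounded_of_forall_approx fun ε hε => ?_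
  have hpi := Real.pi_pos
  -- On `‖t‖ < δ` an element of the unit Lipschitz ball moves by at most `ε / 3`, and the kernel
  -- error times `R` is at most `ε / 3`; `R + 1` avoids dividing by zero.
  obtain ⟨c, hc⟩ := exists_fourier_approx (CrossedProduct α) (δ := ε / (3 * (2 * Real.pi)))
    (ε := ε / (3 * (R + 1))) (by positivity) (by positivity)
  let K : ℤ → Set (CrossedProduct α) := fun k =>
    (fun a => c k • monomial (-k) a) '' {a : A | a ∈ X.lip 1 ∧ ‖a‖ ≤ R}
  have hK : ∀ k ∈ c.support, TotallyBounded (K k) := fun k _ =>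
    (hX.totallyBounded_lip R).image (c k • (monomial (-k) : A →L[ℂ] CrossedProduct α)).uniformContinuous
  refine ⟨_, TotallyBounded.finset_sum c.support hK, ?_⟩
  rintro b ⟨hb, hbR⟩
  refine ⟨∑ k ∈ c.support, c k • coeff (-k) b, ⟨fun k => c k • coeff (-k) b, fun k _ => ?_, rfl⟩, ?_⟩
  · obtain ⟨a, ha, ha', hka⟩ := exists_coeff_eq_of_mem_lip h hb (-k)
    exact ⟨a, ⟨ha, ha'.trans hbR⟩, by simp only [hka]⟩
  · have h1 := hc (fun t => dualAction α (AddCircle.toCircle t) b) R (ε / 3) (continuous_orbit b)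
      (fun t => (norm_dualAction_le _ b).trans hbR) fun t ht => ?_
    · simp only [orbit_zero] at h1
      rw [dist_eq_norm]
      refine h1.trans_lt ?_
      have h2 : ε / (3 * (R + 1)) * R ≤ ε / 3 := by
        rw [div_mul_eq_mul_div, div_le_div_iff₀ (by positivity) (by norm_num)]
        nlinarith
      linarith
    · simp only [orbit_zero]
      refine (norm_dualAction_toCircle_sub_le X α hb t).trans ?_
      rw [lt_div_iff₀ (by positivity)] at ht
      linarith

theorem isCompactMetric_crossedTriple (hX : X.IsCompactMetric) :
    (crossedTriple X α h).IsCompactMetric := by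
  constructor
  · refine Set.Subset.antisymm (fun b hb => ?_) (span_one_subset_metricCommutant _)
    have hb0 := mem_metricCommutant_iff.1 hb
    obtain ⟨a, ha, -, hba⟩ := exists_coeff_eq_of_mem_lip h hb0 0
    obtain ⟨z, rfl⟩ := hX.exists_eq_smul_one ha
    -- With Lipschitz constant `0` this bound makes `b` equal to its zeroth coefficient, which is
    -- already known to be scalar.
    have h1 := norm_coeff_zero_sub_le h hb0
    rw [mul_zero, norm_le_zero_iff, sub_eq_zero] at h1
    rw [← h1, hba, monomial_zero, map_smul, map_one]
    exact Submodule.mem_span_singleton.2 ⟨z, rfl⟩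
  · obtain ⟨C, hC, hCX⟩ := hX.exists_norm_sub_le
    have hpi := Real.pi_pos
    refine totallyBounded_mkQ_lipBall (R := Real.pi + C)
      (totallyBounded_lip_crossedTriple h hX (by positivity)) fun b hb => ?_
    obtain ⟨a, ha, -, hba⟩ := exists_coeff_eq_of_mem_lip h hb 0
    obtain ⟨z, hz⟩ := hCX a ha
    refine ⟨z, ?_⟩
    have h1 : b - z • 1 = -(coeff 0 b - b) + embed α (a - z • 1) := by
      rw [hba, monomial_zero, map_sub, map_smul, map_one]
      abel
    rw [h1]
    refine (norm_add_le _ _).trans (add_le_add ?_ ?_)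
    · rw [norm_neg]
      simpa using norm_coeff_zero_sub_le h hb
    · exact (NonUnitalStarAlgHom.norm_apply_le (embed α) _).trans hz

end CrossedCompact
end
end SpectralMetric

namespace SpectralMetric
noncomputable section

set_option linter.unusedSectionVars false

/-! ### Equicontinuity and equivalence of the Connes metrics -/

section Equicontinuity

open CrossedProduct SpectralTriple

section Transfer

variable {A : Type v} [CStarAlgebra A] {B₁ B₂ : Type*} [CStarAlgebra B₁] [CStarAlgebra B₂]
  {Y₁ : SpectralTriple.{u} B₁} {j₁ : A →⋆ₐ[ℂ] B₁} {Y₂ : SpectralTriple.{u} B₂} {j₂ : A →⋆ₐ[ℂ] B₂}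

theorem lip_mul_of_forall_lip_one {K M : ℝ} (h : ∀ a, j₁ a ∈ Y₁.lip 1 → j₂ a ∈ Y₂.lip K)
    (hM : 0 < M) {a : A} (ha : j₁ a ∈ Y₁.lip M) : j₂ a ∈ Y₂.lip (M * K) := by
  have hM' : (M : ℂ) ≠ 0 := Complex.ofReal_ne_zero.2 hM.ne'
  have h1 : j₁ ((M : ℂ)⁻¹ • a) ∈ Y₁.lip 1 := by
    have := lip_smul (M : ℂ)⁻¹ ha
    rwa [norm_inv, Complex.norm_real, Real.norm_of_nonneg hM.le, inv_mul_cancel₀ hM.ne',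
      ← map_smul] at this
  have h2 := lip_smul (M : ℂ) (h _ h1)
  rwa [← map_smul, smul_smul, mul_inv_cancel₀ hM', one_smul, Complex.norm_real,
    Real.norm_of_nonneg hM.le] at h2

theorem inducedConnesDist_le_mul {K : ℝ≥0} (hK : 0 < K)
    (h : ∀ a, j₁ a ∈ Y₁.lip 1 → j₂ a ∈ Y₂.lip K) (ρ ω : A →L[ℂ] ℂ) :
    inducedConnesDist Y₁ j₁ ρ ω ≤ K * inducedConnesDist Y₂ j₂ ρ ω := by
  refine iSup₂_le fun a ha => ?_
  have hK' : ((K : ℝ) : ℂ) ≠ 0 := Complex.ofReal_ne_zero.2 (NNReal.coe_pos.2 hK).ne'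
  have hn : ‖((K : ℝ) : ℂ)‖ = K := by rw [Complex.norm_real, NNReal.norm_eq]
  have h1 : j₂ (((K : ℝ) : ℂ)⁻¹ • a) ∈ Y₂.lip 1 := by
    have := lip_smul ((K : ℝ) : ℂ)⁻¹ (h a ha)
    rwa [norm_inv, hn, inv_mul_cancel₀ (NNReal.coe_pos.2 hK).ne', ← map_smul] at this
  have h2 := norm_sub_le_inducedConnesDist (ρ := ρ) (ω := ω) h1
  have h3 : ρ a - ω a =
      ((K : ℝ) : ℂ) • (ρ (((K : ℝ) : ℂ)⁻¹ • a) - ω (((K : ℝ) : ℂ)⁻¹ • a)) := by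
    rw [smul_sub, ← map_smul, ← map_smul, smul_smul, mul_inv_cancel₀ hK', one_smul]
  rw [h3, ← ofReal_norm, norm_smul, hn, ENNReal.ofReal_mul NNReal.zero_le_coe,
    ENNReal.ofReal_coe_nnreal]
  gcongr

end Transfer

variable {A : Type u} [CStarAlgebra A] {α : A ≃⋆ₐ[ℂ] A}

/-- An equicontinuous action on a compact spectral metric space is uniformly Lipschitz. -/
theorem exists_forall_zpow_mem_lip {X : SpectralTriple.{u} A} (hX : X.IsCompactMetric)
    (h : X.IsEquicontinuousAut α) :
    ∃ K : ℝ≥0, 0 < K ∧ ∀ a ∈ X.lip 1, ∀ n : ℤ, (α ^ n) a ∈ X.lip K := by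
  obtain ⟨C, hC, hCX⟩ := hX.exists_norm_sub_le
  let L : Set A := {a | a ∈ X.lip 1 ∧ ‖a‖ ≤ C}
  have hL : IsClosed L := (X.isClosed_lip 1).inter (isClosed_le continuous_norm continuous_const)
  have hL0 : (0 : A) ∈ L :=
    ⟨by simpa using smul_one_mem_lip (X := X) 0 zero_le_one, by simpa using hC⟩
  have : CompleteSpace L := hL.completeSpace_coe
  have : Nonempty L := ⟨⟨0, hL0⟩⟩
  let F : ℕ → Set L := fun m => {a | ∀ n : ℤ, (α ^ n) (a : A) ∈ X.lip m}
  have hF : ∀ m, IsClosed (F m) := by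
    intro m
    have : F m = ⋂ n : ℤ, (fun a : L => (α ^ n) (a : A)) ⁻¹' X.lip m := by
      ext a; simp [F]
    rw [this]
    refine isClosed_iInter fun n => (X.isClosed_lip m).preimage ?_
    exact (continuous_starAlgHom ((α ^ n : A ≃⋆ₐ[ℂ] A) : A →⋆ₐ[ℂ] A)).comp continuous_subtype_val
  have hU : ⋃ m, F m = Set.univ := by
    refine Set.eq_univ_of_forall fun a => ?_
    obtain ⟨M, hM⟩ := mem_C1_iff_of_isEquicontinuousAut h ((X.mem_C1_iff).2 ⟨1, a.2.1⟩)
    obtain ⟨m, hm⟩ := exists_nat_ge M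
    exact Set.mem_iUnion.2 ⟨m, fun n => lip_mono (hM n) hm⟩
  -- Baire category: `L` is complete and is covered by closed sets on which the whole orbit has
  -- Lipschitz constant at most `m`.
  obtain ⟨m, a₀, ha₀⟩ := nonempty_interior_of_iUnion_of_closed hF hU
  obtain ⟨ε, hε, hball⟩ := Metric.isOpen_iff.1 isOpen_interior a₀ ha₀
  have hball' : ∀ a ∈ L, ‖a - a₀‖ < ε → ∀ n : ℤ, (α ^ n) a ∈ X.lip m := by
    intro a ha hd
    exact interior_subset (hball (a := ⟨a, ha⟩) (by
      rwa [Metric.mem_ball, Subtype.dist_eq, dist_eq_norm]))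
  have hconv : Convex ℝ L := by
    refine (convex_lip X 1).inter ?_
    intro a ha b hb s t hs ht hst
    have := convex_closedBall (0 : A) C (mem_closedBall_zero_iff.2 ha)
      (mem_closedBall_zero_iff.2 hb) hs ht hst
    exact mem_closedBall_zero_iff.1 this
  -- `L` has diameter at most `2 * C`, so shrinking by `t` towards `a₀` brings all of the convex set
  -- `L` into the ball where the bound `m` holds; undoing the shrinking gives the constant below.
  obtain ⟨t, ht0, ht1, htε⟩ : ∃ t : ℝ, 0 < t ∧ t ≤ 1 ∧ t * (2 * C) < ε := by
    refine ⟨min 1 (ε / (2 * C + 1)), by positivity, min_le_left _ _, ?_⟩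
    calc min 1 (ε / (2 * C + 1)) * (2 * C) ≤ ε / (2 * C + 1) * (2 * C) := by
          gcongr; exact min_le_right _ _
      _ < ε := by
          rw [div_mul_eq_mul_div, div_lt_iff₀ (by positivity)]
          nlinarith
  have hLK : ∀ a ∈ L, ∀ n : ℤ, (α ^ n) a ∈ X.lip (t⁻¹ * (m + m) + m) := by
    intro a ha n
    have h1 : (a₀ : A) + t • (a - a₀) ∈ L := hconv.add_smul_sub_mem a₀.2 ha ⟨ht0.le, ht1⟩
    have h2 := hball' _ h1 (by
      rw [add_sub_cancel_left, norm_smul, Real.norm_of_nonneg ht0.le]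
      refine lt_of_le_of_lt ?_ htε
      gcongr
      refine (norm_sub_le _ _).trans ?_
      linarith [ha.2, a₀.2.2]) n
    have h3 := hball' a₀ a₀.2 (by simpa using hε) n
    have h4 := lip_smul ((t⁻¹ : ℝ) : ℂ) (lip_sub h2 h3)
    rw [Complex.norm_real, Real.norm_of_nonneg (inv_nonneg.2 ht0.le), ← map_sub, add_sub_cancel_left,
      ← map_smul, ← Complex.coe_smul, smul_smul, ← Complex.ofReal_mul, inv_mul_cancel₀ ht0.ne',
      Complex.ofReal_one, one_smul, map_sub] at h4
    simpa using lip_add h4 h3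
  have hK : 0 < t⁻¹ * (m + m) + m + 1 := by positivity
  refine ⟨Real.toNNReal (t⁻¹ * (m + m) + m + 1), Real.toNNReal_pos.2 hK, fun a ha n => ?_⟩
  rw [Real.coe_toNNReal _ hK.le]
  obtain ⟨z, hz⟩ := hCX a ha
  have h1 : a - z • 1 ∈ L := by
    refine ⟨?_, hz⟩
    rw [sub_eq_add_neg, ← neg_smul]
    exact add_smul_one_mem_lip _ ha
  have h2 := add_smul_one_mem_lip z (hLK _ h1 n)
  rw [map_sub, map_smul, map_one, sub_add_cancel] at h2
  exact lip_mono h2 (by linarith)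

/-- The uniform Lipschitz constant of the orbits controls the commutator in `Y` by that in `X`;
conversely the estimate for the monomial with `k = 0` loses nothing. -/
theorem equivalentConnesMetrics_crossedTriple {X : SpectralTriple.{u} A} (hX : X.IsCompactMetric)
    (h : X.IsEquicontinuousAut α) :
    EquivalentConnesMetrics X (crossedTriple X α h) (embed α) := by
  obtain ⟨K, hK, hKX⟩ := exists_forall_zpow_mem_lip hX h
  refine ⟨max K 1, fun ρ ω _ _ => ⟨?_, ?_⟩⟩
  · refine inducedConnesDist_le_mul (lt_max_of_lt_left hK) (fun a ha => ?_) ρ ω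
    exact commutatorBound_regularHom_embed X α fun n =>
      lip_mono (hKX a ha n) (NNReal.coe_le_coe.2 (le_max_left _ _))
  · refine inducedConnesDist_le_mul (lt_max_of_lt_left hK) (fun a ha => ?_) ρ ω
    rw [← monomial_zero] at ha
    exact lip_mono (lip_of_commutatorBound_monomial X α ha)
      (by rw [NNReal.coe_max, NNReal.coe_one]; exact le_max_right _ _)

section Cocycle

variable {Y : SpectralTriple.{u} (CrossedProduct α)}

/-- From `[D, U U*] = 0` one gets `[D, U*] = -U* T U*`, whence `[D, U S U*] = U (R + [U* T, S]) U*`,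
and the last bracket vanishes by assumption. The inverse conjugation is analogous. -/
theorem isCommutator_conj {H : Type*} [NormedAddCommGroup H] [InnerProductSpace ℂ H]
    [CompleteSpace H] {D : H →ₗ.[ℂ] H} (hD : IsSelfAdjoint D) {U T S R : H →L[ℂ] H}
    (hU : U ∈ unitary (H →L[ℂ] H)) (hT : IsCommutator D U T) (hS : IsCommutator D S R) :
    (Commute (star U * T) S → IsCommutator D (U * S * star U) (U * R * star U)) ∧
    (Commute (star U * T) (star U * S * U) →
      IsCommutator D (star U * S * U) (star U * R * U)) := by
  have h1 := (hT.mul hD (hT.star hD)).unique hD (T' := 0) (by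
    rw [hU.2]; exact IsCommutator.one hD)
  have h2 : -star T = -(star U * (T * star U)) := by
    have := congrArg (fun V => star U * V) h1
    simp only [mul_add, mul_zero, ← mul_assoc, hU.1, one_mul] at this
    rw [eq_neg_iff_add_eq_zero, ← mul_assoc]
    exact this
  have h3 := hT.star hD
  rw [h2] at h3
  constructor
  · intro hc
    have h4 := (hT.mul hD hS).mul hD h3
    have h5 : U * S * -(star U * (T * star U)) + (U * R + T * S) * star U = U * R * star U := by
      have : T * S * star U = U * S * (star U * (T * star U)) := by
        calc T * S * star U = U * star U * T * S * star U := by rw [hU.2, one_mul]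
          _ = U * (star U * T * S) * star U := by simp only [mul_assoc]
          _ = U * (S * (star U * T)) * star U := by rw [hc.eq]
          _ = _ := by simp only [mul_assoc]
      rw [add_mul, this, mul_neg]
      abel
    rwa [h5] at h4
  · intro hc
    have h4 := (h3.mul hD hS).mul hD hT
    have h5 : star U * S * T + (star U * R + -(star U * (T * star U)) * S) * U =
        star U * R * U := by
      have : star U * S * T = star U * (T * star U) * S * U := by
        calc star U * S * T = star U * S * (U * star U) * T := by rw [hU.2, mul_one]
          _ = (star U * S * U) * (star U * T) := by simp only [mul_assoc]
          _ = (star U * T) * (star U * S * U) := hc.eq.symm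
          _ = _ := by simp only [mul_assoc]
      rw [add_mul, this, neg_mul, neg_mul]
      abel
    rwa [h5] at h4

/-- Conjugation by `u` transports the commutator unitarily in both directions, so its norm is
preserved along the orbit. -/
theorem embed_zpow_mem_lip (hY : BoundedCommutingCocycle α Y) {a : A} {M : ℝ}
    (ha : embed α a ∈ Y.lip M) (n : ℤ) : embed α ((α ^ n) a) ∈ Y.lip M := by
  obtain ⟨T, hT, hTA⟩ := hY
  have hU : Y.π (u α) ∈ unitary (Y.H →L[ℂ] Y.H) := Unitary.map_mem Y.π (u_mem_unitary α)
  have hconj : ∀ a, Y.π (u α) * Y.π (embed α a) * star (Y.π (u α)) = Y.π (embed α (α a)) := by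
    intro a
    rw [← map_star, ← map_mul, ← map_mul, u_mul_embed_mul_star]
  have hconj' : ∀ a, star (Y.π (u α)) * Y.π (embed α (α a)) * Y.π (u α) = Y.π (embed α a) := by
    intro a
    rw [← hconj, ← mul_assoc, ← mul_assoc, hU.1, one_mul, mul_assoc, hU.1, mul_one]
  simp only [map_star] at hTA
  have hsucc : ∀ a, embed α a ∈ Y.lip M → embed α (α a) ∈ Y.lip M := by
    rintro a ⟨R, hR, hRM⟩
    have := (isCommutator_conj Y.isSelfAdjoint hU hT hR).1 (hTA a)
    rw [hconj] at this
    exact ⟨_, this, by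
      rwa [CStarRing.norm_mul_mem_unitary _ (Unitary.star_mem hU),
        CStarRing.norm_mem_unitary_mul _ hU]⟩
  have hpred : ∀ a, embed α (α a) ∈ Y.lip M → embed α a ∈ Y.lip M := by
    rintro a ⟨R, hR, hRM⟩
    have := (isCommutator_conj Y.isSelfAdjoint hU hT hR).2 (by rw [hconj']; exact hTA a)
    rw [hconj'] at this
    exact ⟨_, this, by
      rwa [CStarRing.norm_mul_mem_unitary _ hU,
        CStarRing.norm_mem_unitary_mul _ (Unitary.star_mem hU)]⟩
  induction n using Int.induction_on with
  | zero => rw [zpow_zero]; exact ha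
  | succ i ih =>
    rw [add_comm, zpow_one_add]
    exact hsucc _ ih
  | pred i ih =>
    refine hpred _ ?_
    have : α ((α ^ (-(i : ℤ) - 1)) a) = (α ^ (-(i : ℤ))) a := by
      have h1 : α ^ (-(i : ℤ)) = α * α ^ (-(i : ℤ) - 1) := by
        rw [← zpow_one_add, add_sub_cancel]
      rw [h1]
      rfl
    rwa [this]

theorem isEquicontinuousAut_of_equivalentConnesMetrics {X : SpectralTriple.{u} A}
    (hY : BoundedCommutingCocycle α Y) (hXY : EquivalentConnesMetrics X Y (embed α)) :
    X.IsEquicontinuousAut α := by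
  obtain ⟨K, hK⟩ := hXY
  refine Set.Subset.antisymm (fun a ha => ?_) ?_
  · obtain ⟨M, hM⟩ := (X.mem_C1_iff).1 ha
    have hM0 : 0 < M + 1 := by linarith [lip_nonneg hM]
    have h1 : embed α a ∈ Y.lip ((M + 1) * (2 * (K + 1))) :=
      lip_mul_of_forall_lip_one (Y₁ := X) (j₁ := StarAlgHom.id ℂ A)
        (fun a ha => lip_of_inducedConnesDist_le (fun ρ ω hρ hω => (hK ρ ω hρ hω).1) ha) hM0
        (lip_mono hM (by linarith))
    -- One factor `2 * (K + 1)` is paid for passing to `Y`, where the seminorm is `α`-invariant, and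
    -- one for coming back.
    have h2 : ∀ n : ℤ, (α ^ n) a ∈ X.lip ((M + 1) * (2 * (K + 1)) * (2 * (K + 1))) := fun n =>
      lip_mul_of_forall_lip_one (Y₂ := X) (j₂ := StarAlgHom.id ℂ A)
        (fun a ha => lip_of_inducedConnesDist_le (fun ρ ω hρ hω => (hK ρ ω hρ hω).2) ha)
        (by positivity) (embed_zpow_mem_lip hY h1 n)
    choose T hT hTM using h2
    exact ⟨⟨fun g => T g.toAdd, fun g => hT g.toAdd, fun x => continuous_of_discreteTopology⟩,
      _, fun g => ⟨T g.toAdd, hT g.toAdd, hTM g.toAdd⟩⟩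
  · rintro a ⟨⟨T, hT, -⟩, -⟩
    refine ⟨T 1, ?_⟩
    have := hT 1
    rwa [map_one] at this

end Cocycle

end Equicontinuity
end
end SpectralMetric

namespace SpectralMetric
noncomputable section

set_option linter.unusedSectionVars false

/-! ### Restricting a spectral triple to `A` -/

section Restriction

open CrossedProduct SpectralTriple

variable {A : Type u} [CStarAlgebra A] {α : A ≃⋆ₐ[ℂ] A} (Y : SpectralTriple.{u} (CrossedProduct α))

/-- The commutators are strongly continuous on the compact circle, hence pointwise bounded, and the
uniform boundedness principle bounds their norms. -/
theorem exists_forall_dualAction_mem_lip {Y : SpectralTriple.{u} (CrossedProduct α)}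
    (hY : Y.IsQuasiIsometric (dualAction α)) {b : CrossedProduct α} (hb : b ∈ Y.C1) :
    ∃ M, ∀ z, dualAction α z b ∈ Y.lip M := by
  have h : b ∈ Y.C1Action (dualAction α) := by rw [← hY]; exact hb
  obtain ⟨T, hT, hTc⟩ := h
  obtain ⟨M, hM⟩ := banach_steinhaus (g := T) fun x => by
    obtain ⟨C, hC⟩ := (isCompact_range (hTc x)).isBounded.exists_norm_le
    exact ⟨C, fun z => hC _ (Set.mem_range_self z)⟩
  exact ⟨M, fun z => ⟨T z, hT z, hM z⟩⟩

/-- Approximate `a` by an element of the crossed product with bounded commutator and take the zeroth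
coefficient, a contraction that fixes `A` and preserves Lipschitz bounds valid along the whole dual
orbit. -/
theorem dense_commutator_embed {Y : SpectralTriple.{u} (CrossedProduct α)}
    (hY : Y.IsQuasiIsometric (dualAction α)) :
    Dense {a | ∃ T, IsCommutator Y.D (Y.π.comp (embed α) a) T} := by
  refine Metric.dense_iff.2 fun a ε hε => ?_
  obtain ⟨b, hb, hbY⟩ := Metric.dense_iff.1 Y.dense_bounded_commutator (embed α a) ε hε
  obtain ⟨M, hM⟩ := exists_forall_dualAction_mem_lip hY hbY
  obtain ⟨c, hc⟩ := exists_coeff_eq_monomial (embed_injective α) 0 b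
  have h1 := coeff_mem_lip hM 0
  rw [hc, monomial_zero] at h1
  obtain ⟨T, hT, -⟩ := h1
  refine ⟨c, ?_, T, hT⟩
  have h2 : embed α (c - a) = coeff 0 (b - embed α a) := by
    rw [← coeffL_apply, map_sub, map_sub, coeffL_apply, coeffL_apply, hc, ← monomial_zero a,
      coeff_monomial, if_pos rfl, monomial_zero, monomial_zero]
  rw [Metric.mem_ball, dist_eq_norm] at hb ⊢
  rw [← NonUnitalStarAlgHom.norm_map (embed α) (embed_injective α), h2]
  exact (norm_coeff_le 0 _).trans_lt hb

/-- The restriction to `A` of a spectral triple on the crossed product. -/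
def restrictedTriple (hY : Y.IsQuasiIsometric (dualAction α)) : SpectralTriple.{u} A where
  H := Y.H
  π := Y.π.comp (embed α)
  π_injective := Y.π_injective.comp (embed_injective α)
  D := Y.D
  isSelfAdjoint := Y.isSelfAdjoint
  hasCompactResolvent := Y.hasCompactResolvent
  dense_bounded_commutator := dense_commutator_embed hY

variable {Y} (hY : Y.IsQuasiIsometric (dualAction α))

/-- The isometry `embed α` carries the Lipschitz ball of `A` into that of `Y`, so precompactness
pulls back; scalars of the crossed product that come from `A` are scalars of `A`. -/
theorem isCompactMetric_restrictedTriple (h : Y.IsCompactMetric) :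
    (restrictedTriple Y hY).IsCompactMetric := by
  have hiso : Isometry (embed α) := AddMonoidHomClass.isometry_of_norm _
    (NonUnitalStarAlgHom.norm_map (embed α) (embed_injective α))
  have hone : ∀ (a : A) (z : ℂ), embed α a - z • 1 = embed α (a - z • 1) := fun a z => by
    rw [map_sub, map_smul, map_one]
  constructor
  · refine Set.Subset.antisymm (fun a ha => ?_) (span_one_subset_metricCommutant _)
    obtain ⟨z, hz⟩ := h.exists_eq_smul_one (b := embed α a) (mem_metricCommutant_iff.1 ha)
    refine Submodule.mem_span_singleton.2 ⟨z, embed_injective α ?_⟩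
    rw [hz, map_smul, map_one]
  · obtain ⟨C, -, hC⟩ := h.exists_norm_sub_le
    refine totallyBounded_mkQ_lipBall (R := C) ?_ fun a ha => ?_
    · refine (totallyBounded_preimage hiso.isUniformInducing (h.totallyBounded_lip C)).subset ?_
      rintro a ⟨ha, haC⟩
      exact ⟨ha, (NonUnitalStarAlgHom.norm_apply_le (embed α) a).trans haC⟩
    · obtain ⟨z, hz⟩ := hC (embed α a) ha
      refine ⟨z, ?_⟩
      rwa [hone, NonUnitalStarAlgHom.norm_map (embed α) (embed_injective α)] at hz

theorem equivalentConnesMetrics_restrictedTriple :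
    EquivalentConnesMetrics (restrictedTriple Y hY) Y (embed α) :=
  ⟨1, fun ρ ω _ _ => by
    rw [ENNReal.coe_one, one_mul, one_mul]
    exact ⟨le_rfl, le_rfl⟩⟩

end Restriction
end
end SpectralMetric

open SpectralMetric in
theorem mainTheorem1 {A : Type u} [CStarAlgebra A] [TopologicalSpace.SeparableSpace A]
    (α : A ≃⋆ₐ[ℂ] A) :
    ((∃ X : SpectralTriple.{u} A, X.IsCompactMetric ∧ X.IsEquicontinuousAut α) ↔
      ∃ (X : SpectralTriple.{u} A) (Y : SpectralTriple.{u} (CrossedProduct α)),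
        X.IsCompactMetric ∧ Y.IsCompactMetric ∧
        Y.IsQuasiIsometric (CrossedProduct.dualAction α) ∧
        BoundedCommutingCocycle α Y ∧
        EquivalentConnesMetrics X Y (CrossedProduct.embed α)) ∧
    (∀ X : SpectralTriple.{u} A, X.IsCompactMetric →
      (X.IsEquicontinuousAut α ↔
        ∃ Y : SpectralTriple.{u} (CrossedProduct α), Y.IsCompactMetric ∧
          Y.IsQuasiIsometric (CrossedProduct.dualAction α) ∧
          BoundedCommutingCocycle α Y ∧
          EquivalentConnesMetrics X Y (CrossedProduct.embed α))) ∧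
    (∀ Y : SpectralTriple.{u} (CrossedProduct α), Y.IsCompactMetric →
      Y.IsQuasiIsometric (CrossedProduct.dualAction α) →
      BoundedCommutingCocycle α Y →
      ∃ X : SpectralTriple.{u} A, X.IsCompactMetric ∧ X.IsEquicontinuousAut α ∧
        EquivalentConnesMetrics X Y (CrossedProduct.embed α)) := by
  have hb : ∀ X : SpectralTriple.{u} A, X.IsCompactMetric →
      (X.IsEquicontinuousAut α ↔
        ∃ Y : SpectralTriple.{u} (CrossedProduct α), Y.IsCompactMetric ∧
          Y.IsQuasiIsometric (CrossedProduct.dualAction α) ∧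
          BoundedCommutingCocycle α Y ∧
          EquivalentConnesMetrics X Y (CrossedProduct.embed α)) := by
    intro X hX
    constructor
    · intro h
      exact ⟨crossedTriple X α h, isCompactMetric_crossedTriple h hX,
        isQuasiIsometric_crossedTriple X α h, boundedCommutingCocycle_crossedTriple X α h,
        equivalentConnesMetrics_crossedTriple hX h⟩
    · rintro ⟨Y, -, -, hY, hXY⟩
      exact isEquicontinuousAut_of_equivalentConnesMetrics hY hXY
  refine ⟨⟨?_, ?_⟩, hb, fun Y hY hq hc => ?_⟩
  · rintro ⟨X, hX, h⟩
    obtain ⟨Y, hY⟩ := (hb X hX).1 h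
    exact ⟨X, Y, hX, hY⟩
  · rintro ⟨X, Y, hX, hY⟩
    exact ⟨X, hX, (hb X hX).2 ⟨Y, hY⟩⟩
  · exact ⟨restrictedTriple Y hq, isCompactMetric_restrictedTriple hq hY,
      isEquicontinuousAut_of_equivalentConnesMetrics hc (equivalentConnesMetrics_restrictedTriple hq),
      equivalentConnesMetrics_restrictedTriple hq⟩
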